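/- Let $N\ge 2$ and let $F_N=F(A)$ be the free group with free basis $A=\{a_1,\dots,a_N\}$; write $|g|_A$ for the freely reduced length of $g\in F_N$ over $A$. A nontrivial element of a free group $H$ is called primitive in $H$ if it belongs to some free basis of $H$, and simple in $H$ if it belongs to a proper free factor of $H$. For $1\ne g\in F_N$ let $d_{prim}(g)$ (respectively $d_{simp}(g)$) be the smallest index $[F_N:H]$ of a finite index subgroup $H\le F_N$ such that $g\in H$ and $g$ is primitive (respectively simple) in $H$. For $n\ge 1$ let $f_{prim}(n)$ (respectively $f_{simp}(n)$) be the maximum of $d_{prim}(g)$ (respectively $d_{simp}(g)$) over all $1\neq g\in F_N$ with $|g|_A\le n$ that are not proper powers in $F_N$. All these minima and maxima exist, and: 1. There exists an algorithm that, given $1\ne g\in F_N$ as a word in the letters $A\sqcup A^{-1}$, computes $d_{prim}(g)$ and $d_{simp}(g)$. 2. There exists an algorithm that, given $n\ge 1$, computes $f_{prim}(n)$ and $f_{simp}(n)$. -/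

import Mathlib

/-- `g` is a primitive element of `G`: it is nontrivial and belongs to some free basis of `G`. -/
def IsPrimitiveElt {G : Type*} [Group G] (g : G) : Prop :=
  g ≠ 1 ∧ ∃ B : Set G, g ∈ B ∧ ∃ b : FreeGroupBasis B G, ∀ x : B, b x = x

/-- `K` is a free factor of `G`: there is a subgroup `L` such that `G` is the internal free
product of `K` and `L`, i.e. the canonical map from the abstract free product is bijective. -/
def IsFreeFactor {G : Type*} [Group G] (K : Subgroup G) : Prop :=
  ∃ L : Subgroup G, Function.Bijective (Monoid.Coprod.lift K.subtype L.subtype)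

/-- `g` is a simple element of `G`: it is nontrivial and belongs to a proper free factor of `G`. -/
def IsSimpleElt {G : Type*} [Group G] (g : G) : Prop :=
  g ≠ 1 ∧ ∃ K : Subgroup G, IsFreeFactor K ∧ K ≠ ⊤ ∧ g ∈ K

/-- `g` is a proper power in `G`. -/
def IsProperPower {G : Type*} [Group G] (g : G) : Prop :=
  ∃ (h : G) (k : ℕ), 2 ≤ k ∧ h ^ k = g

/-- `d` is the primitivity index `d_prim(g)`: the smallest index of a finite index subgroup `H`
of `G` that contains `g` as a primitive element of `H`. -/
def IsPrimitivityIndex {G : Type*} [Group G] (g : G) (d : ℕ) : Prop :=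
  IsLeast {m : ℕ | ∃ H : Subgroup G, H.FiniteIndex ∧ H.index = m ∧
    ∃ hg : g ∈ H, IsPrimitiveElt (⟨g, hg⟩ : H)} d

/-- `d` is the simplicity index `d_simp(g)`: the smallest index of a finite index subgroup `H`
of `G` that contains `g` as a simple element of `H`. -/
def IsSimplicityIndex {G : Type*} [Group G] (g : G) (d : ℕ) : Prop :=
  IsLeast {m : ℕ | ∃ H : Subgroup G, H.FiniteIndex ∧ H.index = m ∧
    ∃ hg : g ∈ H, IsSimpleElt (⟨g, hg⟩ : H)} d

/-- `m = f_prim(n)` for the free group of rank `N`: the maximum of `d_prim(g)` over all `g ≠ 1`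
of freely reduced length at most `n` that are not proper powers. -/
def IsPrimitivityIndexFnValue (N n m : ℕ) : Prop :=
  IsGreatest {d : ℕ | ∃ g : FreeGroup (Fin N), g ≠ 1 ∧ g.norm ≤ n ∧ ¬ IsProperPower g ∧
    IsPrimitivityIndex g d} m

/-- `m = f_simp(n)` for the free group of rank `N`: the maximum of `d_simp(g)` over all `g ≠ 1`
of freely reduced length at most `n` that are not proper powers. -/
def IsSimplicityIndexFnValue (N n m : ℕ) : Prop :=
  IsGreatest {d : ℕ | ∃ g : FreeGroup (Fin N), g ≠ 1 ∧ g.norm ≤ n ∧ ¬ IsProperPower g ∧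
    IsSimplicityIndex g d} m

/-!
Both indices are computed by a bounded search over finite labelled graphs, in the spirit of
Stallings foldings. A word `w` spells a closed path; identifying vertices turns this path into
further labelled graphs. An identification of two vertices either is a folding, which does not
change the group of labels of closed paths at the base point, or it adds at most one generator to
that group. A folded connected graph with `m` vertices is part of the Schreier graph of a subgroup
`H` of index `m` (Marshall Hall), and completing it costs one more generator for each missing edge.

Suppose a closed path spelling `w` is identified in this way to a folded graph with `m` vertices,
and that its first Betti number `|E| - |V| + 1` grows by at least the number of the identifications
that are not foldings (`LeadsTo`). Counting generators, `H` then has a generating set of at most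
`1 + m (|A| - 1)` elements that contains a generating set of the closed paths of the original graph.
By Schreier's inequality (`card_mul_card_add_one_le`) the rank of `H` is at least this number, and
since finitely generated free groups are Hopfian (`FreeGroup.injective_of_surjective`), the
generating set is a free basis (`FreeGroupBasis.exists_basis_of_generators`,
`MergeChain.exists_basis`). If the path is a circle, then `w` itself is one of the generators, so it
is primitive in `H`; if the path is arbitrary but its Betti number is less than the rank of `H`,
then `w` lies in the free factor generated by a proper part of the basis, so it is simple in `H`.

Conversely, let `w` be primitive or simple in a subgroup `H` of finite index. Then `w` belongs to a
generating set `B` of minimal size `r` of `H`, or to the subgroup generated by a proper part of one.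
Spelling the elements of `B` along loops gives a graph with Betti number `r` and whole group of
closed paths `H`. Folding it keeps the group, and by minimality it never lowers the Betti number, so
that each folding identifies exactly one pair of edges (`exists_mergeChain`). Following the
subgraph that spells `w` through this process gives a sequence of identifications as above, and its
final graph embeds in the Schreier graph of `H`, so that it has at most `[F : H]` vertices. In the
simple case one starts from the closed path spelling `w` in the folded graph of the proper part of
`B`. Hence the least `m` found by the search is the index in question
(`isPrimitivityIndex_iff`, `isSimplicityIndex_iff`).

Up to relabelling, the vertices of all graphs involved are among `0, …, |w| - 1`, so the search is
bounded, and even primitive recursive. The index functions are maxima over finitely many words, once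
it is decided which of them are proper powers: an element `h ≠ 1` with `h ^ k = g` has length at
most `|g|`, and `k ≤ |g|` (`FreeGroup.norm_le_norm_pow`, `FreeGroup.le_norm_pow`).
-/

open Function

/-! ### Generating sets and free bases -/

/-- The number of elements on which homomorphisms to `ℤ/2` can be prescribed freely is at most the
number of generators: a homomorphism is determined by its values on the generators. -/
theorem finite_and_card_le_of_generators {G ι : Type*} [Group G] (b : ι → G)
    (hb : ∀ f : ι → Multiplicative (ZMod 2), ∃ φ : G →* Multiplicative (ZMod 2), ∀ i, φ (b i) = f i)
    (S : Finset G) (hS : Subgroup.closure (S : Set G) = ⊤) : Finite ι ∧ Nat.card ι ≤ S.card := by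
  classical
  choose φ hφ using hb
  have hinj : Injective fun (f : ι → Multiplicative (ZMod 2)) (s : S) => φ f s := by
    intro f g h
    have : φ f = φ g := MonoidHom.eq_of_eqOn_dense hS fun x hx => congrFun h ⟨x, hx⟩
    funext i
    rw [← hφ f i, ← hφ g i, this]
  have hfin : Finite (ι → Multiplicative (ZMod 2)) := Finite.of_injective _ hinj
  have hι : Finite ι := by
    refine Finite.of_injective (β := ι → Multiplicative (ZMod 2))
      (fun i => Pi.mulSingle i (Multiplicative.ofAdd 1)) fun i j h => ?_
    by_contra hij
    have := congrFun h i
    simp [hij] at this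
  refine ⟨hι, ?_⟩
  have := Nat.card_le_card_of_injective _ hinj
  have h2 : Nat.card (Multiplicative (ZMod 2)) = 2 := by simp
  rw [Nat.card_fun, Nat.card_fun, h2] at this
  simpa using (Nat.pow_le_pow_iff_right (by norm_num)).1 this

theorem FreeGroupBasis.exists_hom {G H ι : Type*} [Group G] [Group H] (β : FreeGroupBasis ι G)
    (f : ι → H) : ∃ φ : G →* H, ∀ i, φ (β i) = f i :=
  ⟨β.lift f, fun i => congrFun (β.lift.symm_apply_apply f) i⟩

theorem FreeGroupBasis.finite_and_card_le {G ι : Type*} [Group G] (β : FreeGroupBasis ι G)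
    (S : Finset G) (hS : Subgroup.closure (S : Set G) = ⊤) : Finite ι ∧ Nat.card ι ≤ S.card :=
  finite_and_card_le_of_generators β (fun f => β.exists_hom f) S hS

theorem FreeGroupBasis.closure_range {G ι : Type*} [Group G] (β : FreeGroupBasis ι G) :
    Subgroup.closure (Set.range β) = ⊤ := by
  have h : Set.range β = β.repr.symm.toMonoidHom '' Set.range FreeGroup.of := by
    rw [← Set.range_comp]; rfl
  rw [h, ← MonoidHom.map_closure, FreeGroup.closure_range_of]
  exact Subgroup.map_top_of_surjective _ β.repr.symm.surjective

/-- Finitely generated residually finite free groups are Hopfian: precomposition with a surjective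
endomorphism is injective on the finite set of homomorphisms to a finite group, hence surjective. -/
theorem FreeGroup.injective_of_surjective {ι : Type*} [Finite ι]
    [Group.ResiduallyFinite (FreeGroup ι)]
    (φ : FreeGroup ι →* FreeGroup ι) (hφ : Surjective φ) : Injective φ := by
  rw [injective_iff_map_eq_one]
  intro x hx
  by_contra hne
  obtain ⟨K, hK⟩ := Group.exists_finiteIndexNormalSubgroup_notMem x hne
  let f := QuotientGroup.mk' K.toSubgroup
  have : Finite (FreeGroup ι ⧸ K.toSubgroup) := Subgroup.finite_quotient_of_finiteIndex
  have : Finite (FreeGroup ι →* FreeGroup ι ⧸ K.toSubgroup) := Finite.of_equiv _ FreeGroup.lift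
  have hinj : Injective fun ψ : FreeGroup ι →* FreeGroup ι ⧸ K.toSubgroup => ψ.comp φ :=
    fun ψ ψ' h => (MonoidHom.cancel_right hφ).1 h
  obtain ⟨ψ, hψ⟩ := Finite.surjective_of_injective hinj f
  apply hK
  have h1 : f x = 1 := by
    rw [← hψ]
    simp [hx]
  exact (QuotientGroup.eq_one_iff x).1 h1

/-- A generating set of a free group with at most as many elements as the rank is a free basis. -/
theorem FreeGroupBasis.exists_basis_of_generators {G ι : Type*} [Group G]
    [Group.ResiduallyFinite (FreeGroup ι)] (β : FreeGroupBasis ι G)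
    (S : Finset G) (hS : Subgroup.closure (S : Set G) = ⊤) (hc : S.card ≤ Nat.card ι) :
    ∃ b : FreeGroupBasis (S : Set G) G, ∀ x : (S : Set G), b x = x := by
  obtain ⟨hfin, hle⟩ := β.finite_and_card_le S hS
  have hcard : Nat.card ι = Nat.card (S : Set G) := by
    rw [show Nat.card (S : Set G) = S.card by simp]; omega
  obtain ⟨e⟩ : Nonempty (ι ≃ (S : Set G)) := Finite.card_eq.1 hcard
  let φ : FreeGroup ι →* G := FreeGroup.lift fun i => (e i : G)
  have hφ : Surjective φ := by
    rw [← MonoidHom.range_eq_top, FreeGroup.range_lift_eq_closure, ← hS]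
    congr 1
    ext x
    constructor
    · rintro ⟨i, rfl⟩
      exact (e i).2
    · intro hx
      exact ⟨e.symm ⟨x, hx⟩, by simp⟩
  have hinj : Injective (β.repr.toMonoidHom.comp φ) :=
    FreeGroup.injective_of_surjective _ (β.repr.surjective.comp hφ)
  have hinj' : Injective φ := Injective.of_comp (f := β.repr) hinj
  let Φ : FreeGroup ι ≃* G := MulEquiv.ofBijective φ ⟨hinj', hφ⟩
  refine ⟨(FreeGroupBasis.ofRepr Φ.symm).reindex e, fun x => ?_⟩
  rw [FreeGroupBasis.reindex_apply]
  change φ (FreeGroup.of (e.symm x)) = x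
  simp [φ]

/-- Part of a free basis generates a free factor; the complement is generated by the rest. -/
theorem isFreeFactor_closure {G : Type*} [Group G] {S S₁ : Set G} (b : FreeGroupBasis S G)
    (hb : ∀ x : S, b x = x) (h₁ : S₁ ⊆ S) : IsFreeFactor (Subgroup.closure S₁) := by
  classical
  set K := Subgroup.closure S₁
  set L := Subgroup.closure (S \ S₁)
  refine ⟨L, ?_⟩
  obtain ⟨θ, hθ⟩ := b.exists_hom (H := Monoid.Coprod K L) fun x =>
    if h : (x : G) ∈ S₁ then Monoid.Coprod.inl ⟨x, Subgroup.subset_closure h⟩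
    else Monoid.Coprod.inr ⟨x, Subgroup.subset_closure ⟨x.2, h⟩⟩
  have hK : θ.comp K.subtype = Monoid.Coprod.inl := by
    refine MonoidHom.eq_of_eqOn_dense (Subgroup.closure_closure_coe_preimage (k := S₁)) ?_
    rintro ⟨x, hxK⟩ hx
    have hx' : x ∈ S₁ := hx
    have := hθ ⟨x, h₁ hx'⟩
    rw [hb, dif_pos hx'] at this
    exact this
  have hL : θ.comp L.subtype = Monoid.Coprod.inr := by
    refine MonoidHom.eq_of_eqOn_dense (Subgroup.closure_closure_coe_preimage (k := S \ S₁)) ?_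
    rintro ⟨x, hxL⟩ hx
    have hx' : x ∈ S \ S₁ := hx
    have := hθ ⟨x, hx'.1⟩
    rw [hb, dif_neg hx'.2] at this
    exact this
  have hid : θ.comp (Monoid.Coprod.lift K.subtype L.subtype) = MonoidHom.id _ := by
    refine Monoid.Coprod.hom_ext ?_ ?_
    · rw [MonoidHom.comp_assoc, Monoid.Coprod.lift_comp_inl, hK, MonoidHom.id_comp]
    · rw [MonoidHom.comp_assoc, Monoid.Coprod.lift_comp_inr, hL, MonoidHom.id_comp]
  constructor
  · exact (LeftInverse.injective (g := θ) fun x => DFunLike.congr_fun hid x)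
  · rw [← MonoidHom.range_eq_top, Monoid.Coprod.range_lift, Subgroup.range_subtype,
      Subgroup.range_subtype, eq_top_iff, ← b.closure_range, Subgroup.closure_le]
    rintro _ ⟨x, rfl⟩
    rw [hb]
    by_cases hx : (x : G) ∈ S₁
    · exact Subgroup.mem_sup_left (Subgroup.subset_closure hx)
    · exact Subgroup.mem_sup_right (Subgroup.subset_closure ⟨x.2, hx⟩)

/-- A homomorphism to `ℤ/2` can separate the missing basis elements from the others. -/
theorem closure_ne_top_of_ssubset_basis {G : Type*} [Group G] {S S₁ : Set G}
    (b : FreeGroupBasis S G) (hb : ∀ x : S, b x = x) (h₁ : S₁ ⊂ S) :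
    Subgroup.closure S₁ ≠ ⊤ := by
  classical
  obtain ⟨x, hx, hx₁⟩ := Set.exists_of_ssubset h₁
  obtain ⟨θ, hθ⟩ := b.exists_hom (H := Multiplicative (ZMod 2)) fun y =>
    if (y : G) ∈ S₁ then 1 else Multiplicative.ofAdd 1
  intro htop
  have h1 : θ = 1 := by
    refine MonoidHom.eq_of_eqOn_dense htop fun y hy => ?_
    have := hθ ⟨y, h₁.1 hy⟩
    rwa [hb, if_pos hy] at this
  have := hθ ⟨x, hx⟩
  rw [hb, if_neg hx₁, h1] at this
  exact absurd (Multiplicative.ofAdd.injective this) (by decide)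

/-! ### Schreier's inequality -/

section Schreier

variable {A X : Type*} [MulAction (FreeGroup A) X]

/-- The action on `X × ℤ/2` twisting the action on `X` by the labelling `c` of its arrows. -/
def twistedAction (c : A × X → ZMod 2) : FreeGroup A →* Equiv.Perm (X × ZMod 2) :=
  FreeGroup.lift fun a =>
    { toFun := fun p => (FreeGroup.of a • p.1, p.2 + c (a, p.1))
      invFun := fun p => ((FreeGroup.of a)⁻¹ • p.1, p.2 - c (a, (FreeGroup.of a)⁻¹ • p.1))
      left_inv := fun p => by simp
      right_inv := fun p => by simp }

theorem twistedAction_apply (c : A × X → ZMod 2) (g : FreeGroup A) (x : X) (s : ZMod 2) :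
    twistedAction c g (x, s) = (g • x, s + (twistedAction c g (x, 0)).2) := by
  induction g using FreeGroup.induction_on generalizing x s with
  | C1 => simp
  | of a => simp [twistedAction]
  | inv_of a _ => simp [twistedAction, Equiv.Perm.inv_def, sub_eq_add_neg]
  | mul g h hg hh =>
    rw [map_mul, Equiv.Perm.mul_apply, Equiv.Perm.mul_apply, hh x s, hg, hh x 0,
      hg _ (0 + _)]
    simp [mul_smul, add_assoc]

/-- The sum of the labels `c` along the trajectory of `x` under the word `g`. -/
def labelSum (c : A × X → ZMod 2) (g : FreeGroup A) (x : X) : ZMod 2 :=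
  (twistedAction c g (x, 0)).2

theorem labelSum_mul (c : A × X → ZMod 2) (g h : FreeGroup A) (x : X) :
    labelSum c (g * h) x = labelSum c h x + labelSum c g (h • x) := by
  unfold labelSum
  rw [map_mul, Equiv.Perm.mul_apply, twistedAction_apply c h, twistedAction_apply c g, zero_add]

theorem labelSum_one (c : A × X → ZMod 2) (x : X) : labelSum c 1 x = 0 := by
  simp [labelSum]

theorem labelSum_of (c : A × X → ZMod 2) (a : A) (x : X) :
    labelSum c (FreeGroup.of a) x = c (a, x) := by
  simp [labelSum, twistedAction]

theorem labelSum_inv (c : A × X → ZMod 2) (g : FreeGroup A) (x : X) :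
    labelSum c g⁻¹ x = - labelSum c g (g⁻¹ • x) := by
  have := labelSum_mul c g g⁻¹ x
  rw [mul_inv_cancel, labelSum_one] at this
  exact eq_neg_of_add_eq_zero_left this.symm

/-- The inequality `|X| (|A| - 1) + 1 ≤ rank` in Schreier's index formula. The labellings of the
`|A| |X|` arrows of the Schreier graph are determined by the homomorphism to `ℤ/2` they induce on
the stabilizer, together with their sums along paths from the base point to the other points. -/
theorem card_mul_card_add_one_le [Finite A] [Finite X] [MulAction.IsPretransitive (FreeGroup A) X]
    (x₀ : X) {ι : Type*} [Finite ι]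
    (β : FreeGroupBasis ι (MulAction.stabilizer (FreeGroup A) x₀)) :
    Nat.card A * Nat.card X + 1 ≤ Nat.card ι + Nat.card X := by
  classical
  have ht : ∀ x : X, ∃ t : FreeGroup A, t • x = x₀ ∧ (x = x₀ → t = 1) := fun x => by
    by_cases hx : x = x₀
    · exact ⟨1, by simp [hx], fun _ => rfl⟩
    · obtain ⟨t, ht⟩ := MulAction.exists_smul_eq (FreeGroup A) x x₀
      exact ⟨t, ht, fun h => absurd h hx⟩
  choose t ht ht1 using ht
  have ht' : ∀ x, (t x)⁻¹ • x₀ = x := fun x => by rw [inv_smul_eq_iff, ht]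
  let H := MulAction.stabilizer (FreeGroup A) x₀
  let hom : (A × X → ZMod 2) → (H →* Multiplicative (ZMod 2)) := fun c =>
    { toFun := fun g => Multiplicative.ofAdd (labelSum c g x₀)
      map_one' := by simp [labelSum_one]
      map_mul' := fun g h => by
        have : (h : FreeGroup A) • x₀ = x₀ := h.2
        simp [labelSum_mul, this, mul_comm] }
  let F : (A × X → ZMod 2) → (ι → Multiplicative (ZMod 2)) × ({x // x ≠ x₀} → ZMod 2) :=
    fun c => (fun i => hom c (β i), fun x => labelSum c (t x) x)
  have hF : Injective F := by
    intro c d hcd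
    have h1 : hom c = hom d := β.ext_hom _ _ fun i => congrFun (congrArg Prod.fst hcd) i
    have h2 : ∀ x, labelSum c (t x) x = labelSum d (t x) x := fun x => by
      by_cases hx : x = x₀
      · rw [ht1 x hx, labelSum_one, labelSum_one]
      · exact congrFun (congrArg Prod.snd hcd) ⟨x, hx⟩
    -- The arrow from `x` labelled `a`, closed up by the chosen paths, is a loop at the base point.
    have key : ∀ (e : A × X → ZMod 2) a x,
        labelSum e (t (FreeGroup.of a • x) * FreeGroup.of a * (t x)⁻¹) x₀
          = - labelSum e (t x) x + (e (a, x) +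
            labelSum e (t (FreeGroup.of a • x)) (FreeGroup.of a • x)) := fun e a x => by
      rw [labelSum_mul, labelSum_mul, labelSum_inv, ht', labelSum_of]
    funext ⟨a, x⟩
    have hmem : t (FreeGroup.of a • x) * FreeGroup.of a * (t x)⁻¹ ∈ H := by
      simp only [H, MulAction.mem_stabilizer_iff, mul_smul, ht', ht]
    have h3 := DFunLike.congr_fun h1 ⟨_, hmem⟩
    have h4 : labelSum c _ x₀ = labelSum d _ x₀ := Multiplicative.ofAdd.injective h3
    rw [key, key, h2, h2] at h4
    simpa using h4
  have hle := Nat.card_le_card_of_injective F hF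
  rw [Nat.card_prod, Nat.card_fun, Nat.card_fun, Nat.card_fun, Nat.card_prod] at hle
  simp only [Nat.card_eq_fintype_card (α := ZMod 2), ZMod.card,
    show Nat.card (Multiplicative (ZMod 2)) = 2 by simp] at hle
  rw [← pow_add] at hle
  have hle' := (Nat.pow_le_pow_iff_right (by norm_num)).1 hle
  have hX : Nat.card {x // x ≠ x₀} + 1 = Nat.card X := by
    have := Fintype.ofFinite X
    rw [Nat.card_eq_fintype_card, Nat.card_eq_fintype_card]
    have := Fintype.card_subtype_compl (fun x : X => x = x₀)
    have h1 : 0 < Fintype.card X := Fintype.card_pos_iff.2 ⟨x₀⟩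
    simp only [Fintype.card_unique] at this
    simp only [ne_eq]
    omega
  omega

end Schreier

/-! ### Labelled graphs -/

/-- The edge traversed by the letter `x` from `p` to `q`: an edge `(p, a, q)` is read as `a` from
`p` to `q` and as `a⁻¹` from `q` to `p`. A labelled graph is encoded as its set of edges. -/
def dart {V A : Type*} (p : V) (x : A × Bool) (q : V) : V × A × V :=
  if x.2 then (p, x.1, q) else (q, x.1, p)

/-- The labelled graph `E` has a path from the first to the second vertex reading the given word. -/
inductive Reads {V A : Type*} (E : Finset (V × A × V)) : V → List (A × Bool) → V → Prop
  | nil (p : V) : Reads E p [] p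
  | cons {p q r : V} {x : A × Bool} {w : List (A × Bool)} (h : dart p x q ∈ E)
      (hw : Reads E q w r) : Reads E p (x :: w) r

/-- The vertices of the labelled graph `E` with base point `o`. A graph is given by its edges alone,
so that only the base point can be an isolated vertex. -/
def verts {V A : Type*} [DecidableEq V] (o : V) (E : Finset (V × A × V)) : Finset V :=
  insert o (E.image (fun e => e.1) ∪ E.image fun e => e.2.2)

/-- Every vertex is joined to the base point. -/
def IsConn {V A : Type*} [DecidableEq V] (o : V) (E : Finset (V × A × V)) : Prop :=
  ∀ p ∈ verts o E, ∃ w, Reads E o w p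

/-- A labelled graph is folded when no vertex has two outgoing or two incoming edges with the same
label. -/
def IsFolded {V A : Type*} (E : Finset (V × A × V)) : Prop :=
  ∀ e ∈ E, ∀ e' ∈ E, e.2.1 = e'.2.1 → (e.1 = e'.1 ↔ e.2.2 = e'.2.2)

/-- `ψ` is a morphism from the labelled graph `E` to the Schreier graph of an action, in which
`a • y` is joined to `y` by an edge labelled `a`. -/
def IsCompat {V A X : Type*} [MulAction (FreeGroup A) X] (ψ : V → X) (E : Finset (V × A × V)) :
    Prop :=
  ∀ p a q, (p, a, q) ∈ E → ψ p = FreeGroup.of a • ψ q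

section Basic

variable {V A X : Type*} {E E' : Finset (V × A × V)} {p q r : V} {w w' : List (A × Bool)}
  {x : A × Bool}

theorem dart_not (p q : V) (a : A) (b : Bool) : dart p (a, !b) q = dart q (a, b) p := by
  cases b <;> rfl

theorem Reads.mono (hE : E ⊆ E') (h : Reads E p w q) : Reads E' p w q := by
  induction h with
  | nil p => exact .nil p
  | cons h _ ih => exact .cons (hE h) ih

theorem Reads.append (h : Reads E p w q) (h' : Reads E q w' r) : Reads E p (w ++ w') r := by
  induction h with
  | nil p => exact h'
  | cons h _ ih => exact .cons h (ih h')

theorem Reads.of_append (h : Reads E p (w ++ w') r) : ∃ q, Reads E p w q ∧ Reads E q w' r := by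
  induction w generalizing p with
  | nil => exact ⟨p, .nil p, h⟩
  | cons x w ih =>
    cases h with
    | cons hx hw =>
      obtain ⟨q, h1, h2⟩ := ih hw
      exact ⟨q, .cons hx h1, h2⟩

theorem Reads.invRev (h : Reads E p w q) : Reads E q (FreeGroup.invRev w) p := by
  induction h with
  | nil p => exact .nil p
  | @cons p q r x w h _ ih =>
    have : FreeGroup.invRev (x :: w) = FreeGroup.invRev w ++ [(x.1, !x.2)] := by
      simp [FreeGroup.invRev]
    rw [this]
    exact ih.append (.cons (by rw [dart_not]; exact h) (.nil _))

theorem mk_cons (x : A × Bool) (w : List (A × Bool)) :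
    FreeGroup.mk (x :: w) = FreeGroup.mk [x] * FreeGroup.mk w := by simp

theorem mk_singleton_false (a : A) : FreeGroup.mk [(a, false)] = (FreeGroup.of a)⁻¹ := rfl

theorem IsCompat.apply_dart [MulAction (FreeGroup A) X] {ψ : V → X} (hψ : IsCompat ψ E)
    (h : dart p x q ∈ E) : ψ p = FreeGroup.mk [x] • ψ q := by
  obtain ⟨a, b⟩ := x
  cases b
  · rw [mk_singleton_false, eq_inv_smul_iff]
    exact (hψ q a p h).symm
  · exact hψ p a q h

theorem Reads.eq_smul [MulAction (FreeGroup A) X] {ψ : V → X} (hψ : IsCompat ψ E)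
    (h : Reads E p w q) : ψ p = FreeGroup.mk w • ψ q := by
  induction h with
  | nil p => simp [← FreeGroup.one_eq_mk]
  | cons h _ ih => rw [mk_cons, mul_smul, ← ih, hψ.apply_dart h]

theorem IsFolded.dart_inj (hE : IsFolded E) (h : dart p x q ∈ E) (h' : dart p x r ∈ E) :
    q = r := by
  obtain ⟨a, b⟩ := x
  cases b
  · exact (hE _ h _ h' rfl).2 rfl
  · exact (hE _ h _ h' rfl).1 rfl

theorem IsFolded.reads_unique (hE : IsFolded E) (h : Reads E p w q) (h' : Reads E p w r) :
    q = r := by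
  induction h with
  | nil p => cases h'; rfl
  | cons h _ ih =>
    cases h' with
    | cons h₁ h₂ =>
      cases hE.dart_inj h h₁
      exact ih h₂

/-- In a folded graph the two traversals in a backtrack use the same edge, so that cancelling them
does not change the end point. -/
theorem IsFolded.reads_red (hE : IsFolded E) (hr : FreeGroup.Red w w') (h : Reads E p w q) :
    Reads E p w' q := by
  induction hr with
  | refl => exact h
  | tail _ hs ih =>
    cases hs with
    | @not L₁ L₂ a b =>
      obtain ⟨z, h1, h2⟩ := ih.of_append
      cases h2 with
      | cons h3 h4 =>
        cases h4 with
        | cons h5 h6 =>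
          rw [dart_not] at h5
          have : z = _ := hE.dart_inj (x := (a, !b)) (by rwa [dart_not]) (by rwa [dart_not])
          exact h1.append (this ▸ h6)

theorem IsFolded.eq_of_reads_of_mk_eq [DecidableEq A] (hE : IsFolded E)
    (hw : FreeGroup.mk w = FreeGroup.mk w') (h : Reads E p w q) (h' : Reads E p w' r) : q = r := by
  have h1 := hE.reads_red FreeGroup.reduce.red h
  have h2 := hE.reads_red FreeGroup.reduce.red h'
  rw [FreeGroup.reduce.sound hw] at h1
  exact hE.reads_unique h1 h2

variable [DecidableEq V] {o : V}

theorem base_mem_verts : o ∈ verts o E := Finset.mem_insert_self _ _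

theorem fst_mem_verts {e : V × A × V} (h : e ∈ E) : e.1 ∈ verts o E := by
  refine Finset.mem_insert_of_mem (Finset.mem_union_left _ ?_)
  exact Finset.mem_image_of_mem _ h

theorem snd_mem_verts {e : V × A × V} (h : e ∈ E) : e.2.2 ∈ verts o E := by
  refine Finset.mem_insert_of_mem (Finset.mem_union_right _ ?_)
  exact Finset.mem_image_of_mem (fun e : V × A × V => e.2.2) h

theorem mem_verts_iff : p ∈ verts o E ↔ p = o ∨ ∃ e ∈ E, e.1 = p ∨ e.2.2 = p := by
  simp only [verts, Finset.mem_insert, Finset.mem_union, Finset.mem_image]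
  refine or_congr_right ⟨?_, ?_⟩
  · rintro (⟨e, he, h⟩ | ⟨e, he, h⟩)
    · exact ⟨e, he, .inl h⟩
    · exact ⟨e, he, .inr h⟩
  · rintro ⟨e, he, h | h⟩
    · exact .inl ⟨e, he, h⟩
    · exact .inr ⟨e, he, h⟩

theorem verts_subset (hE : E ⊆ E') : verts o E ⊆ verts o E' := by
  intro p hp
  rw [mem_verts_iff] at hp ⊢
  exact hp.imp_right fun ⟨e, he, h⟩ => ⟨e, hE he, h⟩

theorem right_mem_verts_of_dart (h : dart p x q ∈ E) : q ∈ verts o E := by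
  obtain ⟨a, b⟩ := x
  cases b
  · exact fst_mem_verts h
  · exact snd_mem_verts h

theorem verts_insert [DecidableEq A] (e : V × A × V) :
    verts o (insert e E) = insert e.1 (insert e.2.2 (verts o E)) := by
  ext p
  simp only [verts, Finset.image_insert, Finset.mem_insert, Finset.mem_union]
  tauto

omit [DecidableEq V] in
/-- A set of vertices containing the base point that no edge leaves contains all vertices reached
from the base point. -/
theorem Reads.mem_of_closed {S : Set V} (hS : ∀ e ∈ E, e.1 ∈ S ↔ e.2.2 ∈ S)
    (h : Reads E p w q) (hp : p ∈ S) : q ∈ S := by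
  induction h with
  | nil p => exact hp
  | @cons p q r x w h _ ih =>
    apply ih
    obtain ⟨a, b⟩ := x
    cases b
    · exact (hS _ h).2 hp
    · exact (hS _ h).1 hp

end Basic

/-! ### Generators of the group of closed paths -/

section Generators

variable {V A X : Type*} [DecidableEq V] [DecidableEq A] [MulAction (FreeGroup A) X]

/-- A system of generators for the closed paths of `E` at the base point `o`: with the choice of
an element `t p` for each vertex `p` (to be thought of as the label of a path from `o` to `p`), the
elements `t p * a * (t q)⁻¹` attached to the edges lie in the subgroup generated by `G`. All
choices are required to be consistent with the morphism `ψ` to a Schreier graph. -/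
structure IsGenSystem (o : V) (ψ : V → X) (E : Finset (V × A × V)) (t : V → FreeGroup A)
    (G : Finset (FreeGroup A)) : Prop where
  base : t o = 1
  edge : ∀ p a q, (p, a, q) ∈ E → t p * FreeGroup.of a * (t q)⁻¹ ∈
    Subgroup.closure (G : Set (FreeGroup A))
  smul : ∀ p ∈ verts o E, t p • ψ p = ψ o
  fix : ∀ g ∈ G, g • ψ o = ψ o

variable {o : V} {ψ : V → X} {E Γ W : Finset (V × A × V)} {t : V → FreeGroup A}
  {G : Finset (FreeGroup A)} {p q : V}

omit [DecidableEq A] in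
theorem IsGenSystem.reads (h : IsGenSystem o ψ E t G) {w : List (A × Bool)}
    (hw : Reads E p w q) : t p * FreeGroup.mk w * (t q)⁻¹ ∈
      Subgroup.closure (G : Set (FreeGroup A)) := by
  induction hw with
  | nil p => simp [← FreeGroup.one_eq_mk]
  | @cons p q r x w hx _ ih =>
    have key : t p * FreeGroup.mk [x] * (t q)⁻¹ ∈ Subgroup.closure (G : Set (FreeGroup A)) := by
      obtain ⟨a, b⟩ := x
      cases b
      · have := inv_mem (h.edge _ _ _ hx)
        rw [mk_singleton_false]
        simpa [mul_assoc] using this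
      · exact h.edge _ _ _ hx
    have := mul_mem key ih
    rw [mk_cons]
    simpa only [mul_assoc, inv_mul_cancel_left] using this

omit [DecidableEq A] in
theorem IsGenSystem.loop (h : IsGenSystem o ψ E t G) {w : List (A × Bool)}
    (hw : Reads E o w o) : FreeGroup.mk w ∈ Subgroup.closure (G : Set (FreeGroup A)) := by
  simpa [h.base] using h.reads hw

omit [DecidableEq A] in
theorem IsGenSystem.closure_le (h : IsGenSystem o ψ E t G) :
    Subgroup.closure (G : Set (FreeGroup A)) ≤ MulAction.stabilizer (FreeGroup A) (ψ o) := by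
  rw [Subgroup.closure_le]
  exact fun g hg => h.fix g hg

omit [DecidableEq A] in
theorem IsGenSystem.empty (o : V) (ψ : V → X) :
    IsGenSystem (A := A) o ψ ∅ (fun _ => 1) ∅ where
  base := rfl
  edge := by simp
  smul := by simp [verts]
  fix := by simp

/-- Adding one edge to a graph, at least one of whose end points is already present, costs a
generator only if both end points are present. -/
theorem IsGenSystem.insert_edge (h : IsGenSystem o ψ W t G) (e : V × A × V) (he : e ∉ W)
    (hψ : ψ e.1 = FreeGroup.of e.2.1 • ψ e.2.2) (hv : e.1 ∈ verts o W ∨ e.2.2 ∈ verts o W) :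
    ∃ t' G', G ⊆ G' ∧ IsGenSystem o ψ (insert e W) t' G' ∧
      G'.card + (verts o (insert e W)).card + W.card ≤
        G.card + (insert e W).card + (verts o W).card := by
  obtain ⟨p, a, q⟩ := e
  rw [verts_insert, Finset.card_insert_of_notMem he]
  simp only at hψ hv ⊢
  have hne : ∀ {z}, z ∉ verts o W → o ≠ z := fun hz h => hz (h ▸ base_mem_verts)
  by_cases hp : p ∈ verts o W <;> by_cases hq : q ∈ verts o W
  · refine ⟨t, insert (t p * FreeGroup.of a * (t q)⁻¹) G, Finset.subset_insert _ _,
      ⟨h.base, ?_, ?_, ?_⟩, ?_⟩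
    · intro p' a' q' he'
      rcases Finset.mem_insert.1 he' with he' | he'
      · cases he'
        exact Subgroup.subset_closure (by simp)
      · exact Subgroup.closure_mono (by simp) (h.edge _ _ _ he')
    · rw [verts_insert]
      simpa [hp, hq] using h.smul
    · intro g hg
      rcases Finset.mem_insert.1 hg with rfl | hg
      · rw [mul_smul, mul_smul]
        nth_rw 1 [← h.smul q hq]
        rw [inv_smul_smul, ← hψ, h.smul p hp]
      · exact h.fix g hg
    · have := Finset.card_insert_le (t p * FreeGroup.of a * (t q)⁻¹) G
      rw [Finset.insert_eq_of_mem hq, Finset.insert_eq_of_mem hp]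
      omega
  · refine ⟨update t q (t p * FreeGroup.of a), G, subset_rfl, ⟨?_, ?_, ?_, h.fix⟩, ?_⟩
    · rw [update_of_ne (hne hq), h.base]
    · intro p' a' q' he'
      rcases Finset.mem_insert.1 he' with he' | he'
      · cases he'
        rw [update_self, update_of_ne (ne_of_mem_of_not_mem hp hq)]
        simp
      · rw [update_of_ne (ne_of_mem_of_not_mem (fst_mem_verts he' : p' ∈ _) hq),
          update_of_ne (ne_of_mem_of_not_mem (snd_mem_verts he' : q' ∈ _) hq)]
        exact h.edge _ _ _ he'
    · rw [verts_insert]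
      intro z hz
      simp only [Finset.mem_insert] at hz
      by_cases hzq : z = q
      · subst hzq
        rw [update_self, mul_smul, ← hψ, h.smul p hp]
      · rw [update_of_ne hzq]
        refine h.smul z ?_
        rcases hz with rfl | rfl | hz
        · exact hp
        · exact absurd rfl hzq
        · exact hz
    · rw [Finset.insert_eq_of_mem (Finset.mem_insert_of_mem hp), Finset.card_insert_of_notMem hq]
      omega
  · refine ⟨update t p (t q * (FreeGroup.of a)⁻¹), G, subset_rfl, ⟨?_, ?_, ?_, h.fix⟩, ?_⟩
    · rw [update_of_ne (hne hp), h.base]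
    · intro p' a' q' he'
      rcases Finset.mem_insert.1 he' with he' | he'
      · cases he'
        rw [update_self, update_of_ne (ne_of_mem_of_not_mem hq hp)]
        simp
      · rw [update_of_ne (ne_of_mem_of_not_mem (fst_mem_verts he' : p' ∈ _) hp),
          update_of_ne (ne_of_mem_of_not_mem (snd_mem_verts he' : q' ∈ _) hp)]
        exact h.edge _ _ _ he'
    · rw [verts_insert]
      intro z hz
      simp only [Finset.mem_insert] at hz
      by_cases hzp : z = p
      · subst hzp
        rw [update_self, mul_smul, hψ, inv_smul_smul, h.smul q hq]
      · rw [update_of_ne hzp]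
        refine h.smul z ?_
        rcases hz with rfl | rfl | hz
        · exact absurd rfl hzp
        · exact hq
        · exact hz
    · rw [Finset.insert_eq_of_mem hq, Finset.card_insert_of_notMem hp]
      omega
  · exact absurd hv (by tauto)

/-- A generating system extends from a subgraph containing the base point to a connected graph,
at the cost of as many generators as the difference of the first Betti numbers. -/
theorem IsGenSystem.extend (hconn : IsConn o Γ) (hψ : IsCompat ψ Γ) (hW : W ⊆ Γ)
    (h : IsGenSystem o ψ W t G) :
    ∃ t' G', G ⊆ G' ∧ IsGenSystem o ψ Γ t' G' ∧
      G'.card + (verts o Γ).card + W.card ≤ G.card + Γ.card + (verts o W).card := by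
  induction hn : (Γ \ W).card generalizing W t G with
  | zero =>
    have : W = Γ := hW.antisymm (Finset.sdiff_eq_empty_iff_subset.1 (Finset.card_eq_zero.1 hn))
    subst this
    exact ⟨t, G, subset_rfl, h, by omega⟩
  | succ n ih =>
    obtain ⟨e, heΓ, heW, hev⟩ : ∃ e ∈ Γ, e ∉ W ∧ (e.1 ∈ verts o W ∨ e.2.2 ∈ verts o W) := by
      by_contra! hcon
      have hclosed : ∀ e ∈ Γ, e.1 ∈ (verts o W : Set V) ↔ e.2.2 ∈ (verts o W : Set V) := by
        intro e he
        by_cases heW : e ∈ W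
        · exact iff_of_true (fst_mem_verts heW) (snd_mem_verts heW)
        · exact iff_of_false (hcon e he heW).1 (hcon e he heW).2
      obtain ⟨e, he⟩ : (Γ \ W).Nonempty := by
        rw [← Finset.card_pos]; omega
      rw [Finset.mem_sdiff] at he
      obtain ⟨w, hw⟩ := hconn e.1 (fst_mem_verts he.1)
      exact (hcon e he.1 he.2).1 (hw.mem_of_closed hclosed base_mem_verts)
    obtain ⟨t₁, G₁, hG₁, h₁, hc₁⟩ := h.insert_edge e heW (hψ _ _ _ heΓ) hev
    obtain ⟨t₂, G₂, hG₂, h₂, hc₂⟩ := ih (W := insert e W)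
      (Finset.insert_subset heΓ hW) h₁ (by
        rw [Finset.sdiff_insert, Finset.card_erase_of_mem (Finset.mem_sdiff.2 ⟨heΓ, heW⟩), hn]
        rfl)
    exact ⟨t₂, G₂, hG₁.trans hG₂, h₂, by omega⟩

/-- A connected graph has a generating system with at most `|E| - |V| + 1` elements. -/
theorem exists_genSystem (hconn : IsConn o Γ) (hψ : IsCompat ψ Γ) :
    ∃ t G, IsGenSystem o ψ Γ t G ∧ G.card + (verts o Γ).card ≤ Γ.card + 1 := by
  obtain ⟨t, G, -, h, hc⟩ :=
    (IsGenSystem.empty (A := A) o ψ).extend hconn hψ (Finset.empty_subset _)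
  refine ⟨t, G, h, ?_⟩
  simp only [verts, Finset.card_empty, Finset.image_empty, Finset.union_empty,
    Finset.card_insert_of_notMem (Finset.notMem_empty _)] at hc ⊢
  omega

/-- The first Betti number of a subgraph containing the base point is at most that of the whole
connected graph. -/
theorem card_add_verts_le (hconnW : IsConn o W) (hconn : IsConn o Γ) (hψ : IsCompat ψ Γ)
    (hW : W ⊆ Γ) : W.card + (verts o Γ).card ≤ Γ.card + (verts o W).card := by
  obtain ⟨t, G, h, -⟩ := exists_genSystem hconnW fun p a q hpq => hψ p a q (hW hpq)
  obtain ⟨t', G', hG, -, hc⟩ := h.extend hconn hψ hW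
  have := Finset.card_le_card hG
  omega

end Generators

/-! ### Completing folded graphs -/

/-- A relation that is a partial injection extends to a permutation of a finite set. -/
theorem exists_perm_extending {X : Type*} [Finite X] (R : X → X → Prop)
    (hf : ∀ x y y', R x y → R x y' → y = y') (hi : ∀ x x' y, R x y → R x' y → x = x') :
    ∃ σ : Equiv.Perm X, ∀ x y, R x y → σ x = y := by
  classical
  have := Fintype.ofFinite X
  let f : {x // ∃ y, R x y} → {y // ∃ x, R x y} := fun x => ⟨x.2.choose, x, x.2.choose_spec⟩
  have hfR : ∀ x, R x.1 (f x).1 := fun x => x.2.choose_spec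
  have hbij : Bijective f := by
    constructor
    · intro x x' h
      exact Subtype.ext (hi _ _ _ (hfR x) (h ▸ hfR x'))
    · rintro ⟨y, x, hxy⟩
      exact ⟨⟨x, y, hxy⟩, Subtype.ext (hf _ _ _ (hfR _) hxy)⟩
  refine ⟨(Equiv.ofBijective f hbij).extendSubtype, fun x y hxy => ?_⟩
  rw [Equiv.extendSubtype_apply_of_mem _ _ ⟨y, hxy⟩]
  exact hf _ _ _ (hfR ⟨x, y, hxy⟩) hxy

/-- **Marshall Hall's trick**: a folded graph is part of the Schreier graph of an action on its
vertices. -/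
theorem IsFolded.exists_action {V A : Type*} [DecidableEq V] {E : Finset (V × A × V)}
    (hE : IsFolded E) (o : V) : ∃ (_ : MulAction (FreeGroup A) (verts o E)) (ψ : V → verts o E),
      (∀ v (h : v ∈ verts o E), ψ v = ⟨v, h⟩) ∧ IsCompat ψ E := by
  have key : ∀ a : A, ∃ σ : Equiv.Perm (verts o E),
      ∀ q p : verts o E, ((p : V), a, (q : V)) ∈ E → σ q = p :=
    fun a => exists_perm_extending (fun q p : verts o E => ((p : V), a, (q : V)) ∈ E)
      (fun x y y' h h' => Subtype.ext ((hE _ h _ h' rfl).2 rfl))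
      (fun x x' y h h' => Subtype.ext ((hE _ h _ h' rfl).1 rfl))
  choose σ hσ using key
  let ψ : V → verts o E := fun v => if h : v ∈ verts o E then ⟨v, h⟩ else ⟨o, base_mem_verts⟩
  have hψ : ∀ v (h : v ∈ verts o E), ψ v = ⟨v, h⟩ := fun v h => dif_pos h
  refine ⟨MulAction.compHom _ (FreeGroup.lift σ), ψ, hψ, fun p a q h => ?_⟩
  have hp : p ∈ verts o E := fst_mem_verts h
  have hq : q ∈ verts o E := snd_mem_verts h
  rw [hψ p hp, hψ q hq]
  change _ = FreeGroup.lift σ (FreeGroup.of a) ⟨q, hq⟩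
  rw [FreeGroup.lift_apply_of]
  exact (hσ a ⟨q, hq⟩ ⟨p, hp⟩ h).symm

/-! ### Paths -/

section Path

variable {V A : Type*}

/-- The edges of a path through the vertices `s 0, s 1, …` reading the word `w`. -/
def pathEdges [DecidableEq V] [DecidableEq A] (s : ℕ → V) (w : List (A × Bool)) :
    Finset (V × A × V) :=
  Finset.univ.image fun i : Fin w.length => dart (s i) w[i] (s (i + 1))

variable [DecidableEq V] [DecidableEq A] {s : ℕ → V} {w : List (A × Bool)}

theorem mem_pathEdges {e : V × A × V} :
    e ∈ pathEdges s w ↔ ∃ (i : ℕ) (h : i < w.length), dart (s i) w[i] (s (i + 1)) = e := by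
  simp only [pathEdges, Finset.mem_image, Finset.mem_univ, true_and]
  exact ⟨fun ⟨i, h⟩ => ⟨i, i.2, h⟩, fun ⟨i, hi, h⟩ => ⟨⟨i, hi⟩, h⟩⟩

theorem reads_pathEdges_take (k : ℕ) (hk : k ≤ w.length) :
    Reads (pathEdges s w) (s 0) (w.take k) (s k) := by
  induction k with
  | zero => simpa using Reads.nil _
  | succ k ih =>
    rw [List.take_succ_eq_append_getElem (by omega)]
    exact (ih (by omega)).append (.cons (mem_pathEdges.2 ⟨k, by omega, rfl⟩) (.nil _))

theorem reads_pathEdges : Reads (pathEdges s w) (s 0) w (s w.length) := by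
  simpa using reads_pathEdges_take (s := s) (w := w) w.length le_rfl

theorem mem_verts_pathEdges {p : V} :
    p ∈ verts (s 0) (pathEdges s w) ↔ ∃ i ≤ w.length, s i = p := by
  rw [mem_verts_iff]
  constructor
  · rintro (rfl | ⟨e, he, h⟩)
    · exact ⟨0, Nat.zero_le _, rfl⟩
    · obtain ⟨i, hi, rfl⟩ := mem_pathEdges.1 he
      have : p = s i ∨ p = s (i + 1) := by
        unfold dart at h
        split_ifs at h <;> simp only at h <;> tauto
      rcases this with rfl | rfl
      · exact ⟨i, hi.le, rfl⟩
      · exact ⟨i + 1, hi, rfl⟩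
  · rintro ⟨i, hi, rfl⟩
    rcases i with _ | i
    · exact .inl rfl
    · exact mem_verts_iff.1 (right_mem_verts_of_dart
        (mem_pathEdges.2 ⟨i, hi, rfl⟩ : dart (s i) w[i] (s (i + 1)) ∈ pathEdges s w))

theorem isConn_pathEdges : IsConn (s 0) (pathEdges s w) := by
  intro p hp
  obtain ⟨i, hi, rfl⟩ := mem_verts_pathEdges.1 hp
  exact ⟨_, reads_pathEdges_take i hi⟩

theorem card_pathEdges_le : (pathEdges s w).card ≤ w.length := by
  exact Finset.card_image_le.trans (by simp)

/-- A word read in a graph gives a path, whose vertices are counted by natural numbers. -/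
theorem Reads.exists_path {E : Finset (V × A × V)} {p q : V} (h : Reads E p w q) :
    ∃ s : ℕ → V, s 0 = p ∧ s w.length = q ∧ pathEdges s w ⊆ E := by
  induction h with
  | nil p => exact ⟨fun _ => p, rfl, rfl, by simp [pathEdges]⟩
  | @cons p q r x w h _ ih =>
    obtain ⟨s, h0, hn, hs⟩ := ih
    refine ⟨fun i => Nat.casesOn i p s, rfl, hn, fun e he => ?_⟩
    obtain ⟨i, hi, rfl⟩ := mem_pathEdges.1 he
    rcases i with _ | i
    · simpa [h0] using h
    · exact hs (mem_pathEdges.2 ⟨i, by simpa using hi, rfl⟩)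

/-- The line graph spelling a reduced word is folded. -/
theorem isFolded_pathEdges_id (hw : FreeGroup.IsReduced w) :
    IsFolded (pathEdges (fun i => i) w) := by
  have hred : ∀ (i : ℕ) (h : i + 1 < w.length), w[i].1 = w[i + 1].1 → w[i].2 = w[i + 1].2 :=
    fun i h => List.isChain_iff_getElem.1 hw i h
  rintro e he e' he' hl
  obtain ⟨i, hi, rfl⟩ := mem_pathEdges.1 he
  obtain ⟨j, hj, rfl⟩ := mem_pathEdges.1 he'
  unfold dart at *
  have key : ∀ i j (hi : i < w.length) (hj : j < w.length), w[i].1 = w[j].1 → w[i].2 = true →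
      w[j].2 = false → i ≠ j + 1 ∧ i + 1 ≠ j := by
    intro i j hi hj h h1 h2
    constructor
    · rintro rfl
      have := hred j hi h.symm
      simp_all
    · rintro rfl
      have := hred i hj h
      simp_all
  split_ifs at hl ⊢ with h1 h2 h2 <;> simp only at hl ⊢
  · omega
  · have := key i j hi hj hl h1 (by simpa using h2)
    omega
  · have := key j i hj hi hl.symm h2 (by simpa using h1)
    omega
  · omega

/-- Free groups are residually finite: completing the line graph of a reduced word gives a finite
permutation representation in which the word moves a point. -/
instance FreeGroup.residuallyFinite (ι : Type*) : Group.ResiduallyFinite (FreeGroup ι) := by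
  classical
  rw [Group.residuallyFinite_iff_exists_finiteIndex]
  intro g hg
  have hw : FreeGroup.IsReduced g.toWord := FreeGroup.isReduced_toWord
  set w := g.toWord
  have hmem : ∀ i ≤ w.length, i ∈ verts 0 (pathEdges (fun i => i) w) := fun i hi =>
    mem_verts_pathEdges.2 ⟨i, hi, rfl⟩
  obtain ⟨_, ψ, hψ, hcompat⟩ := (isFolded_pathEdges_id hw).exists_action 0
  have hr := reads_pathEdges.eq_smul hcompat
  have h1 : FreeGroup.mk w = g := FreeGroup.mk_toWord
  refine ⟨MulAction.stabilizer (FreeGroup ι) (ψ w.length), ⟨?_⟩, fun hst => hg ?_⟩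
  · rw [MulAction.index_stabilizer]
    exact ((Set.ncard_pos (Set.toFinite _)).2 ⟨_, MulAction.mem_orbit_self _⟩).ne'
  · rw [h1, MulAction.mem_stabilizer_iff.1 hst, hψ _ (hmem _ (Nat.zero_le _)),
      hψ _ (hmem _ le_rfl)] at hr
    have h3 : w.length = 0 := (congrArg Subtype.val hr).symm
    rw [← h1, List.length_eq_zero_iff.1 h3]
    rfl

end Path

/-! ### Merging vertices -/

/-- The map identifying the vertex `u` with `v`. -/
def mergeMap {V : Type*} [DecidableEq V] (u v z : V) : V := if z = u then v else z

/-- The image of a labelled graph under a map of vertices. -/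
def mapGraph {V V' A : Type*} [DecidableEq V'] [DecidableEq A] (f : V → V')
    (E : Finset (V × A × V)) : Finset (V' × A × V') :=
  E.image fun e => (f e.1, e.2.1, f e.2.2)

/-- The vertices `u` and `v` are the ends of two edges with the same label and a common start, or
the starts of two edges with the same label and a common end. -/
def IsFoldPair {V A : Type*} (E : Finset (V × A × V)) (u v : V) : Prop :=
  ∃ e ∈ E, ∃ e' ∈ E, e.2.1 = e'.2.1 ∧
    (e.1 = e'.1 ∧ e.2.2 = u ∧ e'.2.2 = v ∨ e.2.2 = e'.2.2 ∧ e.1 = u ∧ e'.1 = v)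

/-- `MergeChain o E l c E'`: the graph `E'` arises from `E` by successively identifying the pairs
of distinct vertices in `l`, and `c` of these identifications are not foldings. The vertex that
disappears in an identification is never the base point `o`. -/
inductive MergeChain {V A : Type*} [DecidableEq V] [DecidableEq A] (o : V) :
    Finset (V × A × V) → List (V × V) → ℕ → Finset (V × A × V) → Prop
  | nil (E : Finset (V × A × V)) : MergeChain o E [] 0 E
  | fold {E E' : Finset (V × A × V)} {u v : V} {l : List (V × V)} {c : ℕ} (hu : u ∈ verts o E)
      (hv : v ∈ verts o E) (huv : u ≠ v) (huo : u ≠ o) (hf : IsFoldPair E u v)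
      (h : MergeChain o (mapGraph (mergeMap u v) E) l c E') : MergeChain o E ((u, v) :: l) c E'
  | glue {E E' : Finset (V × A × V)} {u v : V} {l : List (V × V)} {c : ℕ} (hu : u ∈ verts o E)
      (hv : v ∈ verts o E) (huv : u ≠ v) (huo : u ≠ o) (hf : ¬ IsFoldPair E u v)
      (h : MergeChain o (mapGraph (mergeMap u v) E) l c E') :
      MergeChain o E ((u, v) :: l) (c + 1) E'

section Merge

variable {V V' A X : Type*} [DecidableEq V] [DecidableEq V'] [DecidableEq A]
  [MulAction (FreeGroup A) X] {E E' : Finset (V × A × V)} {o u v p q : V} {w : List (A × Bool)}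

theorem mergeMap_self : mergeMap u v u = v := if_pos rfl

theorem mergeMap_of_ne {z : V} (h : z ≠ u) : mergeMap u v z = z := if_neg h

omit [DecidableEq V] in
theorem mem_mapGraph {f : V → V'} {e : V' × A × V'} :
    e ∈ mapGraph f E ↔ ∃ p a q, (p, a, q) ∈ E ∧ (f p, a, f q) = e := by
  simp only [mapGraph, Finset.mem_image, Prod.exists]

omit [DecidableEq V] in
theorem mem_mapGraph_of_mem {a : A} {f : V → V'} (h : (p, a, q) ∈ E) :
    (f p, a, f q) ∈ mapGraph f E :=
  mem_mapGraph.2 ⟨p, a, q, h, rfl⟩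

omit [DecidableEq V] in
theorem dart_mem_mapGraph {x : A × Bool} {f : V → V'} (h : dart p x q ∈ E) :
    dart (f p) x (f q) ∈ mapGraph f E := by
  obtain ⟨a, b⟩ := x
  cases b <;> exact mem_mapGraph_of_mem h

omit [DecidableEq V] in
theorem Reads.map (f : V → V') (h : Reads E p w q) : Reads (mapGraph f E) (f p) w (f q) := by
  induction h with
  | nil p => exact .nil _
  | cons h _ ih => exact .cons (dart_mem_mapGraph h) ih

theorem verts_mapGraph (f : V → V') : verts (f o) (mapGraph f E) = (verts o E).image f := by
  ext z
  simp only [mem_verts_iff, Finset.mem_image, mem_mapGraph]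
  constructor
  · rintro (rfl | ⟨_, ⟨p, a, q, h, rfl⟩, rfl | rfl⟩)
    · exact ⟨o, .inl rfl, rfl⟩
    · exact ⟨p, .inr ⟨_, h, .inl rfl⟩, rfl⟩
    · exact ⟨q, .inr ⟨_, h, .inr rfl⟩, rfl⟩
  · rintro ⟨_, rfl | ⟨⟨p, a, q⟩, h, rfl | rfl⟩, rfl⟩
    · exact .inl rfl
    · exact .inr ⟨_, ⟨p, a, q, h, rfl⟩, .inl rfl⟩
    · exact .inr ⟨_, ⟨p, a, q, h, rfl⟩, .inr rfl⟩

theorem verts_merge (huo : u ≠ o) :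
    verts o (mapGraph (mergeMap u v) E) = (verts o E).image (mergeMap u v) := by
  rw [← verts_mapGraph, mergeMap_of_ne huo.symm]

theorem mem_verts_merge (hv : v ∈ verts o E) (huv : u ≠ v) (huo : u ≠ o) :
    p ∈ verts o (mapGraph (mergeMap u v) E) ↔ p ∈ verts o E ∧ p ≠ u := by
  rw [verts_merge huo, Finset.mem_image]
  constructor
  · rintro ⟨z, hz, rfl⟩
    by_cases hzu : z = u
    · subst hzu
      rw [mergeMap_self]
      exact ⟨hv, huv.symm⟩
    · rw [mergeMap_of_ne hzu]
      exact ⟨hz, hzu⟩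
  · rintro ⟨hp, hpu⟩
    exact ⟨p, hp, mergeMap_of_ne hpu⟩

theorem card_verts_merge (hu : u ∈ verts o E) (hv : v ∈ verts o E) (huv : u ≠ v) (huo : u ≠ o) :
    (verts o (mapGraph (mergeMap u v) E)).card + 1 = (verts o E).card := by
  have : verts o (mapGraph (mergeMap u v) E) = (verts o E).erase u := by
    ext p
    rw [mem_verts_merge hv huv huo, Finset.mem_erase, and_comm]
  rw [this, Finset.card_erase_add_one hu]

theorem IsConn.map {f : V → V'} (h : IsConn o E) : IsConn (f o) (mapGraph f E) := by
  intro p hp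
  rw [verts_mapGraph, Finset.mem_image] at hp
  obtain ⟨z, hz, rfl⟩ := hp
  obtain ⟨w, hw⟩ := h z hz
  exact ⟨w, hw.map f⟩

theorem IsConn.merge (h : IsConn o E) (huo : u ≠ o) : IsConn o (mapGraph (mergeMap u v) E) := by
  have := h.map (f := mergeMap u v)
  rwa [mergeMap_of_ne huo.symm] at this

omit [DecidableEq V] in
theorem IsCompat.comp {f : V → V'} {ψ : V' → X} (h : IsCompat ψ (mapGraph f E)) :
    IsCompat (ψ ∘ f) E :=
  fun _ a _ hpq => h _ a _ (mem_mapGraph_of_mem hpq)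

/-- A generating system survives the identification of `u` and `v` provided the subgroup contains
`t v * (t u)⁻¹`. -/
theorem IsGenSystem.merge {ψ : V → X} {t : V → FreeGroup A} {G G' : Finset (FreeGroup A)}
    (h : IsGenSystem o (ψ ∘ mergeMap u v) E t G) (hv : v ∈ verts o E) (huv : u ≠ v) (huo : u ≠ o)
    (hG : G ⊆ G') (hG' : ∀ g ∈ G', g • ψ o = ψ o)
    (ht : t v * (t u)⁻¹ ∈ Subgroup.closure (G' : Set (FreeGroup A))) :
    IsGenSystem o ψ (mapGraph (mergeMap u v) E) t G' where
  base := h.base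
  edge := by
    intro p' a' q' hpq'
    obtain ⟨p, a, q, hpq, heq⟩ := mem_mapGraph.1 hpq'
    cases heq
    have hm : ∀ z, t (mergeMap u v z) * (t z)⁻¹ ∈ Subgroup.closure (G' : Set (FreeGroup A)) := by
      intro z
      by_cases hz : z = u
      · subst hz
        rwa [mergeMap_self]
      · rw [mergeMap_of_ne hz, mul_inv_cancel]
        exact one_mem _
    have := mul_mem (mul_mem (hm p) (Subgroup.closure_mono (Finset.coe_subset.2 hG)
      (h.edge _ _ _ hpq))) (inv_mem (hm q))
    simpa [mul_assoc] using this
  smul := by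
    intro p hp
    obtain ⟨hp, hpu⟩ := (mem_verts_merge hv huv huo).1 hp
    have := h.smul p hp
    simpa only [comp_apply, mergeMap_of_ne hpu, mergeMap_of_ne huo.symm] using this
  fix := hG'

omit [DecidableEq A] in
theorem IsGenSystem.fold_mem {ψ : V → X} {t : V → FreeGroup A} {G : Finset (FreeGroup A)}
    (h : IsGenSystem o ψ E t G) (hf : IsFoldPair E u v) :
    t v * (t u)⁻¹ ∈ Subgroup.closure (G : Set (FreeGroup A)) := by
  obtain ⟨⟨p, a, q⟩, he, ⟨p', a', q'⟩, he', hl, hf⟩ := hf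
  have h1 := h.edge _ _ _ he
  have h2 := h.edge _ _ _ he'
  simp only at hl hf
  rcases hf with ⟨rfl, rfl, rfl⟩ | ⟨rfl, rfl, rfl⟩ <;> subst hl
  · simpa [mul_assoc] using mul_mem (inv_mem h2) h1
  · simpa [mul_assoc] using mul_mem h2 (inv_mem h1)

theorem MergeChain.isConn {l : List (V × V)} {c : ℕ} (h : MergeChain o E l c E')
    (hE : IsConn o E) : IsConn o E' := by
  induction h with
  | nil => exact hE
  | fold _ _ _ huo _ _ ih => exact ih (hE.merge huo)
  | glue _ _ _ huo _ _ ih => exact ih (hE.merge huo)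

/-- Along a chain of identifications, generating systems grow by one element for each
identification that is not a folding. -/
theorem MergeChain.exists_pullback {l : List (V × V)} {c : ℕ} (h : MergeChain o E l c E')
    {ψ' : V → X} (hψ' : IsCompat ψ' E') :
    ∃ ψ : V → X, ψ o = ψ' o ∧ IsCompat ψ E ∧ ∀ t G, IsGenSystem o ψ E t G →
      ∃ t' G', G ⊆ G' ∧ G'.card ≤ G.card + c ∧ IsGenSystem o ψ' E' t' G' := by
  induction h with
  | nil => exact ⟨ψ', rfl, hψ', fun t G h => ⟨t, G, subset_rfl, by omega, h⟩⟩
  | @fold E E' u v l c hu hv huv huo hf _ ih =>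
    obtain ⟨ψ, hψo, hψ, H⟩ := ih hψ'
    refine ⟨ψ ∘ mergeMap u v, by simp [mergeMap_of_ne huo.symm, hψo], hψ.comp, fun t G h => ?_⟩
    have hfix := h.fix
    simp only [comp_apply, mergeMap_of_ne huo.symm] at hfix
    exact H t G (h.merge hv huv huo subset_rfl hfix (h.fold_mem hf))
  | @glue E E' u v l c hu hv huv huo hf _ ih =>
    obtain ⟨ψ, hψo, hψ, H⟩ := ih hψ'
    refine ⟨ψ ∘ mergeMap u v, by simp [mergeMap_of_ne huo.symm, hψo], hψ.comp, fun t G h => ?_⟩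
    have hfix := h.fix
    simp only [comp_apply, mergeMap_of_ne huo.symm] at hfix
    obtain ⟨t', G', hG, hc, h'⟩ := H t (insert (t v * (t u)⁻¹) G)
      (h.merge hv huv huo (Finset.subset_insert _ _) (by
        intro g hg
        rcases Finset.mem_insert.1 hg with rfl | hg
        · have h1 := h.smul v hv
          have h2 := h.smul u hu
          simp only [comp_apply, mergeMap_of_ne huo.symm, mergeMap_of_ne huv.symm,
            mergeMap_self] at h1 h2
          rw [mul_smul]
          nth_rw 1 [← h2]
          rw [inv_smul_smul, h1]
        · exact hfix g hg) (Subgroup.subset_closure (by simp)))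
    have := Finset.card_insert_le (t v * (t u)⁻¹) G
    exact ⟨t', G', (Finset.subset_insert _ _).trans hG, by omega, h'⟩

end Merge

/-! ### From graphs to free bases -/

section Soundness

variable {V A X : Type*} [DecidableEq V] [DecidableEq A]

/-- Let the connected graph `E` be part of the Schreier graph of an action on its vertices. Then a
generating system of `E` extends to generators of the stabilizer of the base point, with one more
generator for each edge of the Schreier graph that is missing in `E`. -/
theorem IsGenSystem.exists_complete [Fintype A] {S : Finset V} [MulAction (FreeGroup A) S] {o : V}
    {ψ : V → S} {E : Finset (V × A × V)} {t : V → FreeGroup A} {G : Finset (FreeGroup A)}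
    (hψS : ∀ v (h : v ∈ S), ψ v = ⟨v, h⟩) (hS : verts o E = S) (hψ : IsCompat ψ E)
    (h : IsGenSystem o ψ E t G) (hE : IsConn o E) :
    ∃ G', G ⊆ G' ∧ (∀ g ∈ G', g • ψ o = ψ o) ∧
      (∀ g : FreeGroup A, g • ψ o = ψ o → g ∈ Subgroup.closure (G' : Set (FreeGroup A))) ∧
      G'.card + E.card ≤ G.card + Fintype.card A * S.card := by
  let Γ : Finset (V × A × V) :=
    (Finset.univ : Finset (A × S)).image fun x => ((FreeGroup.of x.1 • x.2 : S), x.1, x.2)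
  have hmemΓ : ∀ p a q, (p, a, q) ∈ Γ ↔ p ∈ S ∧ q ∈ S ∧ ψ p = FreeGroup.of a • ψ q := by
    intro p a q
    simp only [Γ, Finset.mem_image, Finset.mem_univ, true_and, Prod.exists, Prod.mk.injEq]
    constructor
    · rintro ⟨a, q, rfl, rfl, rfl⟩
      exact ⟨Subtype.prop _, q.2, by rw [hψS _ (Subtype.prop _), hψS _ q.2]⟩
    · rintro ⟨hp, hq, h⟩
      exact ⟨a, ⟨q, hq⟩, by rw [← hψS, ← h, hψS p hp], rfl, rfl⟩
  have hEΓ : E ⊆ Γ := by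
    rintro ⟨p, a, q⟩ he
    exact (hmemΓ p a q).2 ⟨hS ▸ fst_mem_verts he, hS ▸ snd_mem_verts he, hψ p a q he⟩
  have hΓψ : IsCompat ψ Γ := fun p a q h => ((hmemΓ p a q).1 h).2.2
  have hΓS : verts o Γ = S := by
    refine subset_antisymm (fun p hp => ?_) (hS ▸ verts_subset hEΓ)
    rcases mem_verts_iff.1 hp with rfl | ⟨⟨p', a, q⟩, he, rfl | rfl⟩
    · rw [← hS]; exact base_mem_verts
    · exact ((hmemΓ _ _ _).1 he).1
    · exact ((hmemΓ _ _ _).1 he).2.1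
  have hΓ : IsConn o Γ := by
    intro p hp
    obtain ⟨w, hw⟩ := hE p (by rwa [hS, ← hΓS])
    exact ⟨w, hw.mono hEΓ⟩
  obtain ⟨t', G', hG, h', hc⟩ := h.extend hΓ hΓψ hEΓ
  have hcard : Γ.card ≤ Fintype.card A * S.card :=
    Finset.card_image_le.trans (by simp)
  refine ⟨G', hG, h'.fix, fun g hg => ?_, by rw [hΓS, hS] at hc; omega⟩
  have key : ∀ (g : FreeGroup A) (x : S), t' (g • x : S) * g * (t' x)⁻¹ ∈
      Subgroup.closure (G' : Set (FreeGroup A)) := by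
    intro g
    have hof : ∀ a (x : S), t' (FreeGroup.of a • x : S) * FreeGroup.of a * (t' x)⁻¹ ∈
        Subgroup.closure (G' : Set (FreeGroup A)) := fun a x =>
      h'.edge _ _ _ (Finset.mem_image.2 ⟨(a, x), Finset.mem_univ _, rfl⟩)
    induction g using FreeGroup.induction_on with
    | C1 => simp
    | of a => exact hof a
    | inv_of a _ =>
      intro x
      have := inv_mem (hof a ((FreeGroup.of a)⁻¹ • x))
      simpa [mul_assoc] using this
    | mul g h hg hh =>
      intro x
      have := mul_mem (hg (h • x)) (hh x)
      rw [mul_smul]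
      simpa [mul_assoc] using this
  have := key g (ψ o)
  have ho : ψ o = ⟨o, hS ▸ base_mem_verts⟩ := hψS o _
  rw [hg, ho] at this
  simpa [h'.base] using this

/-- Elements of a subgroup generated by a set contained in `H`, seen inside `H`. -/
theorem mem_closure_subtype {F : Type*} [Group F] {H : Subgroup F} {G : Set F} (hG : G ⊆ H)
    {g : F} (hg : g ∈ Subgroup.closure G) (hgH : g ∈ H) :
    (⟨g, hgH⟩ : H) ∈ Subgroup.closure {x : H | (x : F) ∈ G} := by
  have h1 : H.subtype '' {x : H | (x : F) ∈ G} = G := by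
    ext x
    exact ⟨fun ⟨y, hy, h⟩ => h ▸ hy, fun hx => ⟨⟨x, hG hx⟩, hx, rfl⟩⟩
  rw [← h1, ← MonoidHom.map_closure] at hg
  obtain ⟨y, hy, h⟩ := hg
  have : y = ⟨g, hgH⟩ := Subtype.ext h
  exact this ▸ hy

/-- Suppose that identifications of vertices, `c` of which are not foldings, turn a graph into a
folded graph with `m` vertices. If the size of a generating system of the graph plus `c` does not
exceed the first Betti number of the folded graph, then the generating system is part of a free
basis of a subgroup of index `m`. -/
theorem MergeChain.exists_basis [Fintype A] {o : V} {E E' : Finset (V × A × V)}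
    {l : List (V × V)} {c : ℕ} (h : MergeChain o E l c E') (hE : IsConn o E)
    (hE' : IsFolded E') :
    ∃ (_ : MulAction (FreeGroup A) (verts o E')) (ψ : V → verts o E'), IsCompat ψ E ∧
      ∀ t G, IsGenSystem o ψ E t G → G.card + c + (verts o E').card ≤ E'.card + 1 →
      ∃ H : Subgroup (FreeGroup A), H.FiniteIndex ∧ H.index = (verts o E').card ∧
        ∃ G' : Finset (FreeGroup A), G ⊆ G' ∧ (G' : Set (FreeGroup A)) ⊆ H ∧
          G'.card + (verts o E').card = Fintype.card A * (verts o E').card + 1 ∧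
          ∃ b : FreeGroupBasis {x : H | (x : FreeGroup A) ∈ G'} H, ∀ x, b x = x := by
  obtain ⟨act, ψ', hψS, hψ'⟩ := hE'.exists_action o
  obtain ⟨ψ, hψo, hψ, H⟩ := h.exists_pullback hψ'
  refine ⟨act, ψ, hψ, fun t G hG hc => ?_⟩
  obtain ⟨t', G₁, hG₁, hc₁, h₁⟩ := H t G hG
  have hconn' := h.isConn hE
  obtain ⟨G', hG', hfix, hgen, hc'⟩ := h₁.exists_complete hψS rfl hψ' hconn'
  let K := MulAction.stabilizer (FreeGroup A) (ψ' o)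
  have htrans : MulAction.IsPretransitive (FreeGroup A) (verts o E') := by
    refine (MulAction.isPretransitive_iff_base (ψ' o)).2 fun x => ?_
    obtain ⟨w, hw⟩ := hconn' x x.2
    have := hw.eq_smul hψ'
    refine ⟨(FreeGroup.mk w)⁻¹, ?_⟩
    rw [this, inv_smul_smul, hψS _ x.2]
  have hindex : K.index = (verts o E').card := by
    rw [MulAction.index_stabilizer_of_transitive]
    simp
  have hne : (verts o E').card ≠ 0 := Finset.card_ne_zero_of_mem base_mem_verts
  have hfin : K.FiniteIndex := ⟨by rw [hindex]; exact hne⟩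
  have hsub : (G' : Set (FreeGroup A)) ⊆ K := fun g hg => hfix g hg
  classical
  let T : Finset K := G'.subtype (· ∈ K)
  have hT : (T : Set K) = {x : K | (x : FreeGroup A) ∈ G'} := by
    ext x
    simp [T]
  have hTcard : T.card = G'.card := by
    rw [Finset.card_subtype, Finset.filter_true_of_mem (p := (· ∈ K)) fun g hg => hsub hg]
  have hTgen : Subgroup.closure (T : Set K) = ⊤ := by
    rw [eq_top_iff]
    rintro ⟨g, hg⟩ -
    rw [hT]
    exact mem_closure_subtype hsub (hgen g hg) hg
  -- The generating set `G'` of `K` has at most `1 + m (|A| - 1)` elements, and the rank of `K` is at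
  -- least that number.
  obtain ⟨ι, ⟨β⟩⟩ := (inferInstance : IsFreeGroup K).nonempty_basis
  obtain ⟨hι, hιle⟩ := β.finite_and_card_le T hTgen
  have hsch := card_mul_card_add_one_le (ψ' o) β
  rw [Nat.card_eq_fintype_card (α := A), Nat.card_eq_fintype_card (α := verts o E'),
    Fintype.card_coe] at hsch
  refine ⟨K, hfin, hindex, G', hG₁.trans hG', hsub, by omega, ?_⟩
  rw [← hT]
  exact β.exists_basis_of_generators T hTgen (by omega)

/-- The path that runs through the vertices `0, …, n - 1` and returns to `0`. -/
def circlePath (n i : ℕ) : ℕ := if i < n then i else 0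

/-- The circle spelling `w` is generated by `w`. -/
theorem isGenSystem_circle [MulAction (FreeGroup A) X] {w : List (A × Bool)} {ψ : ℕ → X}
    (hψ : IsCompat ψ (pathEdges (circlePath w.length) w)) :
    IsGenSystem 0 ψ (pathEdges (circlePath w.length) w)
      (fun i => FreeGroup.mk (w.take i)) {FreeGroup.mk w} := by
  set s := circlePath w.length with hs
  have hs0 : s 0 = 0 := by simp [hs, circlePath]
  have hsn : s w.length = 0 := by simp [hs, circlePath]
  have hlt : ∀ i < w.length, s i = i := fun i hi => by simp [hs, circlePath, hi]
  have hw : FreeGroup.mk w ∈ Subgroup.closure (({FreeGroup.mk w} : Finset (FreeGroup A)) :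
      Set (FreeGroup A)) := Subgroup.subset_closure (by simp)
  refine ⟨by simp [← FreeGroup.one_eq_mk], fun p a q h => ?_, fun p hp => ?_, fun g hg => ?_⟩
  · obtain ⟨i, hi, h⟩ := mem_pathEdges.1 h
    have key : FreeGroup.mk (w.take (s i)) * FreeGroup.mk [w[i]] *
        (FreeGroup.mk (w.take (s (i + 1))))⁻¹ ∈
        Subgroup.closure (({FreeGroup.mk w} : Finset (FreeGroup A)) : Set (FreeGroup A)) := by
      have h1 : FreeGroup.mk (w.take (s i)) * FreeGroup.mk [w[i]] =
          FreeGroup.mk (w.take (i + 1)) := by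
        rw [hlt i hi, FreeGroup.mul_mk, List.take_succ_eq_append_getElem hi]
      rw [h1]
      rcases Nat.lt_or_ge (i + 1) w.length with hi' | hi'
      · rw [hlt _ hi', mul_inv_cancel]
        exact one_mem _
      · have : i + 1 = w.length := by omega
        rw [this, hsn, List.take_length, List.take_zero, ← FreeGroup.one_eq_mk, inv_one, mul_one]
        exact hw
    rcases hwi : w[i] with ⟨a', b⟩
    rw [hwi] at h key
    cases b
    · cases h
      rw [mk_singleton_false] at key
      simpa [mul_assoc] using inv_mem key
    · cases h
      exact key
  · rw [← hs0] at hp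
    obtain ⟨i, hi, rfl⟩ := mem_verts_pathEdges.1 hp
    rcases hi.lt_or_eq with hi | rfl
    · have := (reads_pathEdges_take (s := s) (w := w) i hi.le).eq_smul hψ
      rw [hs0] at this
      rw [this, hlt i hi]
    · rw [hsn]
      simp [← FreeGroup.one_eq_mk]
  · rw [Finset.mem_singleton.1 hg]
    have := (reads_pathEdges (s := s) (w := w)).eq_smul hψ
    rw [hs0, hsn] at this
    exact this.symm

/-- If the circle spelling `w` leads to a folded graph with `m` vertices without waste, i.e. so that
the first Betti number grows by at least the number of identifications that are not foldings, then `w` is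
primitive in a subgroup of index `m`. -/
theorem MergeChain.exists_isPrimitiveElt [Fintype A] {w : List (A × Bool)}
    (hw : FreeGroup.mk w ≠ 1) {E' : Finset (ℕ × A × ℕ)} {l : List (ℕ × ℕ)} {c : ℕ}
    (h : MergeChain 0 (pathEdges (circlePath w.length) w) l c E') (hE' : IsFolded E')
    (hc : c + (verts 0 E').card + (pathEdges (circlePath w.length) w).card ≤
      E'.card + (verts 0 (pathEdges (circlePath w.length) w)).card) :
    ∃ H : Subgroup (FreeGroup A), H.FiniteIndex ∧ H.index = (verts 0 E').card ∧
      ∃ hg : FreeGroup.mk w ∈ H, IsPrimitiveElt (⟨FreeGroup.mk w, hg⟩ : H) := by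
  set s := circlePath w.length with hs
  have hs0 : s 0 = 0 := by simp [hs, circlePath]
  have hsn : s w.length = 0 := by simp [hs, circlePath]
  have hconn : IsConn 0 (pathEdges s w) := hs0 ▸ isConn_pathEdges
  obtain ⟨_, ψ, hψ, H⟩ := h.exists_basis hconn hE'
  -- The first Betti number of the circle is at least one, as it carries the nontrivial element `w`.
  have hpos : (verts 0 (pathEdges s w)).card ≤ (pathEdges s w).card := by
    obtain ⟨t, G, hG, hGc⟩ := exists_genSystem hconn hψ
    have hmem := hG.loop (w := w) (by simpa [hs0, hsn] using reads_pathEdges (s := s) (w := w))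
    rcases G.eq_empty_or_nonempty with rfl | hne
    · exact absurd (by simpa using hmem) hw
    · have := hne.card_pos
      omega
  obtain ⟨K, hfin, hind, G', hG', hsub, -, b, hb⟩ := H _ _ (isGenSystem_circle hψ)
    (by rw [Finset.card_singleton]; omega)
  have hwG : FreeGroup.mk w ∈ G' := hG' (by simp)
  exact ⟨K, hfin, hind, hsub hwG, fun h => hw (congrArg Subtype.val h), _, hwG, b, hb⟩

/-- If a closed path spelling `w` leads to a folded graph with `m` vertices without waste, and its
first Betti number is less than the rank of subgroups of index `m`, then `w` is simple in a subgroup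
of index `m`. -/
theorem MergeChain.exists_isSimpleElt [Fintype A] {w : List (A × Bool)}
    (hw : FreeGroup.mk w ≠ 1) {o : V} {s : ℕ → V} (hs0 : s 0 = o) (hsn : s w.length = o)
    {E' : Finset (V × A × V)} {l : List (V × V)} {c : ℕ}
    (h : MergeChain o (pathEdges s w) l c E') (hE' : IsFolded E')
    (hc : c + (verts o E').card + (pathEdges s w).card ≤
      E'.card + (verts o (pathEdges s w)).card)
    (hlt : (pathEdges s w).card + (verts o E').card <
      (verts o (pathEdges s w)).card + Fintype.card A * (verts o E').card) :
    ∃ H : Subgroup (FreeGroup A), H.FiniteIndex ∧ H.index = (verts o E').card ∧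
      ∃ hg : FreeGroup.mk w ∈ H, IsSimpleElt (⟨FreeGroup.mk w, hg⟩ : H) := by
  have hconn : IsConn o (pathEdges s w) := hs0 ▸ isConn_pathEdges
  obtain ⟨_, ψ, hψ, H⟩ := h.exists_basis hconn hE'
  obtain ⟨t, G, hG, hGc⟩ := exists_genSystem hconn hψ
  have hmem := hG.loop (w := w) (by simpa [hs0, hsn] using reads_pathEdges (s := s) (w := w))
  obtain ⟨K, hfin, hind, G', hG', hsub, hcard, b, hb⟩ := H t G hG (by omega)
  have hGK : (G : Set (FreeGroup A)) ⊆ K := fun g hg => hsub (hG' hg)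
  have hwK : FreeGroup.mk w ∈ K := (Subgroup.closure_le _).2 hGK hmem
  -- The basis has more elements than `G`, which generates a proper free factor containing `w`.
  have hss : {x : K | (x : FreeGroup A) ∈ (G : Set (FreeGroup A))} ⊂
      {x : K | (x : FreeGroup A) ∈ G'} := by
    refine (Set.ssubset_iff_of_subset (s := {x : K | (x : FreeGroup A) ∈ (G : Set (FreeGroup A))})
      (t := {x : K | (x : FreeGroup A) ∈ G'}) fun x hx => hG' hx).2 ?_
    obtain ⟨g, hg, hgG⟩ := Finset.exists_mem_notMem_of_card_lt_card
      (show G.card < G'.card by omega)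
    exact ⟨⟨g, hsub hg⟩, hg, hgG⟩
  exact ⟨K, hfin, hind, hwK, fun h => hw (congrArg Subtype.val h), _,
    isFreeFactor_closure b hb hss.1, closure_ne_top_of_ssubset_basis b hb hss,
    mem_closure_subtype hGK hmem hwK⟩

end Soundness

/-! ### Folding -/

section Folding

variable {V A X : Type*} [DecidableEq V] [DecidableEq A] [MulAction (FreeGroup A) X]
  {Γ W : Finset (V × A × V)} {o u v : V} {ψ : V → X}

/-- The group of labels of closed paths at the base point. -/
def loopGroup {V A : Type*} (E : Finset (V × A × V)) (o : V) : Subgroup (FreeGroup A) where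
  carrier := {g | ∃ w, FreeGroup.mk w = g ∧ Reads E o w o}
  one_mem' := ⟨[], rfl, .nil o⟩
  mul_mem' := by
    rintro _ _ ⟨w, rfl, hw⟩ ⟨w', rfl, hw'⟩
    exact ⟨w ++ w', by simp, hw.append hw'⟩
  inv_mem' := by
    rintro _ ⟨w, rfl, hw⟩
    exact ⟨FreeGroup.invRev w, by simp, hw.invRev⟩

omit [DecidableEq V] [DecidableEq A] in
theorem loopGroup_mono {E E' : Finset (V × A × V)} (h : E ⊆ E') :
    loopGroup E o ≤ loopGroup E' o := by
  rintro _ ⟨w, rfl, hw⟩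
  exact ⟨w, rfl, hw.mono h⟩

theorem loopGroup_le_merge (huo : u ≠ o) :
    loopGroup Γ o ≤ loopGroup (mapGraph (mergeMap u v) Γ) o := by
  rintro _ ⟨w, rfl, hw⟩
  have := hw.map (mergeMap u v)
  rw [mergeMap_of_ne huo.symm] at this
  exact ⟨w, rfl, this⟩

/-- The first Betti number of a graph is at least the minimal number of generators of its group of
closed paths. -/
theorem le_card_of_loopGroup_eq {r : ℕ} (hconn : IsConn o Γ) (hψ : IsCompat ψ Γ)
    (hloop : MulAction.stabilizer (FreeGroup A) (ψ o) ≤ loopGroup Γ o)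
    (hr : ∀ G : Finset (FreeGroup A), Subgroup.closure (G : Set (FreeGroup A)) =
      MulAction.stabilizer (FreeGroup A) (ψ o) → r ≤ G.card) :
    r + (verts o Γ).card ≤ Γ.card + 1 := by
  obtain ⟨t, G, hG, hc⟩ := exists_genSystem hconn hψ
  have := hr G (le_antisymm hG.closure_le (hloop.trans ?_))
  · omega
  · rintro _ ⟨w, rfl, hw⟩
    exact hG.loop hw

omit [DecidableEq V] [DecidableEq A] in
theorem IsFoldPair.symm (h : IsFoldPair Γ u v) : IsFoldPair Γ v u := by
  obtain ⟨e, he, e', he', hl, h⟩ := h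
  refine ⟨e', he', e, he, hl.symm, ?_⟩
  rcases h with ⟨h1, h2, h3⟩ | ⟨h1, h2, h3⟩
  · exact .inl ⟨h1.symm, h3, h2⟩
  · exact .inr ⟨h1.symm, h3, h2⟩

omit [DecidableEq A] in
theorem IsFoldPair.mem_verts (h : IsFoldPair Γ u v) : u ∈ verts o Γ ∧ v ∈ verts o Γ := by
  obtain ⟨e, he, e', he', -, ⟨-, rfl, rfl⟩ | ⟨-, rfl, rfl⟩⟩ := h
  · exact ⟨snd_mem_verts he, snd_mem_verts he'⟩
  · exact ⟨fst_mem_verts he, fst_mem_verts he'⟩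

omit [DecidableEq V] [DecidableEq A] in
theorem IsFoldPair.apply_eq (h : IsFoldPair Γ u v) (hψ : IsCompat ψ Γ) : ψ u = ψ v := by
  obtain ⟨⟨p, a, q⟩, he, ⟨p', a', q'⟩, he', hl, h⟩ := h
  have h1 := hψ _ _ _ he
  have h2 := hψ _ _ _ he'
  simp only at hl h
  subst hl
  rcases h with ⟨rfl, rfl, rfl⟩ | ⟨rfl, rfl, rfl⟩
  · exact smul_left_cancel _ (h1.symm.trans h2)
  · exact h1.trans h2.symm

omit [DecidableEq A] in
/-- A graph that is not folded has a pair of vertices to be folded together. The vertex to be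
removed can be chosen different from the base point, and outside a given subgraph unless both
vertices belong to it. -/
theorem exists_isFoldPair (h : ¬ IsFolded Γ) (W : Finset (V × A × V)) :
    ∃ u v, IsFoldPair Γ u v ∧ u ≠ v ∧ u ≠ o ∧ (u ∈ verts o W → v ∈ verts o W) := by
  have h1 : ∃ x y, IsFoldPair Γ x y ∧ x ≠ y := by
    unfold IsFolded at h
    push Not at h
    obtain ⟨e, he, e', he', hl, h | h⟩ := h
    · exact ⟨_, _, ⟨e, he, e', he', hl, .inl ⟨h.1, rfl, rfl⟩⟩, h.2⟩
    · exact ⟨_, _, ⟨e, he, e', he', hl, .inr ⟨h.2, rfl, rfl⟩⟩, h.1⟩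
  obtain ⟨x, y, hf, hxy⟩ := h1
  have ho : o ∈ verts o W := base_mem_verts
  by_cases hx : x ∈ verts o W
  · by_cases hy : y ∈ verts o W
    · by_cases hxo : x = o
      · exact ⟨y, x, hf.symm, hxy.symm, fun h => hxy (hxo.trans h.symm), fun _ => hx⟩
      · exact ⟨x, y, hf, hxy, hxo, fun _ => hy⟩
    · exact ⟨y, x, hf.symm, hxy.symm, fun h => hy (h ▸ ho), fun h => absurd h hy⟩
  · exact ⟨x, y, hf, hxy, fun h => hx (h ▸ ho), fun h => absurd h hx⟩

omit [DecidableEq A] in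
/-- Two edges that are identified when `u` and `v` are folded together. -/
theorem IsFoldPair.exists_edges (h : IsFoldPair Γ u v) (huv : u ≠ v) :
    ∃ e ∈ Γ, ∃ e' ∈ Γ, e ≠ e' ∧ (mergeMap u v e.1, e.2.1, mergeMap u v e.2.2) =
      (mergeMap u v e'.1, e'.2.1, mergeMap u v e'.2.2) ∧
      ∀ W : Finset (V × A × V), e ∈ W → e' ∈ W → IsFoldPair W u v := by
  obtain ⟨e, he, e', he', hl, h⟩ := h
  refine ⟨e, he, e', he', ?_, ?_, fun W hW hW' => ⟨e, hW, e', hW', hl, h⟩⟩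
  · rintro rfl
    rcases h with ⟨-, h1, h2⟩ | ⟨-, h1, h2⟩ <;> exact huv (h1.symm.trans h2)
  · rcases h with ⟨h0, h1, h2⟩ | ⟨h0, h1, h2⟩
    · rw [h0, h1, h2, hl, mergeMap_self, mergeMap_of_ne huv.symm]
    · rw [h0, h1, h2, hl, mergeMap_self, mergeMap_of_ne huv.symm]

theorem IsFoldPair.card_merge_lt (h : IsFoldPair Γ u v) (huv : u ≠ v) :
    (mapGraph (mergeMap u v) Γ).card + 1 ≤ Γ.card := by
  obtain ⟨e, he, e', he', hne, heq, -⟩ := h.exists_edges huv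
  refine Nat.lt_of_le_of_ne Finset.card_image_le fun hcard => hne ?_
  exact Finset.card_image_iff.1 hcard he he' heq

theorem IsCompat.merge (hψ : IsCompat ψ Γ) (h : ψ u = ψ v) :
    IsCompat ψ (mapGraph (mergeMap u v) Γ) := by
  have hm : ∀ z, ψ (mergeMap u v z) = ψ z := fun z => by
    by_cases hz : z = u
    · subst hz; rw [mergeMap_self, h]
    · rw [mergeMap_of_ne hz]
  intro p' a' q' hpq'
  obtain ⟨p, a, q, hpq, heq⟩ := mem_mapGraph.1 hpq'
  cases heq
  rw [hm, hm]
  exact hψ _ _ _ hpq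

/-- Every graph folds, by foldings only, to a folded graph without increasing the first Betti
number. -/
theorem exists_folded (hconn : IsConn o Γ) (hψ : IsCompat ψ Γ) :
    ∃ (Γ' : Finset (V × A × V)) (l : List (V × V)), MergeChain o Γ l 0 Γ' ∧
      IsFolded Γ' ∧ IsConn o Γ' ∧ IsCompat ψ Γ' ∧
      loopGroup Γ o ≤ loopGroup Γ' o ∧ Γ'.card + (verts o Γ).card ≤ Γ.card + (verts o Γ').card := by
  induction hn : (verts o Γ).card generalizing Γ with
  | zero => exact absurd hn (Finset.card_ne_zero_of_mem base_mem_verts)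
  | succ n ih =>
    by_cases hf : IsFolded Γ
    · exact ⟨Γ, [], .nil Γ, hf, hconn, hψ, le_rfl, by omega⟩
    · obtain ⟨u, v, hp, huv, huo, -⟩ := exists_isFoldPair (o := o) hf ∅
      have hcard := card_verts_merge (o := o) hp.mem_verts.1 hp.mem_verts.2 huv huo
      obtain ⟨Γ', l, hch, h1, h2, h3, h4, h5⟩ := ih (hconn.merge huo) (hψ.merge (hp.apply_eq hψ))
        (by omega)
      have := hp.card_merge_lt huv
      exact ⟨Γ', _, .fold hp.mem_verts.1 hp.mem_verts.2 huv huo hp hch, h1, h2, h3,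
        (loopGroup_le_merge huo).trans h4, by omega⟩

theorem mapGraph_merge_of_notMem (hu : u ∉ verts o W) : mapGraph (mergeMap u v) W = W := by
  have : ∀ e ∈ W, (mergeMap u v e.1, e.2.1, mergeMap u v e.2.2) = e := fun e he => by
    rw [mergeMap_of_ne (ne_of_mem_of_not_mem (fst_mem_verts he) hu),
      mergeMap_of_ne (ne_of_mem_of_not_mem (snd_mem_verts he) hu)]
  rw [mapGraph, Finset.image_congr (g := id) fun e he => this e he, Finset.image_id]

/-- If a folding of `Γ` identifies just one pair of edges, it loses at most one edge of a subgraph.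
-/
theorem card_le_card_merge_add_one (hW : W ⊆ Γ)
    (hcard : Γ.card ≤ (mapGraph (mergeMap u v) Γ).card + 1) :
    W.card ≤ (mapGraph (mergeMap u v) W).card + 1 := by
  have h1 : mapGraph (mergeMap u v) Γ =
      mapGraph (mergeMap u v) W ∪ mapGraph (mergeMap u v) (Γ \ W) := by
    unfold mapGraph
    rw [← Finset.image_union, Finset.union_sdiff_of_subset hW]
  have h2 : (mapGraph (mergeMap u v) (Γ \ W)).card ≤ (Γ \ W).card := Finset.card_image_le
  have h3 := Finset.card_union_le (mapGraph (mergeMap u v) W) (mapGraph (mergeMap u v) (Γ \ W))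
  rw [← h1] at h3
  have h4 := Finset.card_sdiff_add_card_eq_card hW
  omega

/-- If a folding of `Γ` identifies just one pair of edges, and these do not both belong to the
subgraph `W`, then `W` loses no edge. -/
theorem IsFoldPair.card_le_card_merge (h : IsFoldPair Γ u v) (huv : u ≠ v) (hW : W ⊆ Γ)
    (hcard : Γ.card ≤ (mapGraph (mergeMap u v) Γ).card + 1) (hWf : ¬ IsFoldPair W u v) :
    W.card ≤ (mapGraph (mergeMap u v) W).card := by
  set m : V × A × V → V × A × V := fun e => (mergeMap u v e.1, e.2.1, mergeMap u v e.2.2) with hm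
  obtain ⟨f, f', hf, hf', hff, hmf, hfW⟩ : ∃ f f', f ∈ Γ ∧ f' ∈ Γ ∧ f ≠ f' ∧ m f = m f' ∧
      f ∉ W := by
    obtain ⟨e, he, e', he', hne, heq, hW'⟩ := h.exists_edges huv
    by_cases heW : e ∈ W
    · exact ⟨e', e, he', he, hne.symm, heq.symm, fun he'W => hWf (hW' W heW he'W)⟩
    · exact ⟨e, e', he, he', hne, heq, heW⟩
  refine (Finset.card_image_of_injOn fun x hx y hy hxy => ?_).ge
  by_contra hne
  -- Otherwise both `f` and an edge `x` of `W` can be removed without changing the image of `Γ`.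
  have hsub : Γ.image m ⊆ ((Γ.erase f).erase x).image m := by
    have hy' : m x ∈ ((Γ.erase f).erase x).image m :=
      Finset.mem_image.2 ⟨y, by
        simp only [Finset.mem_erase]
        exact ⟨Ne.symm hne, ne_of_mem_of_not_mem hy hfW, hW hy⟩, hxy.symm⟩
    intro z' hz'
    obtain ⟨z, hz, rfl⟩ := Finset.mem_image.1 hz'
    by_cases hzx : z = x
    · rw [hzx]; exact hy'
    · by_cases hzf : z = f
      · rw [hzf, hmf]
        by_cases hfx : f' = x
        · rw [hfx]; exact hy'
        · exact Finset.mem_image_of_mem _ (by simp [hfx, hf', hff.symm])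
      · exact Finset.mem_image_of_mem _ (by simp [hzx, hzf, hz])
  have h1 := (Finset.card_le_card hsub).trans Finset.card_image_le
  rw [Finset.card_erase_of_mem (Finset.mem_erase.2 ⟨ne_of_mem_of_not_mem hx hfW, hW hx⟩),
    Finset.card_erase_of_mem hf] at h1
  have h2 : 2 ≤ Γ.card := by
    have : ({f, f'} : Finset _).card ≤ Γ.card := Finset.card_le_card (by
      intro z hz
      simp only [Finset.mem_insert, Finset.mem_singleton] at hz
      rcases hz with rfl | rfl <;> assumption)
    rwa [Finset.card_pair hff] at this
  have h3 : (mapGraph (mergeMap u v) Γ).card = (Γ.image m).card := rfl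
  omega

/-- In a folded graph whose closed paths carry the whole stabilizer, distinct vertices lie over
distinct points. -/
theorem IsFolded.injOn (hf : IsFolded Γ) (hconn : IsConn o Γ) (hψ : IsCompat ψ Γ)
    (hloop : MulAction.stabilizer (FreeGroup A) (ψ o) ≤ loopGroup Γ o) :
    Set.InjOn ψ (verts o Γ) := by
  intro p hp q hq hpq
  obtain ⟨w, hw⟩ := hconn p hp
  obtain ⟨w', hw'⟩ := hconn q hq
  have h1 := hw.eq_smul hψ
  have h2 := hw'.eq_smul hψ
  obtain ⟨z, hz, hzr⟩ := hloop (x := FreeGroup.mk w * (FreeGroup.mk w')⁻¹) (by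
    rw [MulAction.mem_stabilizer_iff, mul_smul]
    nth_rw 1 [h2]
    rw [inv_smul_smul, ← hpq, ← h1])
  refine hf.eq_of_reads_of_mk_eq (w := w) (w' := z ++ w') ?_ hw (hzr.append hw')
  rw [← FreeGroup.mul_mk, hz, inv_mul_cancel_right]

/-- Folding a graph whose first Betti number `r` is the minimal number of generators of the
stabilizer: the number of edges drops by exactly one in each step, and so the images of a subgraph
form a chain of identifications in which each step other than a folding increases the first Betti
number by one. -/
theorem exists_mergeChain {r : ℕ} (hconn : IsConn o Γ) (hψ : IsCompat ψ Γ)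
    (hloop : MulAction.stabilizer (FreeGroup A) (ψ o) ≤ loopGroup Γ o)
    (hr : ∀ G : Finset (FreeGroup A), Subgroup.closure (G : Set (FreeGroup A)) =
      MulAction.stabilizer (FreeGroup A) (ψ o) → r ≤ G.card)
    (hrank : Γ.card + 1 ≤ r + (verts o Γ).card) (hW : W ⊆ Γ) :
    ∃ (Γ' W' : Finset (V × A × V)) (l : List (V × V)) (c : ℕ), MergeChain o W l c W' ∧ W' ⊆ Γ' ∧
      IsFolded Γ' ∧ IsConn o Γ' ∧ Set.InjOn ψ (verts o Γ') ∧
      r + (verts o Γ').card ≤ Γ'.card + 1 ∧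
      c + (verts o W').card + W.card ≤ W'.card + (verts o W).card := by
  induction hn : (verts o Γ).card generalizing Γ W with
  | zero => exact absurd hn (Finset.card_ne_zero_of_mem base_mem_verts)
  | succ n ih =>
    by_cases hf : IsFolded Γ
    · exact ⟨Γ, W, [], 0, .nil W, hW, hf, hconn, hf.injOn hconn hψ hloop,
        le_card_of_loopGroup_eq hconn hψ hloop hr, by omega⟩
    · obtain ⟨u, v, hp, huv, huo, hWuv⟩ := exists_isFoldPair (o := o) hf W
      have hV := card_verts_merge (o := o) hp.mem_verts.1 hp.mem_verts.2 huv huo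
      have hconn' := hconn.merge (u := u) (v := v) huo
      have hψ' := hψ.merge (hp.apply_eq hψ)
      have hloop' := hloop.trans (loopGroup_le_merge (v := v) huo)
      have hr' := le_card_of_loopGroup_eq hconn' hψ' hloop' hr
      have hlt := hp.card_merge_lt huv
      -- By minimality of `r`, the folding does not lower the first Betti number.
      have hE : Γ.card ≤ (mapGraph (mergeMap u v) Γ).card + 1 := by omega
      obtain ⟨Γ', W', l, c, hch, hW', h1, h2, h3, h4, h5⟩ :=
        ih (W := mapGraph (mergeMap u v) W) hconn' hψ' hloop' (by omega)
          (Finset.image_subset_image hW) (by omega)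
      by_cases hu : u ∈ verts o W
      · have hv := hWuv hu
        have hVW := card_verts_merge hu hv huv huo
        by_cases hWf : IsFoldPair W u v
        · have := card_le_card_merge_add_one hW hE
          exact ⟨Γ', W', _, c, .fold hu hv huv huo hWf hch, hW', h1, h2, h3, h4, by omega⟩
        · have := hp.card_le_card_merge huv hW hE hWf
          exact ⟨Γ', W', _, c + 1, .glue hu hv huv huo hWf hch, hW', h1, h2, h3, h4, by omega⟩
      · rw [mapGraph_merge_of_notMem hu] at hch h5
        exact ⟨Γ', W', l, c, hch, hW', h1, h2, h3, h4, h5⟩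

end Folding

/-! ### Complete folded graphs -/

section Complete

variable {V A : Type*} [DecidableEq V] [DecidableEq A] [Fintype A] {Γ W : Finset (V × A × V)} {o : V}

omit [DecidableEq A] in
theorem IsFolded.card_le (hW : IsFolded W) : W.card ≤ Fintype.card A * (verts o W).card := by
  have := Finset.card_le_card_of_injOn (s := W) (t := (Finset.univ : Finset A) ×ˢ verts o W)
    (fun e => (e.2.1, e.1)) (fun e he => by simpa using fst_mem_verts he) (by
      rintro ⟨p, a, q⟩ he ⟨p', a', q'⟩ he' h
      simp only [Prod.mk.injEq] at h
      obtain ⟨rfl, rfl⟩ := h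
      have : q = q' := (hW _ he _ he' rfl).1 rfl
      rw [this])
  simpa using this

omit [DecidableEq A] in
/-- A connected folded graph is not larger than a complete subgraph. -/
theorem IsFolded.eq_of_card_eq (hΓ : IsFolded Γ) (hconn : IsConn o Γ) (hW : W ⊆ Γ)
    (hcard : Fintype.card A * (verts o W).card ≤ W.card) : W = Γ := by
  have hWf : IsFolded W := fun e he e' he' => hΓ e (hW he) e' (hW he')
  have h1 : ∀ z ∈ verts o W, ∀ a, ∃ e ∈ W, e.2.1 = a ∧ e.1 = z := by
    intro z hz a
    obtain ⟨e, he, h⟩ := Finset.surjOn_of_injOn_of_card_le (s := W)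
      (t := (Finset.univ : Finset A) ×ˢ verts o W) (fun e => (e.2.1, e.1))
      (fun e he => by simpa using fst_mem_verts he) (by
        rintro ⟨p, a, q⟩ he ⟨p', a', q'⟩ he' h
        simp only [Prod.mk.injEq] at h
        obtain ⟨rfl, rfl⟩ := h
        have : q = q' := (hWf _ he _ he' rfl).1 rfl
        rw [this]) (by simpa using hcard) (show (a, z) ∈ _ by simpa using hz)
    simp only [Prod.mk.injEq] at h
    exact ⟨e, he, h⟩
  have h2 : ∀ z ∈ verts o W, ∀ a, ∃ e ∈ W, e.2.1 = a ∧ e.2.2 = z := by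
    intro z hz a
    obtain ⟨e, he, h⟩ := Finset.surjOn_of_injOn_of_card_le (s := W)
      (t := (Finset.univ : Finset A) ×ˢ verts o W) (fun e => (e.2.1, e.2.2))
      (fun e he => by simpa using snd_mem_verts he) (by
        rintro ⟨p, a, q⟩ he ⟨p', a', q'⟩ he' h
        simp only [Prod.mk.injEq] at h
        obtain ⟨rfl, rfl⟩ := h
        have : p = p' := (hWf _ he _ he' rfl).2 rfl
        rw [this]) (by simpa using hcard) (show (a, z) ∈ _ by simpa using hz)
    simp only [Prod.mk.injEq] at h
    exact ⟨e, he, h⟩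
  have h3 : ∀ e ∈ Γ, e.1 ∈ verts o W → e ∈ W := by
    rintro ⟨p, a, q⟩ he hp
    obtain ⟨⟨p', a', q'⟩, he', rfl, rfl⟩ := h1 _ hp a
    have : q = q' := (hΓ _ he _ (hW he') rfl).1 rfl
    rwa [this]
  have h4 : ∀ e ∈ Γ, e.2.2 ∈ verts o W → e ∈ W := by
    rintro ⟨p, a, q⟩ he hq
    obtain ⟨⟨p', a', q'⟩, he', rfl, rfl⟩ := h2 _ hq a
    have : p = p' := (hΓ _ he _ (hW he') rfl).2 rfl
    rwa [this]
  refine hW.antisymm fun e he => h3 e he ?_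
  obtain ⟨w, hw⟩ := hconn e.1 (fst_mem_verts he)
  refine hw.mem_of_closed (S := (verts o W : Set V)) (fun e he => ?_) base_mem_verts
  exact ⟨fun h => snd_mem_verts (h3 e he h), fun h => fst_mem_verts (h4 e he h)⟩

end Complete

/-! ### Attaching loops -/

section Loops

variable {A X : Type*} [DecidableEq A] [MulAction (FreeGroup A) X] {Γ : Finset (ℕ × A × ℕ)}
  {ψ : ℕ → X} {w : List (A × Bool)} {p q : ℕ}

theorem verts_insert_dart {o : ℕ} (x : A × Bool) :
    verts o (insert (dart p x q) Γ) = insert p (insert q (verts o Γ)) := by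
  rw [verts_insert]
  obtain ⟨a, b⟩ := x
  cases b
  · exact Finset.insert_comm _ _ _
  · rfl

theorem IsCompat.insert_dart {x : A × Bool} (hψ : IsCompat ψ Γ)
    (h : ψ p = FreeGroup.mk [x] • ψ q) : IsCompat ψ (insert (dart p x q) Γ) := by
  intro p' a q' he
  rcases Finset.mem_insert.1 he with he | he
  · obtain ⟨a, b⟩ := x
    cases b
    · cases he
      rw [mk_singleton_false, eq_inv_smul_iff] at h
      exact h.symm
    · cases he
      exact h
  · exact hψ _ _ _ he

theorem IsConn.insert_dart {x : A × Bool} {o : ℕ} (h : IsConn o Γ) (hp : p ∈ verts o Γ) :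
    IsConn o (insert (dart p x q) Γ) := by
  intro z hz
  rw [verts_insert_dart] at hz
  have hmem : ∀ z ∈ verts o Γ, ∃ w, Reads (insert (dart p x q) Γ) o w z := fun z hz => by
    obtain ⟨w, hw⟩ := h z hz
    exact ⟨w, hw.mono (Finset.subset_insert _ _)⟩
  rcases Finset.mem_insert.1 hz with rfl | hz
  · exact hmem z hp
  · rcases Finset.mem_insert.1 hz with rfl | hz
    · obtain ⟨w, hw⟩ := hmem p hp
      exact ⟨_, hw.append (.cons (Finset.mem_insert_self _ _) (.nil _))⟩
    · exact hmem z hz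

/-- Attaching a path between two vertices increases the first Betti number by at most one. -/
theorem exists_attach_path (hw : w ≠ []) (hconn : IsConn 0 Γ) (hψ : IsCompat ψ Γ)
    (hp : p ∈ verts 0 Γ) (hq : q ∈ verts 0 Γ) (hpq : ψ p = FreeGroup.mk w • ψ q) :
    ∃ (Γ' : Finset (ℕ × A × ℕ)) (ψ' : ℕ → X), Γ ⊆ Γ' ∧ (∀ v ∈ verts 0 Γ, ψ' v = ψ v) ∧
      IsConn 0 Γ' ∧ IsCompat ψ' Γ' ∧ Reads Γ' p w q ∧
      Γ'.card + (verts 0 Γ).card ≤ Γ.card + (verts 0 Γ').card + 1 := by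
  induction w generalizing Γ ψ p with
  | nil => exact absurd rfl hw
  | cons x w ih =>
    rcases w with _ | ⟨y, w⟩
    · refine ⟨insert (dart p x q) Γ, ψ, Finset.subset_insert _ _, fun _ _ => rfl,
        hconn.insert_dart hp, hψ.insert_dart hpq, .cons (Finset.mem_insert_self _ _) (.nil _), ?_⟩
      rw [verts_insert_dart, Finset.insert_eq_of_mem hq, Finset.insert_eq_of_mem hp]
      have := Finset.card_insert_le (dart p x q) Γ
      omega
    · obtain ⟨v, hv⟩ := Infinite.exists_notMem_finset (verts 0 Γ)
      let ψ₁ : ℕ → X := update ψ v ((FreeGroup.mk [x])⁻¹ • ψ p)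
      have hψ₁v : ψ₁ v = (FreeGroup.mk [x])⁻¹ • ψ p := update_self _ _ _
      have hψ₁ : ∀ z ∈ verts 0 Γ, ψ₁ z = ψ z := fun z hz =>
        update_of_ne (ne_of_mem_of_not_mem hz hv) _ _
      have hc₁ : IsCompat ψ₁ Γ := fun a b c h => by
        rw [hψ₁ a (fst_mem_verts h), hψ₁ c (snd_mem_verts h)]
        exact hψ a b c h
      have hverts : verts 0 (insert (dart p x v) Γ) = insert v (verts 0 Γ) := by
        rw [verts_insert_dart, Finset.insert_eq_of_mem (Finset.mem_insert_of_mem hp)]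
      obtain ⟨Γ', ψ', h1, h2, h3, h4, h5, h6⟩ := ih (Γ := insert (dart p x v) Γ) (ψ := ψ₁) (p := v)
        (by simp) (hconn.insert_dart hp)
        (hc₁.insert_dart (by rw [hψ₁v, hψ₁ p hp, smul_inv_smul]))
        (by rw [hverts]; exact Finset.mem_insert_self _ _)
        (by rw [hverts]; exact Finset.mem_insert_of_mem hq)
        (by rw [hψ₁v, hψ₁ q hq, hpq, mk_cons x (y :: w), mul_smul, inv_smul_smul])
      refine ⟨Γ', ψ', (Finset.subset_insert _ _).trans h1, fun z hz => ?_, h3, h4,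
        .cons (h1 (Finset.mem_insert_self _ _)) h5, ?_⟩
      · rw [h2 z (by rw [hverts]; exact Finset.mem_insert_of_mem hz), hψ₁ z hz]
      · rw [hverts, Finset.card_insert_of_notMem hv] at h6
        have := Finset.card_insert_le (dart p x v) Γ
        omega

/-- Attaching loops at the base point that carry the elements of `B`. -/
theorem exists_attach_loops (B : Finset (FreeGroup A)) (hconn : IsConn 0 Γ) (hψ : IsCompat ψ Γ)
    (hB : ∀ b ∈ B, b • ψ 0 = ψ 0) :
    ∃ (Γ' : Finset (ℕ × A × ℕ)) (ψ' : ℕ → X), Γ ⊆ Γ' ∧ ψ' 0 = ψ 0 ∧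
      IsConn 0 Γ' ∧ IsCompat ψ' Γ' ∧ (B : Set (FreeGroup A)) ⊆ loopGroup Γ' 0 ∧
      Γ'.card + (verts 0 Γ).card ≤ Γ.card + (verts 0 Γ').card + B.card := by
  induction B using Finset.induction_on with
  | empty => exact ⟨Γ, ψ, subset_rfl, rfl, hconn, hψ, by simp, by simp⟩
  | insert b B hb ih =>
    obtain ⟨Γ₁, ψ₁, h1, h2, h3, h4, h5, h6⟩ := ih fun b hb => hB b (Finset.mem_insert_of_mem hb)
    rw [Finset.card_insert_of_notMem hb, Finset.coe_insert]
    by_cases hb1 : b.toWord = []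
    · refine ⟨Γ₁, ψ₁, h1, h2, h3, h4, Set.insert_subset ?_ h5, by omega⟩
      rw [FreeGroup.toWord_eq_nil_iff.1 hb1]
      exact one_mem _
    · have hfix : ψ₁ 0 = FreeGroup.mk b.toWord • ψ₁ 0 := by
        rw [FreeGroup.mk_toWord, h2, hB b (Finset.mem_insert_self _ _)]
      obtain ⟨Γ', ψ', k1, k2, k3, k4, k5, k6⟩ :=
        exists_attach_path hb1 h3 h4 base_mem_verts base_mem_verts hfix
      exact ⟨Γ', ψ', h1.trans k1, by rw [k2 0 base_mem_verts, h2], k3, k4,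
        Set.insert_subset ⟨_, FreeGroup.mk_toWord, k5⟩ (h5.trans (loopGroup_mono k1)), by omega⟩

end Loops

/-! ### Minimal generating sets containing primitive and simple elements -/

section Minimal

variable {F : Type*} [Group F] {H : Subgroup F}

/-- Generators of `H`, seen inside `H`. -/
theorem exists_generators_subtype {G : Finset F} (hG : Subgroup.closure (G : Set F) = H) :
    ∃ T : Finset H, Subgroup.closure (T : Set H) = ⊤ ∧ T.card ≤ G.card := by
  classical
  refine ⟨G.subtype (· ∈ H), ?_, ?_⟩
  · have hsub : (G : Set F) ⊆ H := hG ▸ Subgroup.subset_closure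
    rw [eq_top_iff]
    rintro ⟨g, hg⟩ -
    have : ((G.subtype (· ∈ H) : Finset H) : Set H) = {x : H | (x : F) ∈ (G : Set F)} := by
      ext x
      simp
    rw [this]
    exact mem_closure_subtype hsub (hG ▸ hg) hg
  · rw [Finset.card_subtype]
    exact Finset.card_filter_le _ _

theorem closure_image_val {T : Set H} (hT : Subgroup.closure T = ⊤) :
    Subgroup.closure (Subtype.val '' T) = H := by
  have := MonoidHom.map_closure H.subtype T
  rw [hT, ← MonoidHom.range_eq_map, Subgroup.range_subtype] at this
  exact this.symm

/-- A primitive element of a finitely generated subgroup belongs to a generating set of minimal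
size. -/
theorem IsPrimitiveElt.exists_minimal [Group.FG H] {g : F} {hg : g ∈ H}
    (h : IsPrimitiveElt (⟨g, hg⟩ : H)) :
    ∃ B : Finset F, g ∈ B ∧ Subgroup.closure (B : Set F) = H ∧
      ∀ G : Finset F, Subgroup.closure (G : Set F) = H → B.card ≤ G.card := by
  classical
  obtain ⟨-, B, hgB, b, hb⟩ := h
  obtain ⟨S, hS⟩ := Group.fg_def.1 (inferInstance : Group.FG H)
  obtain ⟨hfin, -⟩ := b.finite_and_card_le S hS
  have := Fintype.ofFinite B
  have hB : Subgroup.closure B = ⊤ := by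
    rw [← b.closure_range]
    congr 1
    ext x
    exact ⟨fun hx => ⟨⟨x, hx⟩, hb _⟩, fun ⟨y, hy⟩ => by rw [← hy, hb]; exact y.2⟩
  refine ⟨B.toFinset.image Subtype.val, by simpa using ⟨hg, hgB⟩, ?_, fun G hG => ?_⟩
  · rw [Finset.coe_image, Set.coe_toFinset]
    exact closure_image_val hB
  · obtain ⟨T, hT, hTG⟩ := exists_generators_subtype hG
    obtain ⟨-, hc⟩ := b.finite_and_card_le T hT
    have h1 : B.toFinset.card = Nat.card B := by
      rw [Set.toFinset_card, Nat.card_eq_fintype_card]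
    have h2 : (B.toFinset.image Subtype.val).card ≤ _ := Finset.card_image_le
    omega

/-- A simple element of a finitely generated free subgroup belongs to the subgroup generated by a
proper part of a generating set of minimal size. -/
theorem IsSimpleElt.exists_minimal [Group.FG H] [IsFreeGroup H] {g : F} {hg : g ∈ H}
    (h : IsSimpleElt (⟨g, hg⟩ : H)) :
    ∃ B₁ B : Finset F, B₁ ⊆ B ∧ B₁.card < B.card ∧ g ∈ Subgroup.closure (B₁ : Set F) ∧
      Subgroup.closure (B : Set F) = H ∧
      ∀ G : Finset F, Subgroup.closure (G : Set F) = H → B.card ≤ G.card := by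
  classical
  obtain ⟨-, K, ⟨L, hKL⟩, hK, hgK⟩ := h
  let e := MulEquiv.ofBijective _ hKL
  let βK := IsFreeGroup.basis K
  let βL := IsFreeGroup.basis L
  let b : IsFreeGroup.Generators K ⊕ IsFreeGroup.Generators L → H :=
    Sum.elim (fun i => βK i) fun i => βL i
  -- The bases of the two factors form a basis of `H`, but it suffices that homomorphisms to `ℤ/2` can
  -- be prescribed on them: this bounds the size of generating sets from below.
  have hb : ∀ f : IsFreeGroup.Generators K ⊕ IsFreeGroup.Generators L → Multiplicative (ZMod 2),
      ∃ φ : H →* Multiplicative (ZMod 2), ∀ i, φ (b i) = f i := by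
    intro f
    obtain ⟨φK, hφK⟩ := βK.exists_hom fun i => f (.inl i)
    obtain ⟨φL, hφL⟩ := βL.exists_hom fun i => f (.inr i)
    refine ⟨(Monoid.Coprod.lift φK φL).comp e.symm.toMonoidHom, ?_⟩
    have h1 : ∀ k : K, e.symm k = Monoid.Coprod.inl k := fun k => by
      rw [MulEquiv.symm_apply_eq]
      simp [e]
    have h2 : ∀ k : L, e.symm k = Monoid.Coprod.inr k := fun k => by
      rw [MulEquiv.symm_apply_eq]
      simp [e]
    rintro (i | i)
    · simp [b, h1, hφK]
    · simp [b, h2, hφL]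
  have hcK : Subgroup.closure (Set.range fun i => (βK i : H)) = K := by
    have : (Set.range fun i => (βK i : H)) = Subtype.val '' Set.range βK := by
      rw [← Set.range_comp]; rfl
    rw [this]
    exact closure_image_val βK.closure_range
  have hcL : Subgroup.closure (Set.range fun i => (βL i : H)) = L := by
    have : (Set.range fun i => (βL i : H)) = Subtype.val '' Set.range βL := by
      rw [← Set.range_comp]; rfl
    rw [this]
    exact closure_image_val βL.closure_range
  have hsup : K ⊔ L = ⊤ := by
    have := MonoidHom.range_eq_top.2 hKL.2
    rwa [Monoid.Coprod.range_lift, Subgroup.range_subtype, Subgroup.range_subtype] at this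
  obtain ⟨S, hS⟩ := Group.fg_def.1 (inferInstance : Group.FG H)
  obtain ⟨hfin, -⟩ := finite_and_card_le_of_generators b hb S hS
  have : Finite (IsFreeGroup.Generators K) := Finite.sum_left (IsFreeGroup.Generators L)
  have : Finite (IsFreeGroup.Generators L) := Finite.sum_right (IsFreeGroup.Generators K)
  have := Fintype.ofFinite (IsFreeGroup.Generators K)
  have := Fintype.ofFinite (IsFreeGroup.Generators L)
  have hL : 0 < Fintype.card (IsFreeGroup.Generators L) := by
    by_contra hcon
    have : IsEmpty (IsFreeGroup.Generators L) := Fintype.card_eq_zero_iff.1 (by omega)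
    rw [Set.range_eq_empty, Subgroup.closure_empty] at hcL
    rw [← hcL, sup_bot_eq] at hsup
    exact hK hsup
  let B₁ : Finset F := Finset.univ.image fun i => ((βK i : H) : F)
  let B : Finset F := Finset.univ.image fun i => ((b i : H) : F)
  have hBcl : Subgroup.closure (B : Set F) = H := by
    have h1 : (B : Set F) = Subtype.val '' Set.range b := by
      rw [← Set.range_comp]
      simp [B, comp_def]
    rw [h1]
    refine closure_image_val ?_
    rw [Set.Sum.elim_range, Subgroup.closure_union, hcK, hcL, hsup]
  have hmin : ∀ G : Finset F, Subgroup.closure (G : Set F) = H →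
      Fintype.card (IsFreeGroup.Generators K) + Fintype.card (IsFreeGroup.Generators L) ≤
        G.card := by
    intro G hG
    obtain ⟨T, hT, hTG⟩ := exists_generators_subtype hG
    obtain ⟨-, hc⟩ := finite_and_card_le_of_generators b hb T hT
    rw [Nat.card_eq_fintype_card, Fintype.card_sum] at hc
    omega
  have hBcard : B.card ≤
      Fintype.card (IsFreeGroup.Generators K) + Fintype.card (IsFreeGroup.Generators L) := by
    refine Finset.card_image_le.trans ?_
    rw [Finset.card_univ, Fintype.card_sum]
  have hB₁card : B₁.card ≤ Fintype.card (IsFreeGroup.Generators K) :=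
    Finset.card_image_le.trans (by simp)
  refine ⟨B₁, B, fun x hx => ?_, ?_, ?_, hBcl, fun G hG => hBcard.trans (hmin G hG)⟩
  · obtain ⟨i, -, rfl⟩ := Finset.mem_image.1 hx
    exact Finset.mem_image.2 ⟨.inl i, Finset.mem_univ _, rfl⟩
  · have := hmin B hBcl
    omega
  · have h1 : (B₁ : Set F) = H.subtype '' (Set.range fun i => (βK i : H)) := by
      rw [← Set.range_comp]
      simp [B₁, comp_def]
    rw [h1, ← MonoidHom.map_closure, hcK]
    exact ⟨⟨g, hg⟩, hgK, rfl⟩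

end Minimal

/-! ### From free bases to graphs -/

section Completeness

variable {A : Type*} [DecidableEq A] [Fintype A]

omit [Fintype A] in
theorem isCompat_circle {X : Type*} [MulAction (FreeGroup A) X] {w : List (A × Bool)} {x₀ : X}
    (h : FreeGroup.mk w • x₀ = x₀) :
    IsCompat (fun i => (FreeGroup.mk (w.take i))⁻¹ • x₀) (pathEdges (circlePath w.length) w) := by
  intro p a q he
  obtain ⟨i, hi, he⟩ := mem_pathEdges.1 he
  have h1 : (FreeGroup.mk (w.take (circlePath w.length (i + 1))))⁻¹ • x₀ =
      (FreeGroup.mk (w.take (i + 1)))⁻¹ • x₀ := by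
    unfold circlePath
    split_ifs with hlt
    · rfl
    · rw [show i + 1 = w.length by omega, List.take_length, List.take_zero, ← FreeGroup.one_eq_mk,
        inv_one, one_smul, eq_inv_smul_iff, h]
  have h2 : circlePath w.length i = i := if_pos hi
  have h3 : FreeGroup.mk (w.take (i + 1)) = FreeGroup.mk (w.take i) * FreeGroup.mk [w[i]] := by
    rw [FreeGroup.mul_mk, List.take_succ_eq_append_getElem hi]
  have key : (FreeGroup.mk (w.take (circlePath w.length i)))⁻¹ • x₀ = FreeGroup.mk [w[i]] •
      (FreeGroup.mk (w.take (circlePath w.length (i + 1))))⁻¹ • x₀ := by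
    rw [h1, h2, h3, mul_inv_rev, mul_smul, smul_inv_smul]
  rcases hwi : w[i] with ⟨a', b⟩
  rw [hwi] at he key
  cases b
  · cases he
    rw [mk_singleton_false, eq_inv_smul_iff] at key
    exact key.symm
  · cases he
    exact key

omit [Fintype A] in
theorem isConn_circle {w : List (A × Bool)} : IsConn 0 (pathEdges (circlePath w.length) w) := by
  have := isConn_pathEdges (s := circlePath w.length) (w := w)
  rwa [show circlePath w.length 0 = 0 by simp [circlePath]] at this

omit [Fintype A] in
theorem length_le_card_verts_circle {w : List (A × Bool)} :
    w.length ≤ (verts 0 (pathEdges (circlePath w.length) w)).card := by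
  have : Finset.range w.length ⊆ verts 0 (pathEdges (circlePath w.length) w) := by
    intro i hi
    have h0 : circlePath w.length 0 = 0 := by simp [circlePath]
    have := (mem_verts_pathEdges (s := circlePath w.length) (w := w) (p := i)).2
      ⟨i, (Finset.mem_range.1 hi).le, if_pos (Finset.mem_range.1 hi)⟩
    rwa [h0] at this
  simpa using Finset.card_le_card this

omit [Fintype A] in
theorem reads_circle {w : List (A × Bool)} :
    Reads (pathEdges (circlePath w.length) w) 0 w 0 := by
  have := reads_pathEdges (s := circlePath w.length) (w := w)
  simpa [circlePath] using this

/-- If `w` is primitive in a subgroup of finite index, then the circle spelling `w` leads without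
waste to a folded graph whose number of vertices is at most the index. -/
theorem exists_mergeChain_of_isPrimitiveElt {w : List (A × Bool)} {H : Subgroup (FreeGroup A)}
    [H.FiniteIndex] {hg : FreeGroup.mk w ∈ H}
    (h : IsPrimitiveElt (⟨FreeGroup.mk w, hg⟩ : H)) :
    ∃ (E' : Finset (ℕ × A × ℕ)) (l : List (ℕ × ℕ)) (c : ℕ),
      MergeChain 0 (pathEdges (circlePath w.length) w) l c E' ∧ IsFolded E' ∧
      (verts 0 E').card ≤ H.index ∧
      c + (verts 0 E').card + (pathEdges (circlePath w.length) w).card ≤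
        E'.card + (verts 0 (pathEdges (circlePath w.length) w)).card := by
  obtain ⟨B, hgB, hBH, hmin⟩ := h.exists_minimal
  let x₀ : FreeGroup A ⧸ H := ((1 : FreeGroup A) : FreeGroup A ⧸ H)
  have hst : MulAction.stabilizer (FreeGroup A) x₀ = H := MulAction.stabilizer_quotient H
  have hBst : ∀ b ∈ B, b • x₀ = x₀ := fun b hb => by
    rw [← MulAction.mem_stabilizer_iff, hst, ← hBH]
    exact Subgroup.subset_closure hb
  set W := pathEdges (circlePath w.length) w with hW
  let ψ : ℕ → FreeGroup A ⧸ H := fun i => (FreeGroup.mk (w.take i))⁻¹ • x₀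
  have hψ : IsCompat ψ W := isCompat_circle (hBst _ hgB)
  have hψ0 : ψ 0 = x₀ := by simp [ψ, ← FreeGroup.one_eq_mk]
  obtain ⟨Γ, ψ', hWΓ, hψ'0, hconn, hψ', hBΓ, hcard⟩ := exists_attach_loops (Γ := W)
    (B.erase (FreeGroup.mk w)) isConn_circle hψ fun b hb => by
      rw [hψ0, hBst b (Finset.mem_of_mem_erase hb)]
  rw [hψ0] at hψ'0
  have hloop : MulAction.stabilizer (FreeGroup A) (ψ' 0) ≤ loopGroup Γ 0 := by
    rw [hψ'0, hst, ← hBH, Subgroup.closure_le]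
    intro b hb
    by_cases hbw : b = FreeGroup.mk w
    · rw [hbw]
      exact ⟨w, rfl, reads_circle.mono hWΓ⟩
    · exact hBΓ (by simpa [hbw] using hb)
  rw [Finset.card_erase_of_mem hgB] at hcard
  have hBpos : 0 < B.card := Finset.card_pos.2 ⟨_, hgB⟩
  have h1 : W.card ≤ w.length := card_pathEdges_le
  have h2 : w.length ≤ (verts 0 W).card := length_le_card_verts_circle
  obtain ⟨Γ', W', l, c, hch, hW', hf, -, hinj, -, hle⟩ := exists_mergeChain (r := B.card) hconn hψ'
    hloop (fun G hG => hmin G (by rw [hG, hψ'0, hst])) (by omega) hWΓ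
  refine ⟨W', l, c, hch, fun e he e' he' => hf e (hW' he) e' (hW' he'), ?_, hle⟩
  have := Fintype.ofFinite (FreeGroup A ⧸ H)
  rw [Subgroup.index, Nat.card_eq_fintype_card, ← Finset.card_univ]
  exact Finset.card_le_card_of_injOn ψ' (fun _ _ => by simp)
    (hinj.mono (Finset.coe_subset.2 (verts_subset hW')))

/-- If the reduced word `w` is simple in a subgroup of finite index, then some closed path spelling
`w` leads without waste to a folded graph with `m` vertices, where `m` is at most the index, and its
first Betti number is less than the rank of subgroups of index `m`. -/
theorem exists_mergeChain_of_isSimpleElt {w : List (A × Bool)} (hw : FreeGroup.IsReduced w)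
    {H : Subgroup (FreeGroup A)} [H.FiniteIndex] {hg : FreeGroup.mk w ∈ H}
    (h : IsSimpleElt (⟨FreeGroup.mk w, hg⟩ : H)) :
    ∃ (s : ℕ → ℕ) (E' : Finset (ℕ × A × ℕ)) (l : List (ℕ × ℕ)) (c : ℕ), s 0 = 0 ∧
      s w.length = 0 ∧ MergeChain 0 (pathEdges s w) l c E' ∧ IsFolded E' ∧
      (verts 0 E').card ≤ H.index ∧
      c + (verts 0 E').card + (pathEdges s w).card ≤ E'.card + (verts 0 (pathEdges s w)).card ∧
      (pathEdges s w).card + (verts 0 E').card <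
        (verts 0 (pathEdges s w)).card + Fintype.card A * (verts 0 E').card := by
  obtain ⟨B₁, B, hB₁, hlt, hgB, hBH, hmin⟩ := h.exists_minimal
  let x₀ : FreeGroup A ⧸ H := ((1 : FreeGroup A) : FreeGroup A ⧸ H)
  have hst : MulAction.stabilizer (FreeGroup A) x₀ = H := MulAction.stabilizer_quotient H
  have hBst : ∀ b ∈ B, b • x₀ = x₀ := fun b hb => by
    rw [← MulAction.mem_stabilizer_iff, hst, ← hBH]
    exact Subgroup.subset_closure hb
  -- A bouquet spelling `B₁` folds to a graph in which `w` is read along a closed path.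
  obtain ⟨Γ₀, ψ₀, -, hψ₀0, hconn₀, hψ₀, hB₁Γ₀, hcard₀⟩ := exists_attach_loops (Γ := ∅)
    (ψ := fun _ => x₀) B₁
    (fun p hp => ⟨[], by
      have : p = 0 := by simpa [verts] using hp
      rw [this]; exact .nil 0⟩)
    (fun p a q h => absurd h (Finset.notMem_empty _)) fun b hb => hBst b (hB₁ hb)
  obtain ⟨Γ₁, -, -, hf₁, hconn₁, hψ₁, hle₁, hcard₁⟩ := exists_folded hconn₀ hψ₀
  have hread : Reads Γ₁ 0 w 0 := by
    obtain ⟨z, hz, hzr⟩ := hle₁ ((Subgroup.closure_le _).2 hB₁Γ₀ hgB)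
    have := hf₁.reads_red FreeGroup.reduce.red hzr
    rwa [FreeGroup.reduce.sound hz, hw.reduce_eq] at this
  obtain ⟨s, hs0, hsn, hs⟩ := hread.exists_path
  have hconnW : IsConn 0 (pathEdges s w) := hs0 ▸ isConn_pathEdges
  have hbetti := card_add_verts_le hconnW hconn₁ hψ₁ hs
  -- With loops for the rest of `B` the graph carries all of `H`.
  obtain ⟨Γ₂, ψ₂, hΓ₂, hψ₂0, hconn₂, hψ₂, hBΓ₂, hcard₂⟩ := exists_attach_loops (B \ B₁)
    hconn₁ hψ₁ fun b hb => by rw [hψ₀0]; exact hBst b (Finset.mem_sdiff.1 hb).1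
  have h0 : ψ₂ 0 = x₀ := by rw [hψ₂0, hψ₀0]
  have hloop : MulAction.stabilizer (FreeGroup A) (ψ₂ 0) ≤ loopGroup Γ₂ 0 := by
    rw [h0, hst, ← hBH, Subgroup.closure_le]
    intro b hb
    by_cases hb₁ : b ∈ B₁
    · exact loopGroup_mono hΓ₂ (hle₁ (hB₁Γ₀ hb₁))
    · exact hBΓ₂ (by simpa [hb₁] using hb)
  have hsd := Finset.card_sdiff_add_card_eq_card hB₁
  have hv0 : (verts 0 (∅ : Finset (ℕ × A × ℕ))).card = 1 := by simp [verts]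
  rw [hv0, Finset.card_empty] at hcard₀
  obtain ⟨Γ', W', l, c, hch, hW', hf, hconn', hinj, hr, hle⟩ := exists_mergeChain (r := B.card)
    hconn₂ hψ₂ hloop (fun G hG => hmin G (by rw [hG, h0, hst])) (by omega) (hs.trans hΓ₂)
  have hfW' : IsFolded W' := fun e he e' he' => hf e (hW' he) e' (hW' he')
  refine ⟨s, W', l, c, hs0, hsn, hch, hfW', ?_, hle, ?_⟩
  · have := Fintype.ofFinite (FreeGroup A ⧸ H)
    rw [Subgroup.index, Nat.card_eq_fintype_card, ← Finset.card_univ]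
    exact Finset.card_le_card_of_injOn ψ₂ (fun _ _ => by simp)
      (hinj.mono (Finset.coe_subset.2 (verts_subset hW')))
  · have hW'card := hfW'.card_le (o := 0)
    rcases hW'card.lt_or_eq with hlt' | heq
    · omega
    · -- A complete `W'` is all of `Γ'`, whose first Betti number exceeds `|B₁|`.
      have := hf.eq_of_card_eq hconn' hW' heq.ge
      subst this
      omega

end Completeness

/-! ### Bounding the search -/

section Relabel

variable {V V' A : Type*} [DecidableEq V] [DecidableEq V'] [DecidableEq A]
  {E E' : Finset (V × A × V)} {o : V} {l : List (V × V)} {c : ℕ}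

theorem MergeChain.verts_subset (h : MergeChain o E l c E') : verts o E' ⊆ verts o E := by
  induction h with
  | nil => exact subset_rfl
  | fold hu hv huv huo _ _ ih =>
    exact ih.trans fun p hp => ((mem_verts_merge hv huv huo).1 hp).1
  | glue hu hv huv huo _ _ ih =>
    exact ih.trans fun p hp => ((mem_verts_merge hv huv huo).1 hp).1

theorem MergeChain.length_le (h : MergeChain o E l c E') : l.length ≤ (verts o E).card := by
  induction h with
  | nil => simp
  | fold hu hv huv huo _ _ ih =>
    have := card_verts_merge hu hv huv huo
    rw [List.length_cons]
    omega
  | glue hu hv huv huo _ _ ih =>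
    have := card_verts_merge hu hv huv huo
    rw [List.length_cons]
    omega

theorem MergeChain.mem_verts (h : MergeChain o E l c E') :
    ∀ p ∈ l, p.1 ∈ verts o E ∧ p.2 ∈ verts o E := by
  induction h with
  | nil => simp
  | fold hu hv huv huo _ _ ih =>
    rintro p hp
    rcases List.mem_cons.1 hp with rfl | hp
    · exact ⟨hu, hv⟩
    · exact (ih p hp).imp (fun h => ((mem_verts_merge hv huv huo).1 h).1)
        fun h => ((mem_verts_merge hv huv huo).1 h).1
  | glue hu hv huv huo _ _ ih =>
    rintro p hp
    rcases List.mem_cons.1 hp with rfl | hp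
    · exact ⟨hu, hv⟩
    · exact (ih p hp).imp (fun h => ((mem_verts_merge hv huv huo).1 h).1)
        fun h => ((mem_verts_merge hv huv huo).1 h).1

theorem card_mapGraph {σ : V → V'} (hσ : Set.InjOn σ (verts o E)) :
    (mapGraph σ E).card = E.card := by
  refine Finset.card_image_of_injOn ?_
  rintro ⟨p, a, q⟩ he ⟨p', a', q'⟩ he' h
  simp only [Prod.mk.injEq] at h
  have h1 : p = p' := hσ (fst_mem_verts he) (fst_mem_verts he') h.1
  have h2 : q = q' := hσ (snd_mem_verts he) (snd_mem_verts he') h.2.2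
  rw [h1, h.2.1, h2]

theorem card_verts_mapGraph {σ : V → V'} (hσ : Set.InjOn σ (verts o E)) :
    (verts (σ o) (mapGraph σ E)).card = (verts o E).card := by
  rw [verts_mapGraph]
  exact Finset.card_image_of_injOn hσ

theorem IsFolded.mapGraph {σ : V → V'} (hσ : Set.InjOn σ (verts o E)) (h : IsFolded E) :
    IsFolded (mapGraph σ E) := by
  intro e he e' he' hl
  obtain ⟨p, a, q, hf, rfl⟩ := mem_mapGraph.1 he
  obtain ⟨p', a', q', hf', rfl⟩ := mem_mapGraph.1 he'
  have h1 : σ p = σ p' ↔ p = p' := hσ.eq_iff (fst_mem_verts hf) (fst_mem_verts hf')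
  have h2 : σ q = σ q' ↔ q = q' := hσ.eq_iff (snd_mem_verts hf) (snd_mem_verts hf')
  simp only at hl ⊢
  rw [h1, h2]
  exact h _ hf _ hf' hl

theorem isFoldPair_mapGraph {σ : V → V'} (hσ : Set.InjOn σ (verts o E)) {u v : V}
    (hu : u ∈ verts o E) (hv : v ∈ verts o E) :
    IsFoldPair (mapGraph σ E) (σ u) (σ v) ↔ IsFoldPair E u v := by
  constructor
  · rintro ⟨e, he, e', he', hl, h⟩
    obtain ⟨p, a, q, hf, rfl⟩ := mem_mapGraph.1 he
    obtain ⟨p', a', q', hf', rfl⟩ := mem_mapGraph.1 he'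
    have hp : p ∈ verts o E := fst_mem_verts hf
    have hq : q ∈ verts o E := snd_mem_verts hf
    have hp' : p' ∈ verts o E := fst_mem_verts hf'
    have hq' : q' ∈ verts o E := snd_mem_verts hf'
    simp only at hl h
    rw [hσ.eq_iff hp hp', hσ.eq_iff hq hq', hσ.eq_iff hq hu, hσ.eq_iff hq' hv, hσ.eq_iff hp hu,
      hσ.eq_iff hp' hv] at h
    exact ⟨_, hf, _, hf', hl, h⟩
  · rintro ⟨⟨p, a, q⟩, he, ⟨p', a', q'⟩, he', hl, h⟩
    refine ⟨_, mem_mapGraph_of_mem he, _, mem_mapGraph_of_mem he', hl, ?_⟩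
    rcases h with ⟨h0, h1, h2⟩ | ⟨h0, h1, h2⟩
    · exact .inl ⟨congrArg σ h0, congrArg σ h1, congrArg σ h2⟩
    · exact .inr ⟨congrArg σ h0, congrArg σ h1, congrArg σ h2⟩

theorem mapGraph_mergeMap {σ : V → V'} (hσ : Set.InjOn σ (verts o E)) {u v : V}
    (hu : u ∈ verts o E) :
    mapGraph (mergeMap (σ u) (σ v)) (mapGraph σ E) = mapGraph σ (mapGraph (mergeMap u v) E) := by
  have h : ∀ z ∈ verts o E, mergeMap (σ u) (σ v) (σ z) = σ (mergeMap u v z) := fun z hz => by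
    by_cases hzu : z = u
    · rw [hzu, mergeMap_self, mergeMap_self]
    · rw [mergeMap_of_ne hzu, mergeMap_of_ne fun h => hzu (hσ hz hu h)]
  unfold mapGraph
  rw [Finset.image_image, Finset.image_image]
  refine Finset.image_congr fun e he => ?_
  simp only [comp_apply]
  rw [h _ (fst_mem_verts he), h _ (snd_mem_verts he)]

/-- Chains of identifications are preserved by relabelling the vertices. -/
theorem MergeChain.map (h : MergeChain o E l c E') {σ : V → V'}
    (hσ : Set.InjOn σ (verts o E)) :
    MergeChain (σ o) (mapGraph σ E) (l.map (Prod.map σ σ)) c (mapGraph σ E') := by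
  induction h with
  | nil => exact .nil _
  | @fold E E' u v l c hu hv huv huo hf h ih =>
    have hmem : ∀ {z}, z ∈ verts o E → σ z ∈ verts (σ o) (mapGraph σ E) := fun hz => by
      rw [verts_mapGraph]; exact Finset.mem_image_of_mem _ hz
    refine .fold (hmem hu) (hmem hv) (fun h => huv (hσ hu hv h))
      (fun h => huo (hσ hu base_mem_verts h)) ((isFoldPair_mapGraph hσ hu hv).2 hf) ?_
    rw [mapGraph_mergeMap hσ hu]
    exact ih (hσ.mono fun p hp => ((mem_verts_merge hv huv huo).1 hp).1)
  | @glue E E' u v l c hu hv huv huo hf h ih =>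
    have hmem : ∀ {z}, z ∈ verts o E → σ z ∈ verts (σ o) (mapGraph σ E) := fun hz => by
      rw [verts_mapGraph]; exact Finset.mem_image_of_mem _ hz
    refine .glue (hmem hu) (hmem hv) (fun h => huv (hσ hu hv h))
      (fun h => huo (hσ hu base_mem_verts h)) (fun h => hf ((isFoldPair_mapGraph hσ hu hv).1 h)) ?_
    rw [mapGraph_mergeMap hσ hu]
    exact ih (hσ.mono fun p hp => ((mem_verts_merge hv huv huo).1 hp).1)

omit [DecidableEq V] [DecidableEq V'] [DecidableEq A] in
theorem dart_map {σ : V → V'} (p q : V) (x : A × Bool) :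
    dart (σ p) x (σ q) = (σ (dart p x q).1, (dart p x q).2.1, σ (dart p x q).2.2) := by
  unfold dart
  split_ifs <;> rfl

theorem mapGraph_pathEdges {σ : V → V'} (s : ℕ → V) (w : List (A × Bool)) :
    mapGraph σ (pathEdges s w) = pathEdges (σ ∘ s) w := by
  unfold mapGraph pathEdges
  rw [Finset.image_image]
  exact Finset.image_congr fun i _ => (dart_map _ _ _).symm

end Relabel

section LeadsTo

variable {A : Type*} [DecidableEq A]

/-- The closed path spelling `w` through the vertices `s` leads, without waste, to a folded graph
with `m` vertices: the first Betti number grows by at least the number of the identifications that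
are not foldings. -/
def LeadsTo (s : ℕ → ℕ) (w : List (A × Bool)) (m : ℕ) : Prop :=
  ∃ (E' : Finset (ℕ × A × ℕ)) (l : List (ℕ × ℕ)) (c : ℕ), MergeChain 0 (pathEdges s w) l c E' ∧
    IsFolded E' ∧ (verts 0 E').card = m ∧
    c + m + (pathEdges s w).card ≤ E'.card + (verts 0 (pathEdges s w)).card

/-- The first Betti number of the closed path spelling `w` through the vertices `s` is less than
the rank `1 + m (|A| - 1)` of the subgroups of index `m`. -/
def IsSmall [Fintype A] (s : ℕ → ℕ) (w : List (A × Bool)) (m : ℕ) : Prop :=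
  (pathEdges s w).card + m < (verts 0 (pathEdges s w)).card + Fintype.card A * m

/-- A closed path can be relabelled so that each vertex becomes the time of the first visit. -/
theorem LeadsTo.exists_bounded [Fintype A] {s : ℕ → ℕ} {w : List (A × Bool)} {m : ℕ}
    (h : LeadsTo s w m) (h0 : s 0 = 0) (hn : s w.length = 0) (hs : IsSmall s w m) :
    ∃ s' : ℕ → ℕ, s' 0 = 0 ∧ s' w.length = 0 ∧ (∀ i, i < w.length → s' i < w.length) ∧
      LeadsTo s' w m ∧ IsSmall s' w m := by
  obtain ⟨E', l, c, hch, hf, hm, hc⟩ := h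
  let σ : ℕ → ℕ := fun v => sInf {i | s i = v}
  have hsσ : ∀ i, s (σ (s i)) = s i := fun i => Nat.sInf_mem (s := {j | s j = s i}) ⟨i, rfl⟩
  have hle : ∀ i, σ (s i) ≤ i := fun i => Nat.sInf_le (s := {j | s j = s i}) rfl
  have hσ0 : σ 0 = 0 := by
    have := hle 0
    rw [h0] at this
    omega
  have hσ : Set.InjOn σ (verts 0 (pathEdges s w)) := by
    intro p hp q hq hpq
    rw [← h0, Finset.mem_coe, mem_verts_pathEdges] at hp hq
    obtain ⟨i, -, rfl⟩ := hp
    obtain ⟨j, -, rfl⟩ := hq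
    rw [← hsσ i, hpq, hsσ j]
  have hσ' : Set.InjOn σ (verts 0 E') := hσ.mono (Finset.coe_subset.2 hch.verts_subset)
  have hE := card_mapGraph hσ
  have hV := card_verts_mapGraph hσ
  have hE' := card_mapGraph hσ'
  have hV' := card_verts_mapGraph hσ'
  have hmap := hch.map hσ
  rw [hσ0, mapGraph_pathEdges] at hV hmap
  rw [mapGraph_pathEdges] at hE
  rw [hσ0] at hV'
  refine ⟨σ ∘ s, by simp [h0, hσ0], by simp [hn, hσ0], fun i hi => (hle i).trans_lt hi,
    ⟨_, _, c, hmap, hf.mapGraph hσ', by rw [hV', hm], ?_⟩, ?_⟩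
  · rw [hE, hV, hE']
    exact hc
  · unfold IsSmall
    rw [hE, hV]
    exact hs

/-- The search succeeds: the circle folds to a graph whose first Betti number is not smaller. -/
theorem exists_leadsTo_circle {w : List (A × Bool)} (hw : FreeGroup.mk w ≠ 1) :
    ∃ m, LeadsTo (circlePath w.length) w m := by
  let x₀ : FreeGroup A ⧸ (⊤ : Subgroup (FreeGroup A)) := ((1 : FreeGroup A) : FreeGroup A ⧸ _)
  have hψ := isCompat_circle (w := w) (x₀ := x₀) (QuotientGroup.subsingleton_quotient_top.elim _ _)
  obtain ⟨E', l, hch, hf, hconn, hψ', hloop, -⟩ := exists_folded isConn_circle hψ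
  refine ⟨_, E', l, 0, hch, hf, rfl, ?_⟩
  have h1 : (pathEdges (circlePath w.length) w).card ≤ w.length := card_pathEdges_le
  have h2 := length_le_card_verts_circle (w := w)
  -- The folded graph still carries the nontrivial element `w`, so its Betti number is positive.
  have h3 : (verts 0 E').card ≤ E'.card := by
    obtain ⟨t, G, hG, hGc⟩ := exists_genSystem hconn hψ'
    obtain ⟨z, hz, hzr⟩ := hloop ⟨w, rfl, reads_circle⟩
    have hmem := hG.loop hzr
    rw [hz] at hmem
    rcases G.eq_empty_or_nonempty with rfl | hne
    · exact absurd (by simpa using hmem) hw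
    · have := hne.card_pos
      omega
  omega

/-- The vertices of a closed path that is labelled by `0, …, |w| - 1`, and hence those of the graphs
it leads to, are bounded by the length of `w`. -/
theorem LeadsTo.le_length {s : ℕ → ℕ} {w : List (A × Bool)} {m : ℕ} (h : LeadsTo s w m)
    (hw : w ≠ []) (h0 : s 0 = 0) (hs : ∀ i < w.length, s i < w.length) (hn : s w.length = 0) :
    verts 0 (pathEdges s w) ⊆ Finset.range w.length ∧ m ≤ w.length := by
  have hpos := List.length_pos_iff.2 hw
  have hsub : verts 0 (pathEdges s w) ⊆ Finset.range w.length := by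
    intro p hp
    rw [← h0, mem_verts_pathEdges] at hp
    obtain ⟨i, hi, rfl⟩ := hp
    rcases hi.lt_or_eq with hi | rfl
    · exact Finset.mem_range.2 (hs i hi)
    · rw [hn]; exact Finset.mem_range.2 hpos
  obtain ⟨E', l, c, hch, -, rfl, -⟩ := h
  exact ⟨hsub, by simpa using Finset.card_le_card (hch.verts_subset.trans hsub)⟩

variable [Fintype A]

/-- The primitivity index in terms of circles. -/
theorem isPrimitivityIndex_iff {w : List (A × Bool)} (hw : FreeGroup.mk w ≠ 1) {d : ℕ} :
    IsPrimitivityIndex (FreeGroup.mk w) d ↔ IsLeast {m | LeadsTo (circlePath w.length) w m} d := by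
  have h1 : ∀ m, LeadsTo (circlePath w.length) w m → ∃ H : Subgroup (FreeGroup A),
      H.FiniteIndex ∧ H.index = m ∧ ∃ hg : FreeGroup.mk w ∈ H,
        IsPrimitiveElt (⟨FreeGroup.mk w, hg⟩ : H) := by
    rintro m ⟨E', l, c, hch, hf, rfl, hc⟩
    exact hch.exists_isPrimitiveElt hw hf hc
  have h2 : ∀ m, (∃ H : Subgroup (FreeGroup A),
      H.FiniteIndex ∧ H.index = m ∧ ∃ hg : FreeGroup.mk w ∈ H,
        IsPrimitiveElt (⟨FreeGroup.mk w, hg⟩ : H)) →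
      ∃ m' ≤ m, LeadsTo (circlePath w.length) w m' := by
    rintro m ⟨H, hH, rfl, hg, h⟩
    obtain ⟨E', l, c, hch, hf, hm, hc⟩ := exists_mergeChain_of_isPrimitiveElt h
    exact ⟨_, hm, E', l, c, hch, hf, rfl, hc⟩
  constructor
  · rintro ⟨hd, hmin⟩
    obtain ⟨m, hm, hlm⟩ := h2 d hd
    exact ⟨(hm.antisymm (hmin (h1 m hlm))) ▸ hlm, fun m hm => hmin (h1 m hm)⟩
  · rintro ⟨hd, hmin⟩
    refine ⟨h1 d hd, fun m hm => ?_⟩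
    obtain ⟨m', hm', hl⟩ := h2 m hm
    exact (hmin hl).trans hm'

/-- The simplicity index of a reduced word in terms of closed paths. -/
theorem isSimplicityIndex_iff {w : List (A × Bool)} (hw : FreeGroup.mk w ≠ 1)
    (hred : FreeGroup.IsReduced w) {d : ℕ} :
    IsSimplicityIndex (FreeGroup.mk w) d ↔
      IsLeast {m | ∃ s : ℕ → ℕ, s 0 = 0 ∧ s w.length = 0 ∧ (∀ i, i < w.length → s i < w.length) ∧
        LeadsTo s w m ∧ IsSmall s w m} d := by
  set P : ℕ → Prop := fun m => ∃ s : ℕ → ℕ, s 0 = 0 ∧ s w.length = 0 ∧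
    (∀ i, i < w.length → s i < w.length) ∧ LeadsTo s w m ∧ IsSmall s w m with hP
  have h1 : ∀ m, P m → ∃ H : Subgroup (FreeGroup A),
      H.FiniteIndex ∧ H.index = m ∧ ∃ hg : FreeGroup.mk w ∈ H,
        IsSimpleElt (⟨FreeGroup.mk w, hg⟩ : H) := by
    rintro m ⟨s, hs0, hsn, -, ⟨E', l, c, hch, hf, rfl, hc⟩, hsm⟩
    exact hch.exists_isSimpleElt hw hs0 hsn hf hc hsm
  have h2 : ∀ m, (∃ H : Subgroup (FreeGroup A),
      H.FiniteIndex ∧ H.index = m ∧ ∃ hg : FreeGroup.mk w ∈ H,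
        IsSimpleElt (⟨FreeGroup.mk w, hg⟩ : H)) →
      ∃ m' ≤ m, P m' := by
    rintro m ⟨H, hH, rfl, hg, h⟩
    obtain ⟨s, E', l, c, hs0, hsn, hch, hf, hm, hc, hsm⟩ := exists_mergeChain_of_isSimpleElt hred h
    exact ⟨_, hm, LeadsTo.exists_bounded ⟨E', l, c, hch, hf, rfl, hc⟩ hs0 hsn hsm⟩
  constructor
  · rintro ⟨hd, hmin⟩
    obtain ⟨m, hm, hlm⟩ := h2 d hd
    exact ⟨(hm.antisymm (hmin (h1 m hlm))) ▸ hlm, fun m hm => hmin (h1 m hm)⟩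
  · rintro ⟨hd, hmin⟩
    refine ⟨h1 d hd, fun m hm => ?_⟩
    obtain ⟨m', hm', hl⟩ := h2 m hm
    exact (hmin hl).trans hm'

/-- A circle has Betti number one, which is less than the rank of every subgroup of finite index. -/
theorem isSmall_circle (hA : 2 ≤ Fintype.card A) {w : List (A × Bool)} {m : ℕ}
    (h : LeadsTo (circlePath w.length) w m) : IsSmall (circlePath w.length) w m := by
  have hm : 0 < m := by
    obtain ⟨E', l, c, -, -, rfl, -⟩ := h
    exact Finset.card_pos.2 ⟨0, base_mem_verts⟩
  have h1 : (pathEdges (circlePath w.length) w).card ≤ w.length := card_pathEdges_le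
  have h2 := length_le_card_verts_circle (w := w)
  unfold IsSmall
  nlinarith

end LeadsTo

/-! ### The search on lists -/

section Search

variable {A : Type*} [DecidableEq A]

/-- The edges of the closed path spelling `w` through the vertices listed in `s`; positions beyond
the end of `s` count as the base point `0`. -/
def edgeList {A : Type*} (s : List ℕ) (w : List (A × Bool)) : List (ℕ × A × ℕ) :=
  (List.range w.length).filterMap fun i =>
    w[i]?.map fun x => dart (s.getD i 0) x (s.getD (i + 1) 0)

/-- The vertices of a graph given by a list of edges. -/
def vertList {A : Type*} (E : List (ℕ × A × ℕ)) : List ℕ :=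
  0 :: (E.map (fun e => e.1) ++ E.map fun e => e.2.2)

/-- `IsFoldPair` for lists of edges. -/
def FoldPairIn {A : Type*} (E : List (ℕ × A × ℕ)) (p : ℕ × ℕ) : Prop :=
  ∃ e ∈ E, ∃ e' ∈ E, e.2.1 = e'.2.1 ∧
    (e.1 = e'.1 ∧ e.2.2 = p.1 ∧ e'.2.2 = p.2 ∨ e.2.2 = e'.2.2 ∧ e.1 = p.1 ∧ e'.1 = p.2)

open Classical in
/-- One identification in a state consisting of a list of edges and the number of identifications
so far that were not foldings. A pair that may not be identified leaves the state as it is. -/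
noncomputable def mergeStep {A : Type*} (st : List (ℕ × A × ℕ) × ℕ) (p : ℕ × ℕ) :
    List (ℕ × A × ℕ) × ℕ :=
  if (∃ u ∈ vertList st.1, u = p.1) ∧ (∃ v ∈ vertList st.1, v = p.2) ∧ p.1 ≠ p.2 ∧ p.1 ≠ 0 then
    (st.1.map fun e => (mergeMap p.1 p.2 e.1, e.2.1, mergeMap p.1 p.2 e.2.2),
      if FoldPairIn st.1 p then st.2 else st.2 + 1)
  else st

/-- All lists of length `k` with entries in `L`. -/
def listsOfLength {α : Type*} (L : List α) : ℕ → List (List α)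
  | 0 => [[]]
  | k + 1 => L.flatMap fun a => (listsOfLength L k).map (a :: ·)

theorem mem_listsOfLength {α : Type*} {L : List α} {k : ℕ} {l : List α} :
    l ∈ listsOfLength L k ↔ l.length = k ∧ ∀ a ∈ l, a ∈ L := by
  induction k generalizing l with
  | zero =>
    simp only [listsOfLength, List.mem_singleton, List.length_eq_zero_iff]
    constructor
    · rintro rfl; simp
    · exact fun h => h.1
  | succ k ih =>
    simp only [listsOfLength, List.mem_flatMap, List.mem_map, ih]
    constructor
    · rintro ⟨a, ha, l, ⟨rfl, hl⟩, rfl⟩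
      simpa using ⟨ha, hl⟩
    · rintro ⟨hk, hl⟩
      rcases l with _ | ⟨a, l⟩
      · simp at hk
      · exact ⟨a, hl a (by simp), l, ⟨by simpa using hk, fun b hb => hl b (by simp [hb])⟩, rfl⟩

theorem toFinset_edgeList (s : List ℕ) (w : List (A × Bool)) :
    (edgeList s w).toFinset = pathEdges (fun i => s.getD i 0) w := by
  ext e
  simp only [edgeList, List.mem_toFinset, List.mem_filterMap, List.mem_range, mem_pathEdges,
    Option.map_eq_some_iff]
  constructor
  · rintro ⟨i, hi, x, hx, rfl⟩
    obtain ⟨_, rfl⟩ := List.getElem?_eq_some_iff.1 hx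
    exact ⟨i, hi, rfl⟩
  · rintro ⟨i, hi, rfl⟩
    exact ⟨i, hi, _, List.getElem?_eq_getElem hi, rfl⟩

theorem toFinset_vertList (E : List (ℕ × A × ℕ)) :
    (vertList E).toFinset = verts 0 E.toFinset := by
  ext p
  simp [vertList, verts]

theorem foldPairIn_iff {E : List (ℕ × A × ℕ)} {u v : ℕ} :
    FoldPairIn E (u, v) ↔ IsFoldPair E.toFinset u v := by
  simp only [FoldPairIn, IsFoldPair, List.mem_toFinset]

theorem toFinset_map_merge (E : List (ℕ × A × ℕ)) (u v : ℕ) :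
    (E.map fun e => (mergeMap u v e.1, e.2.1, mergeMap u v e.2.2)).toFinset =
      mapGraph (mergeMap u v) E.toFinset := by
  ext e
  simp [mapGraph]

theorem mergeStep_of_not {st : List (ℕ × A × ℕ) × ℕ} {u v : ℕ}
    (h : ¬ (u ∈ verts 0 st.1.toFinset ∧ v ∈ verts 0 st.1.toFinset ∧ u ≠ v ∧ u ≠ 0)) :
    mergeStep st (u, v) = st := by
  refine if_neg fun h' => h ?_
  simp only [exists_eq_right] at h'
  rwa [← toFinset_vertList, List.mem_toFinset, List.mem_toFinset]

open Classical in
theorem mergeStep_of {st : List (ℕ × A × ℕ) × ℕ} {u v : ℕ}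
    (hu : u ∈ verts 0 st.1.toFinset) (hv : v ∈ verts 0 st.1.toFinset) (huv : u ≠ v) (huo : u ≠ 0) :
    mergeStep st (u, v) = (st.1.map fun e => (mergeMap u v e.1, e.2.1, mergeMap u v e.2.2),
      if IsFoldPair st.1.toFinset u v then st.2 else st.2 + 1) := by
  rw [← toFinset_vertList, List.mem_toFinset] at hu hv
  refine (if_pos ⟨⟨u, hu, rfl⟩, ⟨v, hv, rfl⟩, huv, huo⟩).trans ?_
  simp only [foldPairIn_iff]

/-- The steps of a list that are admissible form a chain of identifications. -/
theorem exists_mergeChain_foldl (l : List (ℕ × ℕ)) (st : List (ℕ × A × ℕ) × ℕ) :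
    ∃ l' c, MergeChain 0 st.1.toFinset l' c (l.foldl mergeStep st).1.toFinset ∧
      (l.foldl mergeStep st).2 = st.2 + c := by
  classical
  induction l generalizing st with
  | nil => exact ⟨[], 0, .nil _, rfl⟩
  | cons p l ih =>
    obtain ⟨u, v⟩ := p
    rw [List.foldl_cons]
    by_cases h : u ∈ verts 0 st.1.toFinset ∧ v ∈ verts 0 st.1.toFinset ∧ u ≠ v ∧ u ≠ 0
    · obtain ⟨hu, hv, huv, huo⟩ := h
      rw [mergeStep_of hu hv huv huo]
      obtain ⟨l', c, hch, hc⟩ := ih (st.1.map fun e => (mergeMap u v e.1, e.2.1, mergeMap u v e.2.2),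
        if IsFoldPair st.1.toFinset u v then st.2 else st.2 + 1)
      rw [hc]
      simp only [toFinset_map_merge] at hch
      by_cases hf : IsFoldPair st.1.toFinset u v
      · exact ⟨_, c, .fold hu hv huv huo hf hch, by rw [if_pos hf]⟩
      · exact ⟨_, c + 1, .glue hu hv huv huo hf hch, by rw [if_neg hf]; omega⟩
    · rw [mergeStep_of_not h]
      exact ih st

theorem MergeChain.foldl_eq {E E' : Finset (ℕ × A × ℕ)} {l : List (ℕ × ℕ)} {c : ℕ}
    (h : MergeChain 0 E l c E') (st : List (ℕ × A × ℕ) × ℕ) (hst : st.1.toFinset = E) :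
    (l.foldl mergeStep st).1.toFinset = E' ∧ (l.foldl mergeStep st).2 = st.2 + c := by
  classical
  induction h generalizing st with
  | nil => exact ⟨hst, rfl⟩
  | @fold E E' u v l c hu hv huv huo hf _ ih =>
    subst hst
    rw [List.foldl_cons, mergeStep_of hu hv huv huo, if_pos hf]
    exact ih (st.1.map fun e => (mergeMap u v e.1, e.2.1, mergeMap u v e.2.2), st.2)
      (toFinset_map_merge _ _ _)
  | @glue E E' u v l c hu hv huv huo hf _ ih =>
    subst hst
    rw [List.foldl_cons, mergeStep_of hu hv huv huo, if_neg hf]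
    obtain ⟨h1, h2⟩ := ih (st.1.map fun e => (mergeMap u v e.1, e.2.1, mergeMap u v e.2.2),
      st.2 + 1) (toFinset_map_merge _ _ _)
    exact ⟨h1, h2.trans (by simp only; omega)⟩

/-- Pairs that may not be identified serve to pad the list of identifications. -/
theorem foldl_mergeStep_replicate (k : ℕ) (st : List (ℕ × A × ℕ) × ℕ) :
    (List.replicate k (0, 0)).foldl mergeStep st = st := by
  induction k with
  | zero => rfl
  | succ k ih => rw [List.replicate_succ, List.foldl_cons, mergeStep_of_not (by simp), ih]

/-- `IsFolded` for lists of edges. -/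
def FoldedList {A : Type*} (E : List (ℕ × A × ℕ)) : Prop :=
  ∀ e ∈ E, ∀ e' ∈ E, e.2.1 ≠ e'.2.1 ∨
    (e.1 = e'.1 ∧ e.2.2 = e'.2.2 ∨ ¬ e.1 = e'.1 ∧ ¬ e.2.2 = e'.2.2)

theorem foldedList_iff {E : List (ℕ × A × ℕ)} : FoldedList E ↔ IsFolded E.toFinset := by
  simp only [FoldedList, IsFolded, List.mem_toFinset]
  refine forall₄_congr fun e _ e' _ => ?_
  tauto

/-- The list `l` of identifications witnesses `LeadsTo` for the closed path `s`. -/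
def IsWitness (w : List (A × Bool)) (m : ℕ) (s : List ℕ) (l : List (ℕ × ℕ)) : Prop :=
  FoldedList (l.foldl mergeStep (edgeList s w, 0)).1 ∧
  (vertList (l.foldl mergeStep (edgeList s w, 0)).1).dedup.length = m ∧
  (l.foldl mergeStep (edgeList s w, 0)).2 + m + (edgeList s w).dedup.length ≤
    (l.foldl mergeStep (edgeList s w, 0)).1.dedup.length +
      (vertList (edgeList s w)).dedup.length

/-- `LeadsTo` as a bounded search. All lists of identifications are padded to the length of `w`. -/
def LeadsToSearch (w : List (A × Bool)) (m : ℕ) (s : List ℕ) : Prop :=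
  ∃ l ∈ listsOfLength ((List.range w.length).flatMap fun i =>
    (List.range w.length).map fun j => (i, j)) w.length, IsWitness w m s l

theorem length_dedup_edgeList (s : List ℕ) (w : List (A × Bool)) :
    (edgeList s w).dedup.length = (pathEdges (fun i => s.getD i 0) w).card := by
  rw [← toFinset_edgeList, List.card_toFinset]

theorem length_dedup_vertList (E : List (ℕ × A × ℕ)) :
    (vertList E).dedup.length = (verts 0 E.toFinset).card := by
  rw [← toFinset_vertList, List.card_toFinset]

theorem isWitness_iff {w : List (A × Bool)} {m : ℕ} {s : List ℕ} {l : List (ℕ × ℕ)} :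
    IsWitness w m s l ↔ IsFolded (l.foldl mergeStep (edgeList s w, 0)).1.toFinset ∧
      (verts 0 (l.foldl mergeStep (edgeList s w, 0)).1.toFinset).card = m ∧
      (l.foldl mergeStep (edgeList s w, 0)).2 + m + (pathEdges (fun i => s.getD i 0) w).card ≤
        (l.foldl mergeStep (edgeList s w, 0)).1.toFinset.card +
          (verts 0 (pathEdges (fun i => s.getD i 0) w)).card := by
  unfold IsWitness
  rw [foldedList_iff, length_dedup_vertList, length_dedup_vertList, length_dedup_edgeList,
    toFinset_edgeList, List.card_toFinset]

theorem leadsToSearch_iff {w : List (A × Bool)} {m : ℕ} {s : List ℕ}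
    (hw : w ≠ []) (h0 : s.getD 0 0 = 0) (hlen : s.length = w.length)
    (hs : ∀ i ∈ s, i < w.length) :
    LeadsToSearch w m s ↔ LeadsTo (fun i => s.getD i 0) w m := by
  constructor
  · rintro ⟨l, -, h⟩
    obtain ⟨h1, h2, h3⟩ := isWitness_iff.1 h
    obtain ⟨l', c, hch, hc⟩ := exists_mergeChain_foldl l (edgeList s w, 0)
    simp only [zero_add] at hc
    rw [hc] at h3
    rw [toFinset_edgeList] at hch
    exact ⟨_, l', c, hch, h1, h2, h3⟩
  · intro h
    have hn : s.getD w.length 0 = 0 := List.getD_eq_default _ _ (by omega)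
    have hs' : ∀ i < w.length, s.getD i 0 < w.length := fun i hi => by
      rw [List.getD_eq_getElem _ _ (by omega)]
      exact hs _ (List.getElem_mem _)
    obtain ⟨hsub, -⟩ := h.le_length hw h0 hs' hn
    obtain ⟨E', l, c, hch, hf, hm, hc⟩ := h
    have hll : l.length ≤ w.length :=
      hch.length_le.trans (by simpa using Finset.card_le_card hsub)
    have hpos := List.length_pos_iff.2 hw
    have hlmem : ∀ p ∈ l, p.1 < w.length ∧ p.2 < w.length := fun p hp =>
      (hch.mem_verts p hp).imp (fun h => Finset.mem_range.1 (hsub h))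
        fun h => Finset.mem_range.1 (hsub h)
    obtain ⟨h1, h2⟩ := hch.foldl_eq (edgeList s w, 0) (toFinset_edgeList _ _)
    refine ⟨l ++ List.replicate (w.length - l.length) (0, 0), mem_listsOfLength.2 ⟨?_, ?_⟩,
      isWitness_iff.2 ?_⟩
    · simp [hll]
    · rintro ⟨i, j⟩ hp
      have : i < w.length ∧ j < w.length := by
        rcases List.mem_append.1 hp with hp | hp
        · exact hlmem _ hp
        · cases List.eq_of_mem_replicate hp
          exact ⟨hpos, hpos⟩
      simp [this]
    · rw [List.foldl_append, foldl_mergeStep_replicate, h1, h2]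
      exact ⟨hf, hm, by simp only; omega⟩

variable [Fintype A]

/-- `IsSmall` for paths given by lists. -/
def SmallList (w : List (A × Bool)) (m : ℕ) (s : List ℕ) : Prop :=
  (edgeList s w).dedup.length + m <
    (vertList (edgeList s w)).dedup.length + Fintype.card A * m

theorem smallList_iff {w : List (A × Bool)} {m : ℕ} {s : List ℕ} :
    SmallList w m s ↔ IsSmall (fun i => s.getD i 0) w m := by
  unfold SmallList IsSmall
  rw [length_dedup_vertList, length_dedup_edgeList, toFinset_edgeList]

/-- The search for a simple element among the closed paths spelling `w`. -/
def SimpleSearch (w : List (A × Bool)) (m : ℕ) : Prop :=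
  ∃ s ∈ listsOfLength (List.range w.length) w.length,
    s.getD 0 0 = 0 ∧ SmallList w m s ∧ LeadsToSearch w m s

omit [Fintype A] in
theorem leadsToSearch_range_iff {w : List (A × Bool)} {m : ℕ} (hw : w ≠ []) :
    LeadsToSearch w m (List.range w.length) ↔ LeadsTo (circlePath w.length) w m := by
  have hfun : (fun i => (List.range w.length).getD i 0) = circlePath w.length := by
    funext i
    unfold circlePath
    split_ifs with h
    · rw [List.getD_eq_getElem _ _ (by simpa using h), List.getElem_range]
    · exact List.getD_eq_default _ _ (by simpa using h)
  rw [← hfun]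
  refine leadsToSearch_iff hw ?_ (by simp) (by simp)
  exact (congrFun hfun 0).trans (by simp [circlePath])

theorem simpleSearch_iff {w : List (A × Bool)} {m : ℕ} (hw : w ≠ []) :
    SimpleSearch w m ↔ ∃ s : ℕ → ℕ, s 0 = 0 ∧ s w.length = 0 ∧
      (∀ i, i < w.length → s i < w.length) ∧ LeadsTo s w m ∧ IsSmall s w m := by
  have hpos := List.length_pos_iff.2 hw
  constructor
  · rintro ⟨s, hs, h0, hsm, hl⟩
    obtain ⟨hlen, hs⟩ := mem_listsOfLength.1 hs
    have hs' : ∀ i ∈ s, i < w.length := fun i hi => List.mem_range.1 (hs i hi)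
    rw [leadsToSearch_iff hw h0 hlen hs'] at hl
    refine ⟨fun i => s.getD i 0, h0, List.getD_eq_default _ _ (by omega), fun i hi => ?_, hl,
      smallList_iff.1 hsm⟩
    simp only
    rw [List.getD_eq_getElem _ _ (by omega)]
    exact hs' _ (List.getElem_mem _)
  · rintro ⟨s, h0, hn, hs, hl, hsm⟩
    let sl : List ℕ := (List.range w.length).map s
    have hget : ∀ i < w.length, sl.getD i 0 = s i := fun i hi => by
      rw [List.getD_eq_getElem _ _ (by simpa [sl] using hi)]
      simp [sl]
    have hget' : ∀ i ≤ w.length, sl.getD i 0 = s i := fun i hi => by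
      rcases hi.lt_or_eq with hi | rfl
      · exact hget i hi
      · rw [hn]
        exact List.getD_eq_default _ _ (by simp [sl])
    have hpath : pathEdges (fun i => sl.getD i 0) w = pathEdges s w := by
      ext e
      simp only [mem_pathEdges]
      refine exists₂_congr fun i hi => ?_
      rw [hget' i hi.le, hget' (i + 1) hi]
    have hsl : ∀ i ∈ sl, i < w.length := fun i hi => by
      obtain ⟨j, hj, rfl⟩ := List.mem_map.1 hi
      exact hs j (List.mem_range.1 hj)
    have hlen : sl.length = w.length := by simp [sl]
    have h0' : sl.getD 0 0 = 0 := by rw [hget 0 hpos, h0]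
    refine ⟨sl, mem_listsOfLength.2 ⟨hlen, fun i hi => List.mem_range.2 (hsl i hi)⟩, h0',
      smallList_iff.2 ?_, (leadsToSearch_iff hw h0' hlen hsl).2 ?_⟩
    · unfold IsSmall
      rw [hpath]
      exact hsm
    · unfold LeadsTo
      rw [hpath]
      exact hl

end Search

/-! ### The search is primitive recursive -/

section Primrec

open Primrec

variable {A α : Type*} [Primcodable A] [Primcodable α]

theorem primrec_dedup [DecidableEq α] : Primrec (List.dedup : List α → List α) := by
  have hmem : PrimrecRel fun (L : List α) (a : α) => ∃ b ∈ L, b = a :=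
    PrimrecRel.exists_mem_list Primrec.eq
  have : Primrec fun L : List α =>
      L.foldr (fun a r => if ∃ b ∈ r, b = a then r else a :: r) [] := by
    refine list_foldr (h := fun _ p => if ∃ b ∈ p.2, b = p.1 then p.2 else p.1 :: p.2)
      Primrec.id (const []) ?_
    exact Primrec.ite (hmem.comp (snd.comp snd) (fst.comp snd)) (snd.comp snd)
      (list_cons.comp (fst.comp snd) (snd.comp snd))
  refine this.of_eq fun L => ?_
  induction L with
  | nil => rfl
  | cons a L ih =>
    rw [List.foldr_cons, ih]
    by_cases h : a ∈ L
    · rw [List.dedup_cons_of_mem h, if_pos ⟨a, List.mem_dedup.2 h, rfl⟩]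
    · rw [List.dedup_cons_of_notMem h, if_neg]
      rintro ⟨b, hb, rfl⟩
      exact h (List.mem_dedup.1 hb)

theorem primrec_listsOfLength : Primrec₂ fun (L : List α) k => listsOfLength L k := by
  have : Primrec₂ fun (L : List α) (k : ℕ) =>
      (Nat.rec [[]] (fun _ r => L.flatMap fun a => r.map (a :: ·)) k : List (List α)) := by
    refine nat_rec (f := fun _ => [[]])
      (g := fun (L : List α) (p : ℕ × List (List α)) => L.flatMap fun a => p.2.map (a :: ·))
      (const _) ?_
    refine list_flatMap (f := fun q : List α × ℕ × List (List α) => q.1)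
      (g := fun (q : List α × ℕ × List (List α)) (a : α) => q.2.2.map (a :: ·)) fst ?_
    exact list_map (f := fun q : (List α × ℕ × List (List α)) × α => q.1.2.2)
      (g := fun (q : (List α × ℕ × List (List α)) × α) (l : List α) => q.2 :: l)
      (snd.comp (snd.comp fst)) (list_cons.comp (snd.comp fst) snd)
  refine this.of_eq fun L k => ?_
  induction k with
  | zero => rfl
  | succ k ih => simp only [listsOfLength, ← ih]

theorem primrec_dart {f g : α → ℕ} {x : α → A × Bool} (hf : Primrec f) (hx : Primrec x)
    (hg : Primrec g) : Primrec fun a => dart (f a) (x a) (g a) := by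
  refine (Primrec.cond (snd.comp hx) (Primrec.pair hf (Primrec.pair (fst.comp hx) hg))
    (Primrec.pair hg (Primrec.pair (fst.comp hx) hf))).of_eq fun a => ?_
  unfold dart
  cases (x a).2 <;> rfl

theorem primrec_edgeList : Primrec₂ fun (s : List ℕ) (w : List (A × Bool)) => edgeList s w := by
  refine listFilterMap (f := fun p : List ℕ × List (A × Bool) => List.range p.2.length)
    (g := fun p i => p.2[i]?.map fun x => dart (p.1.getD i 0) x (p.1.getD (i + 1) 0))
    (list_range.comp (list_length.comp snd)) ?_
  refine option_map (f := fun q : (List ℕ × List (A × Bool)) × ℕ => q.1.2[q.2]?)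
    (g := fun q x => dart (q.1.1.getD q.2 0) x (q.1.1.getD (q.2 + 1) 0))
    (list_getElem?.comp (snd.comp fst) snd) ?_
  refine primrec_dart ?_ snd ?_
  · exact (list_getD 0).comp (fst.comp (fst.comp fst)) (snd.comp fst)
  · exact (list_getD 0).comp (fst.comp (fst.comp fst)) (succ.comp (snd.comp fst))

theorem primrec_vertList : Primrec fun E : List (ℕ × A × ℕ) => vertList E := by
  refine list_cons.comp (const 0) (list_append.comp ?_ ?_)
  · exact list_map Primrec.id (fst.comp snd).to₂
  · exact list_map Primrec.id (snd.comp (snd.comp snd)).to₂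

theorem primrecRel_foldPairIn : PrimrecRel fun (E : List (ℕ × A × ℕ)) p => FoldPairIn E p := by
  have h1 : PrimrecRel fun (e' : ℕ × A × ℕ) (q : (ℕ × A × ℕ) × ℕ × ℕ) => q.1.2.1 = e'.2.1 ∧
      (q.1.1 = e'.1 ∧ q.1.2.2 = q.2.1 ∧ e'.2.2 = q.2.2 ∨
        q.1.2.2 = e'.2.2 ∧ q.1.1 = q.2.1 ∧ e'.1 = q.2.2) := by
    have a1 : Primrec fun p : (ℕ × A × ℕ) × (ℕ × A × ℕ) × ℕ × ℕ => p.2.1.1 :=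
      fst.comp (fst.comp snd)
    have a2 : Primrec fun p : (ℕ × A × ℕ) × (ℕ × A × ℕ) × ℕ × ℕ => p.2.1.2.1 :=
      fst.comp (snd.comp (fst.comp snd))
    have a3 : Primrec fun p : (ℕ × A × ℕ) × (ℕ × A × ℕ) × ℕ × ℕ => p.2.1.2.2 :=
      snd.comp (snd.comp (fst.comp snd))
    have b1 : Primrec fun p : (ℕ × A × ℕ) × (ℕ × A × ℕ) × ℕ × ℕ => p.1.1 := fst.comp fst
    have b2 : Primrec fun p : (ℕ × A × ℕ) × (ℕ × A × ℕ) × ℕ × ℕ => p.1.2.1 :=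
      fst.comp (snd.comp fst)
    have b3 : Primrec fun p : (ℕ × A × ℕ) × (ℕ × A × ℕ) × ℕ × ℕ => p.1.2.2 :=
      snd.comp (snd.comp fst)
    have c1 : Primrec fun p : (ℕ × A × ℕ) × (ℕ × A × ℕ) × ℕ × ℕ => p.2.2.1 :=
      fst.comp (snd.comp snd)
    have c2 : Primrec fun p : (ℕ × A × ℕ) × (ℕ × A × ℕ) × ℕ × ℕ => p.2.2.2 :=
      snd.comp (snd.comp snd)
    exact (Primrec.eq.comp a2 b2).and
      (((Primrec.eq.comp a1 b1).and ((Primrec.eq.comp a3 c1).and (Primrec.eq.comp b3 c2))).or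
        ((Primrec.eq.comp a3 b3).and ((Primrec.eq.comp a1 c1).and (Primrec.eq.comp b1 c2))))
  have h2 : PrimrecRel fun (e : ℕ × A × ℕ) (q : List (ℕ × A × ℕ) × ℕ × ℕ) =>
      ∃ e' ∈ q.1, e.2.1 = e'.2.1 ∧
      (e.1 = e'.1 ∧ e.2.2 = q.2.1 ∧ e'.2.2 = q.2.2 ∨
        e.2.2 = e'.2.2 ∧ e.1 = q.2.1 ∧ e'.1 = q.2.2) :=
    (h1.exists_mem_list).comp (fst.comp snd) (Primrec.pair fst (snd.comp snd))
  exact (h2.exists_mem_list).comp fst Primrec.id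

theorem primrecPred_foldedList : PrimrecPred fun E : List (ℕ × A × ℕ) => FoldedList E := by
  have h1 : PrimrecRel fun (e' e : ℕ × A × ℕ) => e.2.1 ≠ e'.2.1 ∨
      (e.1 = e'.1 ∧ e.2.2 = e'.2.2 ∨ ¬ e.1 = e'.1 ∧ ¬ e.2.2 = e'.2.2) := by
    have a1 : Primrec fun p : (ℕ × A × ℕ) × (ℕ × A × ℕ) => p.2.1 := fst.comp snd
    have a2 : Primrec fun p : (ℕ × A × ℕ) × (ℕ × A × ℕ) => p.2.2.1 := fst.comp (snd.comp snd)
    have a3 : Primrec fun p : (ℕ × A × ℕ) × (ℕ × A × ℕ) => p.2.2.2 := snd.comp (snd.comp snd)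
    have b1 : Primrec fun p : (ℕ × A × ℕ) × (ℕ × A × ℕ) => p.1.1 := fst.comp fst
    have b2 : Primrec fun p : (ℕ × A × ℕ) × (ℕ × A × ℕ) => p.1.2.1 := fst.comp (snd.comp fst)
    have b3 : Primrec fun p : (ℕ × A × ℕ) × (ℕ × A × ℕ) => p.1.2.2 := snd.comp (snd.comp fst)
    exact (Primrec.eq.comp a2 b2).not.or
      (((Primrec.eq.comp a1 b1).and (Primrec.eq.comp a3 b3)).or
        ((Primrec.eq.comp a1 b1).not.and (Primrec.eq.comp a3 b3).not))
  have h2 : PrimrecRel fun (e : ℕ × A × ℕ) (E : List (ℕ × A × ℕ)) =>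
      ∀ e' ∈ E, e.2.1 ≠ e'.2.1 ∨
      (e.1 = e'.1 ∧ e.2.2 = e'.2.2 ∨ ¬ e.1 = e'.1 ∧ ¬ e.2.2 = e'.2.2) :=
    (h1.forall_mem_list).comp snd fst
  exact (h2.forall_mem_list).comp Primrec.id Primrec.id

theorem primrec_mergeMap : Primrec fun p : (ℕ × ℕ) × ℕ => mergeMap p.1.1 p.1.2 p.2 :=
  Primrec.ite (Primrec.eq.comp snd (fst.comp fst)) (snd.comp fst) snd

theorem primrec_mergeStep :
    Primrec₂ fun (st : List (ℕ × A × ℕ) × ℕ) (p : ℕ × ℕ) => mergeStep st p := by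
  classical
  have hmem : PrimrecRel fun (L : List ℕ) (a : ℕ) => ∃ b ∈ L, b = a :=
    PrimrecRel.exists_mem_list Primrec.eq
  have hv : Primrec fun q : (List (ℕ × A × ℕ) × ℕ) × ℕ × ℕ => vertList q.1.1 :=
    primrec_vertList.comp (fst.comp fst)
  have h1 : Primrec fun q : (List (ℕ × A × ℕ) × ℕ) × ℕ × ℕ => q.2.1 := fst.comp snd
  have h2 : Primrec fun q : (List (ℕ × A × ℕ) × ℕ) × ℕ × ℕ => q.2.2 := snd.comp snd
  refine Primrec.ite (((hmem.comp hv h1)).and ((hmem.comp hv h2).and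
    ((Primrec.eq.comp h1 h2).not.and (Primrec.eq.comp h1 (const 0)).not))) ?_ fst
  refine Primrec.pair ?_ (Primrec.ite (primrecRel_foldPairIn.comp (fst.comp fst) snd)
    (snd.comp fst) (succ.comp (snd.comp fst)))
  refine list_map (f := fun q : (List (ℕ × A × ℕ) × ℕ) × ℕ × ℕ => q.1.1)
    (g := fun q e => (mergeMap q.2.1 q.2.2 e.1, e.2.1, mergeMap q.2.1 q.2.2 e.2.2))
    (fst.comp fst) ?_
  have h3 : Primrec fun r : ((List (ℕ × A × ℕ) × ℕ) × ℕ × ℕ) × ℕ × A × ℕ => r.1.2 := snd.comp fst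
  exact Primrec.pair (primrec_mergeMap.comp (Primrec.pair h3 (fst.comp snd)))
    (Primrec.pair (fst.comp (snd.comp snd))
      (primrec_mergeMap.comp (Primrec.pair h3 (snd.comp (snd.comp snd)))))

variable [DecidableEq A]

theorem primrecPred_isWitness :
    PrimrecPred fun q : (List (A × Bool) × ℕ × List ℕ) × List (ℕ × ℕ) =>
      IsWitness q.1.1 q.1.2.1 q.1.2.2 q.2 := by
  have hw : Primrec fun q : (List (A × Bool) × ℕ × List ℕ) × List (ℕ × ℕ) => q.1.1 := fst.comp fst
  have hm : Primrec fun q : (List (A × Bool) × ℕ × List ℕ) × List (ℕ × ℕ) => q.1.2.1 :=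
    fst.comp (snd.comp fst)
  have hs : Primrec fun q : (List (A × Bool) × ℕ × List ℕ) × List (ℕ × ℕ) => q.1.2.2 :=
    snd.comp (snd.comp fst)
  have hE : Primrec fun q : (List (A × Bool) × ℕ × List ℕ) × List (ℕ × ℕ) =>
      edgeList q.1.2.2 q.1.1 := primrec_edgeList.comp hs hw
  have hst : Primrec fun q : (List (A × Bool) × ℕ × List ℕ) × List (ℕ × ℕ) =>
      q.2.foldl mergeStep (edgeList q.1.2.2 q.1.1, 0) :=
    list_foldl (h := fun _ p => mergeStep p.1 p.2) snd (Primrec.pair hE (const 0))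
      (primrec_mergeStep.comp (fst.comp snd) (snd.comp snd))
  refine (primrecPred_foldedList.comp (fst.comp hst)).and ((Primrec.eq.comp (list_length.comp
    (primrec_dedup.comp (primrec_vertList.comp (fst.comp hst)))) hm).and (nat_le.comp ?_ ?_))
  · exact nat_add.comp (nat_add.comp (snd.comp hst) hm) (list_length.comp (primrec_dedup.comp hE))
  · exact nat_add.comp (list_length.comp (primrec_dedup.comp (fst.comp hst)))
      (list_length.comp (primrec_dedup.comp (primrec_vertList.comp hE)))

theorem primrecPred_leadsToSearch :
    PrimrecPred fun q : List (A × Bool) × ℕ × List ℕ => LeadsToSearch q.1 q.2.1 q.2.2 := by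
  have hR : PrimrecRel fun (l : List (ℕ × ℕ)) (q : List (A × Bool) × ℕ × List ℕ) =>
      IsWitness q.1 q.2.1 q.2.2 l := primrecPred_isWitness.comp (Primrec.pair snd fst)
  have hn : Primrec fun q : List (A × Bool) × ℕ × List ℕ => List.range q.1.length :=
    list_range.comp (list_length.comp fst)
  refine (hR.exists_mem_list).comp (primrec_listsOfLength.comp ?_ (list_length.comp fst)) Primrec.id
  refine list_flatMap (g := fun (q : List (A × Bool) × ℕ × List ℕ) i =>
    (List.range q.1.length).map fun j => (i, j)) hn ?_
  exact list_map (f := fun r : (List (A × Bool) × ℕ × List ℕ) × ℕ => List.range r.1.1.length)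
    (g := fun r j => (r.2, j)) (hn.comp fst) (Primrec.pair (snd.comp fst) snd)

variable [Fintype A]

theorem primrecPred_smallList :
    PrimrecPred fun q : List (A × Bool) × ℕ × List ℕ => SmallList q.1 q.2.1 q.2.2 := by
  have hE : Primrec fun q : List (A × Bool) × ℕ × List ℕ => edgeList q.2.2 q.1 :=
    primrec_edgeList.comp (snd.comp snd) fst
  have hm : Primrec fun q : List (A × Bool) × ℕ × List ℕ => q.2.1 := fst.comp snd
  exact nat_lt.comp (nat_add.comp (list_length.comp (primrec_dedup.comp hE)) hm)
    (nat_add.comp (list_length.comp (primrec_dedup.comp (primrec_vertList.comp hE)))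
      (nat_mul.comp (const _) hm))

theorem primrecRel_simpleSearch :
    PrimrecRel fun (w : List (A × Bool)) (m : ℕ) => SimpleSearch w m := by
  have hR : PrimrecRel fun (s : List ℕ) (q : List (A × Bool) × ℕ) =>
      s.getD 0 0 = 0 ∧ SmallList q.1 q.2 s ∧ LeadsToSearch q.1 q.2 s := by
    have h : Primrec fun r : List ℕ × List (A × Bool) × ℕ => (r.2.1, r.2.2, r.1) :=
      Primrec.pair (fst.comp snd) (Primrec.pair (snd.comp snd) fst)
    exact (Primrec.eq.comp ((list_getD 0).comp fst (const 0)) (const 0)).and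
      ((primrecPred_smallList.comp h).and (primrecPred_leadsToSearch.comp h))
  exact (hR.exists_mem_list).comp (primrec_listsOfLength.comp
    (list_range.comp (list_length.comp fst)) (list_length.comp fst)) Primrec.id

omit [Fintype A] in
theorem primrecRel_primitiveSearch :
    PrimrecRel fun (w : List (A × Bool)) (m : ℕ) => LeadsToSearch w m (List.range w.length) :=
  primrecPred_leadsToSearch.comp (Primrec.pair fst (Primrec.pair snd
    (list_range.comp (list_length.comp fst))))

omit [Fintype A] in
theorem primrec_reduce : Primrec (FreeGroup.reduce : List (A × Bool) → List (A × Bool)) := by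
  have : Primrec fun L : List (A × Bool) => L.foldr (fun x r => (List.casesOn r [x] fun y t =>
      if x.1 = y.1 ∧ x.2 = !y.2 then t else x :: y :: t : List (A × Bool))) [] := by
    refine list_foldr (h := fun _ p => (List.casesOn p.2 [p.1] fun y t =>
      if p.1.1 = y.1 ∧ p.1.2 = !y.2 then t else p.1 :: y :: t : List (A × Bool)))
      Primrec.id (const []) ?_
    refine list_casesOn (f := fun q : List (A × Bool) × (A × Bool) × List (A × Bool) => q.2.2)
      (h := fun q z => if q.2.1.1 = z.1.1 ∧ q.2.1.2 = !z.1.2 then z.2 else q.2.1 :: z.1 :: z.2)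
      (snd.comp snd) (list_cons.comp (fst.comp snd) (const [])) ?_
    have hx : Primrec fun r : (List (A × Bool) × (A × Bool) × List (A × Bool)) ×
        (A × Bool) × List (A × Bool) => r.1.2.1 := fst.comp (snd.comp fst)
    have hy : Primrec fun r : (List (A × Bool) × (A × Bool) × List (A × Bool)) ×
        (A × Bool) × List (A × Bool) => r.2.1 := fst.comp snd
    exact Primrec.ite ((Primrec.eq.comp (fst.comp hx) (fst.comp hy)).and
      (Primrec.eq.comp (snd.comp hx) (Primrec.not.comp (snd.comp hy)))) (snd.comp snd)
      (list_cons.comp hx (list_cons.comp hy (snd.comp snd)))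
  refine this.of_eq fun L => ?_
  induction L with
  | nil => rfl
  | cons x L ih => rw [List.foldr_cons, ih, FreeGroup.reduce.cons]

end Primrec

/-! ### Proper powers -/

section Powers

variable {A : Type*} [DecidableEq A]

/-- The word of `h ^ k` consists of a conjugator, `k` copies of the cyclic reduction of `h`, and the
inverse of the conjugator. -/
theorem FreeGroup.norm_pow_eq (h : FreeGroup A) {k : ℕ} (hk : k ≠ 0) :
    (h ^ k).norm = 2 * (FreeGroup.reduceCyclically.conjugator h.toWord).length +
      k * (FreeGroup.reduceCyclically h.toWord).length := by
  rw [FreeGroup.norm, FreeGroup.toWord_pow,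
    FreeGroup.reduceCyclically.reduce_flatten_replicate FreeGroup.isReduced_toWord, if_neg hk]
  simp
  ring

theorem FreeGroup.norm_le_norm_pow (h : FreeGroup A) {k : ℕ} (hk : k ≠ 0) :
    h.norm ≤ (h ^ k).norm := by
  have h1 := h.norm_pow_eq one_ne_zero
  rw [pow_one] at h1
  rw [h1, h.norm_pow_eq hk]
  exact Nat.add_le_add_left (Nat.mul_le_mul_right _ (Nat.one_le_iff_ne_zero.2 hk)) _

theorem FreeGroup.le_norm_pow {h : FreeGroup A} (hh : h ≠ 1) {k : ℕ} : k ≤ (h ^ k).norm := by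
  rcases eq_or_ne k 0 with rfl | hk
  · exact Nat.zero_le _
  have hpos : 0 < (FreeGroup.reduceCyclically h.toWord).length := by
    rw [List.length_pos_iff]
    intro h0
    refine hh ?_
    have := FreeGroup.reduceCyclically.conj_conjugator_reduceCyclically h.toWord
    rw [h0, List.append_nil] at this
    rw [← FreeGroup.mk_toWord (x := h), ← this, ← FreeGroup.mul_mk, ← FreeGroup.inv_mk,
      mul_inv_cancel]
  rw [h.norm_pow_eq hk]
  nlinarith

omit [DecidableEq A] in
theorem FreeGroup.mk_flatten_replicate (h : List (A × Bool)) (k : ℕ) :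
    FreeGroup.mk (List.replicate k h).flatten = FreeGroup.mk h ^ k := by
  induction k with
  | zero => rfl
  | succ k ih => rw [List.replicate_succ, List.flatten_cons, ← FreeGroup.mul_mk, ih, pow_succ']

theorem not_isProperPower_of (a : A) : ¬ IsProperPower (FreeGroup.of a) := by
  rintro ⟨h, k, hk, hp⟩
  have hh : h ≠ 1 := by
    rintro rfl
    rw [one_pow] at hp
    exact FreeGroup.of_ne_one a hp.symm
  have := FreeGroup.le_norm_pow hh (k := k)
  rw [hp, FreeGroup.norm_of] at this
  omega

end Powers

/-! ### The algorithms -/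

section Algorithms

variable {A : Type*}

/-- The words of length at most `n` over the letters in `L`. -/
def wordsUpTo (L : List (A × Bool)) (n : ℕ) : List (List (A × Bool)) :=
  (List.range (n + 1)).flatMap fun k => listsOfLength L k

theorem mem_wordsUpTo {L : List (A × Bool)} (hL : ∀ x, x ∈ L) {n : ℕ} {w : List (A × Bool)} :
    w ∈ wordsUpTo L n ↔ w.length ≤ n := by
  simp [wordsUpTo, mem_listsOfLength, hL]

variable [DecidableEq A]

/-- The search for a proper root of `w` among the words that are not longer than `w`. -/
def PowerSearch (L : List (A × Bool)) (w : List (A × Bool)) : Prop :=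
  ∃ h ∈ wordsUpTo L w.length, ∃ k ∈ List.range (w.length + 1), 2 ≤ k ∧
    FreeGroup.reduce (List.replicate k h).flatten = FreeGroup.reduce w

theorem powerSearch_iff {L : List (A × Bool)} (hL : ∀ x, x ∈ L) {w : List (A × Bool)}
    (hw : FreeGroup.mk w ≠ 1) : PowerSearch L w ↔ IsProperPower (FreeGroup.mk w) := by
  constructor
  · rintro ⟨h, -, k, -, hk, he⟩
    refine ⟨FreeGroup.mk h, k, hk, ?_⟩
    rw [← FreeGroup.mk_flatten_replicate, ← FreeGroup.reduce.self, he, FreeGroup.reduce.self]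
  · rintro ⟨h, k, hk, he⟩
    have hh : h ≠ 1 := by
      rintro rfl
      rw [one_pow] at he
      exact hw he.symm
    have hle : (h ^ k).norm ≤ w.length := he ▸ FreeGroup.norm_mk_le
    refine ⟨h.toWord, (mem_wordsUpTo hL).2 ((h.norm_le_norm_pow (by omega)).trans hle), k,
      List.mem_range.2 (Nat.lt_succ_of_le ((FreeGroup.le_norm_pow hh).trans hle)), hk, ?_⟩
    rw [← FreeGroup.toWord_mk, ← FreeGroup.toWord_mk, FreeGroup.mk_flatten_replicate,
      FreeGroup.mk_toWord, he]

open Classical in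
/-- The least `m < k` with the property `p`. -/
noncomputable def leastBelow (k : ℕ) (p : ℕ → Prop) : ℕ :=
  (List.range k).findIdx fun m => decide (p m)

theorem isLeast_leastBelow {k : ℕ} {p : ℕ → Prop} (h : ∃ m < k, p m) :
    IsLeast {m | p m} (leastBelow k p) := by
  classical
  obtain ⟨m, hm, hp⟩ := h
  have hlt : (List.range k).findIdx (fun m => decide (p m)) < (List.range k).length :=
    List.findIdx_lt_length_of_exists ⟨m, List.mem_range.2 hm, decide_eq_true hp⟩
  constructor
  · have := of_decide_eq_true (List.findIdx_getElem (w := hlt))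
    rwa [List.getElem_range] at this
  · intro j hj
    by_contra! hjl
    have := List.not_of_lt_findIdx hjl
    rw [List.getElem_range] at this
    exact of_decide_eq_false this hj

open Classical in
/-- The maximum of `f` over the members of `l` with the property `p`, or `0` if there are none. -/
noncomputable def maxFilter {β : Type*} (l : List β) (p : β → Prop) (f : β → ℕ) : ℕ :=
  l.foldr (fun b r => if p b then max (f b) r else r) 0

theorem le_maxFilter {β : Type*} {l : List β} {p : β → Prop} {f : β → ℕ} {b : β} (hb : b ∈ l)
    (hp : p b) : f b ≤ maxFilter l p f := by
  induction l with
  | nil => simp at hb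
  | cons c l ih =>
    rw [maxFilter, List.foldr_cons, ← maxFilter]
    rcases List.mem_cons.1 hb with rfl | hb
    · rw [if_pos hp]
      exact le_max_left _ _
    · split_ifs
      · exact (ih hb).trans (le_max_right _ _)
      · exact ih hb

theorem exists_eq_maxFilter {β : Type*} {l : List β} {p : β → Prop} {f : β → ℕ} (h : ∃ b ∈ l, p b) :
    ∃ b ∈ l, p b ∧ f b = maxFilter l p f := by
  have key : (∃ b ∈ l, p b ∧ f b = maxFilter l p f) ∨ (∀ b ∈ l, ¬ p b) ∧ maxFilter l p f = 0 := by
    clear h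
    induction l with
    | nil => exact Or.inr ⟨by simp, rfl⟩
    | cons c l ih =>
      rw [maxFilter, List.foldr_cons, ← maxFilter]
      by_cases hc : p c
      · rw [if_pos hc]
        rcases ih with ⟨b, hb, hp, he⟩ | ⟨-, h0⟩
        · rcases max_choice (f c) (maxFilter l p f) with hm | hm
          · exact Or.inl ⟨c, by simp, hc, hm.symm⟩
          · exact Or.inl ⟨b, by simp [hb], hp, he.trans hm.symm⟩
        · exact Or.inl ⟨c, by simp, hc, by rw [h0, max_eq_left (Nat.zero_le _)]⟩
      · rw [if_neg hc]
        rcases ih with ⟨b, hb, hp, he⟩ | ⟨hl, h0⟩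
        · exact Or.inl ⟨b, by simp [hb], hp, he⟩
        · exact Or.inr ⟨by simpa [hc] using hl, h0⟩
  obtain ⟨b, hb, hp⟩ := h
  exact key.resolve_right fun h => h.1 b hb hp

variable [Fintype A]

/-- The primitivity index and the simplicity index of a word, by a bounded search for its free
reduction. -/
noncomputable def indices (w : List (A × Bool)) : ℕ × ℕ :=
  (leastBelow ((FreeGroup.reduce w).length + 1) fun m =>
      LeadsToSearch (FreeGroup.reduce w) m (List.range (FreeGroup.reduce w).length),
    leastBelow ((FreeGroup.reduce w).length + 1) fun m => SimpleSearch (FreeGroup.reduce w) m)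

theorem indices_spec (hA : 2 ≤ Fintype.card A) {w : List (A × Bool)} (hw : FreeGroup.mk w ≠ 1) :
    IsPrimitivityIndex (FreeGroup.mk w) (indices w).1 ∧
      IsSimplicityIndex (FreeGroup.mk w) (indices w).2 := by
  unfold indices
  have hred : FreeGroup.IsReduced (FreeGroup.reduce w) :=
    FreeGroup.isReduced_iff_reduce_eq.2 FreeGroup.reduce.idem
  rw [← FreeGroup.reduce.self] at hw ⊢
  generalize FreeGroup.reduce w = w at *
  have hne : w ≠ [] := by
    rintro rfl
    exact hw rfl
  have hpos := List.length_pos_iff.2 hne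
  obtain ⟨m, hm⟩ := exists_leadsTo_circle hw
  have h0 : circlePath w.length 0 = 0 := by simp [circlePath]
  have hn : circlePath w.length w.length = 0 := by simp [circlePath]
  have hlt : ∀ i < w.length, circlePath w.length i < w.length := fun i hi => by
    simp [circlePath, hi]
  have hle := (hm.le_length hne h0 hlt hn).2
  constructor
  · rw [isPrimitivityIndex_iff hw]
    simp only [← leadsToSearch_range_iff hne] at hm ⊢
    exact isLeast_leastBelow ⟨m, Nat.lt_succ_of_le hle, hm⟩
  · rw [isSimplicityIndex_iff hw hred]
    simp only [← simpleSearch_iff hne]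
    exact isLeast_leastBelow ⟨m, Nat.lt_succ_of_le hle,
      (simpleSearch_iff hne).2 ⟨_, h0, hn, hlt, hm, isSmall_circle hA hm⟩⟩

/-- Since the index functions are single-valued, the maxima of the index functions over the
elements of norm at most `n` are maxima over a finite list of words. -/
theorem isGreatest_maxFilter {N : ℕ} {L : List (Fin N × Bool)} (hL : ∀ x, x ∈ L) {n : ℕ} (hn : 1 ≤ n)
    (hN : 0 < N) {d : List (Fin N × Bool) → ℕ} {I : FreeGroup (Fin N) → ℕ → Prop}
    (hI : ∀ g a b, I g a → I g b → a = b)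
    (hd : ∀ w, FreeGroup.mk w ≠ 1 → I (FreeGroup.mk w) (d w)) :
    IsGreatest {e | ∃ g : FreeGroup (Fin N), g ≠ 1 ∧ g.norm ≤ n ∧ ¬ IsProperPower g ∧ I g e}
      (maxFilter (wordsUpTo L n) (fun w => FreeGroup.reduce w ≠ [] ∧ ¬ PowerSearch L w) d) := by
  have hne : ∀ w : List (Fin N × Bool), FreeGroup.reduce w ≠ [] ↔ FreeGroup.mk w ≠ 1 := fun w => by
    rw [← FreeGroup.toWord_mk, Ne, FreeGroup.toWord_eq_nil_iff]
  constructor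
  · obtain ⟨w, hw, ⟨h1, h2⟩, he⟩ := exists_eq_maxFilter (f := d)
      (p := fun w => FreeGroup.reduce w ≠ [] ∧ ¬ PowerSearch L w) (l := wordsUpTo L n)
      ⟨[(⟨0, hN⟩, true)], (mem_wordsUpTo hL).2 (by simpa using hn), by simp,
        fun h => not_isProperPower_of (⟨0, hN⟩ : Fin N)
          ((powerSearch_iff hL (FreeGroup.of_ne_one _)).1 h)⟩
    rw [hne] at h1
    rw [← he]
    exact ⟨FreeGroup.mk w, h1, FreeGroup.norm_mk_le.trans ((mem_wordsUpTo hL).1 hw),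
      fun h => h2 ((powerSearch_iff hL h1).2 h), hd w h1⟩
  · rintro e ⟨g, hg, hgn, hgp, he⟩
    have hmk : FreeGroup.mk g.toWord = g := FreeGroup.mk_toWord
    have hg' : FreeGroup.mk g.toWord ≠ 1 := by rwa [hmk]
    rw [hI g e (d g.toWord) he (by simpa only [hmk] using hd g.toWord hg')]
    refine le_maxFilter ((mem_wordsUpTo hL).2 hgn) ⟨(hne _).2 hg', fun h => hgp ?_⟩
    rw [← hmk]
    exact (powerSearch_iff hL hg').1 h

end Algorithms

section Computability

open Primrec

variable {A : Type*} [Primcodable A]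

theorem primrec_wordsUpTo (L : List (A × Bool)) : Primrec (wordsUpTo L) :=
  list_flatMap (g := fun (_ : ℕ) k => listsOfLength L k) (list_range.comp succ)
    (primrec_listsOfLength.comp (const L) snd)

theorem primrec_leastBelow {α : Type*} [Primcodable α] {k : α → ℕ} {p : α → ℕ → Prop}
    (hk : Primrec k) (hp : PrimrecRel p) : Primrec fun a => leastBelow (k a) (p a) := by
  classical
  exact list_findIdx (p := fun a m => decide (p a m)) (list_range.comp hk) hp.decide

theorem primrec_maxFilter {α : Type*} [Primcodable α] {β : Type*} [Primcodable β] {l : α → List β}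
    {p : β → Prop} {f : β → ℕ} (hl : Primrec l) (hp : PrimrecPred p) (hf : Primrec f) :
    Primrec fun a => maxFilter (l a) p f := by
  classical
  exact list_foldr (h := fun _ q => if p q.1 then max (f q.1) q.2 else q.2) hl (const 0)
    (Primrec.ite (hp.comp (fst.comp snd)) (nat_max.comp (hf.comp (fst.comp snd)) (snd.comp snd))
      (snd.comp snd))

variable [DecidableEq A]

theorem primrecPred_powerSearch (L : List (A × Bool)) :
    PrimrecPred fun w : List (A × Bool) => PowerSearch L w := by
  have hrep : Primrec fun r : ℕ × List (A × Bool) × List (A × Bool) =>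
      (List.replicate r.1 r.2.1).flatten := by
    refine (list_flatten.comp (list_map (f := fun r : ℕ × List (A × Bool) × List (A × Bool) =>
      List.range r.1) (g := fun r _ => r.2.1) (list_range.comp fst)
      (fst.comp (snd.comp fst)))).of_eq fun r => ?_
    rw [List.map_const', List.length_range]
  have hk : PrimrecRel fun (k : ℕ) (r : List (A × Bool) × List (A × Bool)) => 2 ≤ k ∧
      FreeGroup.reduce (List.replicate k r.1).flatten = FreeGroup.reduce r.2 :=
    (nat_le.comp (const 2) fst).and (Primrec.eq.comp (primrec_reduce.comp hrep)
      (primrec_reduce.comp (snd.comp snd)))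
  have hh : PrimrecRel fun (h w : List (A × Bool)) => ∃ k ∈ List.range (w.length + 1), 2 ≤ k ∧
      FreeGroup.reduce (List.replicate k h).flatten = FreeGroup.reduce w :=
    hk.exists_mem_list.comp (list_range.comp (succ.comp (list_length.comp snd))) Primrec.id
  exact hh.exists_mem_list.comp ((primrec_wordsUpTo L).comp list_length) Primrec.id

theorem primrec_indices [Fintype A] : Primrec (indices : List (A × Bool) → ℕ × ℕ) := by
  have hk : Primrec fun w : List (A × Bool) => w.length + 1 := succ.comp list_length
  exact Primrec.pair ((primrec_leastBelow hk primrecRel_primitiveSearch).comp primrec_reduce)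
    ((primrec_leastBelow hk primrecRel_simpleSearch).comp primrec_reduce)

end Computability

theorem theoremt (N : ℕ) (hN : 2 ≤ N) :
    (∃ P : List (Fin N × Bool) → ℕ × ℕ, Computable P ∧
      ∀ w : List (Fin N × Bool), FreeGroup.mk w ≠ 1 →
        IsPrimitivityIndex (FreeGroup.mk w) (P w).1 ∧
        IsSimplicityIndex (FreeGroup.mk w) (P w).2) ∧
    (∃ Q : ℕ → ℕ × ℕ, Computable Q ∧
      ∀ n : ℕ, 1 ≤ n →
        IsPrimitivityIndexFnValue N n (Q n).1 ∧
        IsSimplicityIndexFnValue N n (Q n).2) := by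
  have hA : 2 ≤ Fintype.card (Fin N) := by rwa [Fintype.card_fin]
  refine ⟨⟨indices, primrec_indices.to_comp, fun w hw => indices_spec hA hw⟩, ?_⟩
  let L : List (Fin N × Bool) := Finset.univ.toList
  have hL : ∀ x, x ∈ L := fun x => Finset.mem_toList.2 (Finset.mem_univ x)
  have hp : PrimrecPred fun w : List (Fin N × Bool) =>
      FreeGroup.reduce w ≠ [] ∧ ¬ PowerSearch L w :=
    (Primrec.eq.comp primrec_reduce (Primrec.const [])).not.and (primrecPred_powerSearch L).not
  refine ⟨fun n => (maxFilter (wordsUpTo L n) (fun w => FreeGroup.reduce w ≠ [] ∧ ¬ PowerSearch L w)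
      fun w => (indices w).1, maxFilter (wordsUpTo L n)
      (fun w => FreeGroup.reduce w ≠ [] ∧ ¬ PowerSearch L w) fun w => (indices w).2), ?_, ?_⟩
  · exact (Primrec.pair
      (primrec_maxFilter (primrec_wordsUpTo L) hp (Primrec.fst.comp primrec_indices))
      (primrec_maxFilter (primrec_wordsUpTo L) hp (Primrec.snd.comp primrec_indices))).to_comp
  · intro n hn
    exact ⟨isGreatest_maxFilter hL hn (by omega) (fun _ _ _ => IsLeast.unique)
        fun w hw => (indices_spec hA hw).1,
      isGreatest_maxFilter hL hn (by omega) (fun _ _ _ => IsLeast.unique)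
        fun w hw => (indices_spec hA hw).2⟩
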